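/- Let $k$ be an algebraically closed field of characteristic $0$, and let $n\ge 2$, $d\ge 2$. Write $S=k[x_1,\dots,x_n]$ and let $S$ act on $k[y_1,\dots,y_n]$ by differentiation, $h\circ F=h(\partial/\partial y_1,\dots,\partial/\partial y_n)F$; put $F^\perp=\{h\in S: h\circ F=0\}$. Put $s=n(d-1)$, $K=\dim_k S_d=\binom{d+n-1}{n-1}$, and let $T=(t_0,\dots,t_s)=(1,n,\dots,n,1)$ be given by $\sum_i t_iu^i=(1+u+\dots+u^{d-1})^n$. Let $k[z]$ be the polynomial ring in the coefficients $z_m$ of the generic form $\mathcal F=\sum_m z_m y^m$ of degree $s$ ($y^m$ running over the monomials of degree $s$), so that $\operatorname{Spec} k[z]$ is the affine space of forms of degree $s$ in $y_1,\dots,y_n$. For $0\le i\le s$ let $D_i$ be the matrix over $k[z]$ whose columns, indexed by the monomials $x^a$ of degree $i$, consist of the coefficients of $x^a\circ \mathcal F$ with respect to the monomials in $y$ of degree $s-i$. Define the catalecticant schemes as follows. - $\mathbf V=\operatorname{Spec} k[z]/J_1$, where $J_1$ is generated by all $(K-n+1)$-minors of $D_d$. - $\mathbf{Gor}_{\le}(T)=\operatorname{Spec}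 k[z]/J_2$, where $J_2$ is generated by all $(t_i+1)$-minors of $D_i$, $1\le i\le s-1$; and $\mathbf{Gor}(T)$ is the open subscheme of $\mathbf{Gor}_{\le}(T)$ whose closed points are the forms $F$ such that $S/F^\perp$ has Hilbert function $T$. Let $U_{\mathrm{Res}}$ be the set of forms $F\in k[y_1,\dots,y_n]_{s}$ such that $F^\perp\cap S_d$ is $n$-dimensional and has a basis $f_1,\dots,f_n$ with nonvanishing resultant, i.e. with no common zero in $k^n$ other than the origin. Then every $F\in U_{\mathrm{Res}}$ is a closed point of both $\mathbf V$ and $\mathbf{Gor}(T)$. If $X$ is either of these schemes, then $X$ is smooth at $F$, and, more generally, at every (not necessarily closed) point $x\in X$ whose closure contains $F$; that is, the local ring $\mathcal O_{X,x}$ is a regular local ring. Moreover, the Zariski tangent space to $X$ at $F$ has dimension $$N=Kn-n^2+1.$$ -/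

import Mathlib

open AlgebraicGeometry CategoryTheory

namespace Catalecticant

universe u

noncomputable section

/-! ### Forms, differentiation and annihilators -/

/-- Exponent vectors of the monomials of degree `j` in `n` variables. They index the standard
monomial basis of the space of forms of degree `j`. -/
abbrev Mon (n j : ℕ) : Type := {a : Fin n →₀ ℕ // a.degree = j}

instance (n j : ℕ) : Finite (Mon n j) :=
  ((Finset.univ.finsuppAntidiag j).finite_toSet.subset
    (fun a (ha : a.degree = j) => by
      simpa [Finset.mem_finsuppAntidiag, Finsupp.degree_eq_sum] using ha)).to_subtype

instance (n j : ℕ) : Fintype (Mon n j) := Fintype.ofFinite _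

section Action

variable {n : ℕ} {R : Type*} [CommRing R]

/-- The partial derivative `∂/∂y_i` as an `R`-linear operator. -/
def partialOp (R : Type*) [CommRing R] {n : ℕ} (i : Fin n) :
    Module.End R (MvPolynomial (Fin n) R) :=
  (MvPolynomial.pderiv i).toLinearMap

/-- The operator `(∂/∂y_1)^(a_1) ⋯ (∂/∂y_n)^(a_n)`. -/
def monomialOp (R : Type*) [CommRing R] {n : ℕ} (a : Fin n →₀ ℕ) :
    Module.End R (MvPolynomial (Fin n) R) :=
  ((List.finRange n).map fun i => partialOp R i ^ a i).prod

/-- For fixed `F`, the linear map `h ↦ h ∘ F = h(∂/∂y_1, …, ∂/∂y_n) F`. -/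
def act (F : MvPolynomial (Fin n) R) :
    MvPolynomial (Fin n) R →ₗ[R] MvPolynomial (Fin n) R :=
  (MvPolynomial.basisMonomials (Fin n) R).constr R fun a => monomialOp R a F

lemma partialOp_commute (i j : Fin n) : Commute (partialOp R i) (partialOp R j) := by
  have h : ⁅MvPolynomial.pderiv (R := R) i, MvPolynomial.pderiv (R := R) j⁆ = 0 := by
    apply MvPolynomial.derivation_ext
    intro l
    simp [Derivation.commutator_apply, MvPolynomial.pderiv_X, Pi.single_apply]
    split_ifs <;> simp
  refine LinearMap.ext fun F => ?_
  have h' := congrArg (fun D => D F) h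
  simpa [Derivation.commutator_apply, sub_eq_zero, partialOp] using h'

lemma monomialOp_add (a b : Fin n →₀ ℕ) :
    monomialOp R (a + b) = monomialOp R a * monomialOp R b := by
  have key : ∀ l : List (Fin n),
      (l.map fun i => partialOp R i ^ (a + b) i).prod =
        (l.map fun i => partialOp R i ^ a i).prod * (l.map fun i => partialOp R i ^ b i).prod := by
    intro l
    induction l with
    | nil => simp
    | cons i l ih =>
      have hc : Commute (l.map fun i => partialOp R i ^ a i).prod (partialOp R i ^ b i) := by
        apply Commute.list_prod_left
        intro x hx
        obtain ⟨j, -, rfl⟩ := List.mem_map.1 hx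
        exact (partialOp_commute j i).pow_pow _ _
      rw [List.map_cons, List.prod_cons, ih, List.map_cons, List.prod_cons, List.map_cons,
        List.prod_cons, Finsupp.add_apply, pow_add, mul_assoc, mul_assoc, ← mul_assoc _ _
        (l.map fun i => partialOp R i ^ b i).prod, ← hc.eq]
      simp only [mul_assoc]
  exact key _

lemma act_monomial (F : MvPolynomial (Fin n) R) (a : Fin n →₀ ℕ) (c : R) :
    act F (MvPolynomial.monomial a c) = c • monomialOp R a F := by
  have h : MvPolynomial.monomial a c = c • MvPolynomial.basisMonomials (Fin n) R a := by
    simp [MvPolynomial.smul_monomial]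
  rw [h, map_smul, act, Module.Basis.constr_basis]

lemma act_mul (g h F : MvPolynomial (Fin n) R) : act F (g * h) = act (act F h) g := by
  induction g using MvPolynomial.induction_on' with
  | add p q hp hq => simp [add_mul, hp, hq]
  | monomial a c =>
    induction h using MvPolynomial.induction_on' with
    | add p q hp hq =>
      simp only [act_monomial] at hp hq ⊢
      simp only [mul_add, map_add, hp, hq, smul_add]
    | monomial b e =>
      simp [MvPolynomial.monomial_mul, act_monomial, monomialOp_add, mul_smul]

/-- The annihilator `F^⊥ = {h | h ∘ F = 0}`. -/
def annihilator (F : MvPolynomial (Fin n) R) : Ideal (MvPolynomial (Fin n) R) where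
  carrier := {h | act F h = 0}
  zero_mem' := map_zero _
  add_mem' {g h} hg hh := by
    simp only [Set.mem_ofPred_eq] at hg hh ⊢
    rw [map_add, hg, hh, add_zero]
  smul_mem' g h hh := by
    simp only [Set.mem_ofPred_eq] at hh ⊢
    rw [smul_eq_mul, act_mul, hh, act]
    have : (fun a => monomialOp R a (0 : MvPolynomial (Fin n) R)) = 0 := by
      funext a; simp
    rw [this, map_zero, LinearMap.zero_apply]

end Action

section Forms

variable {n : ℕ} {k : Type u} [Field k]

/-- The vector space `F^⊥ ∩ k[x_1, …, x_n]_j`. -/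
def annihilatorDeg (F : MvPolynomial (Fin n) k) (j : ℕ) : Submodule k (MvPolynomial (Fin n) k) :=
  (annihilator F).restrictScalars k ⊓ MvPolynomial.homogeneousSubmodule (Fin n) k j

/-- The Hilbert function of `k[x_1, …, x_n] / F^⊥`: the dimension of the degree `i` component,
i.e. of the image of the space of forms of degree `i`. -/
def hilbertFn (F : MvPolynomial (Fin n) k) (i : ℕ) : ℕ :=
  Module.finrank k ((MvPolynomial.homogeneousSubmodule (Fin n) k i).map
    (Ideal.Quotient.mkₐ k (annihilator F)).toLinearMap)

/-- The resultant of forms `f_1, …, f_n` in `n` variables over an algebraically closed field is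
nonzero. The resultant is the form in the coefficients, unique up to a scalar, that
defines the locus of tuples having a common zero away from the origin. -/
def ResultantNeZero (f : Fin n → MvPolynomial (Fin n) k) : Prop :=
  ∀ x : Fin n → k, (∀ i, MvPolynomial.eval x (f i) = 0) → x = 0

end Forms

section Schemes

variable (k : Type u) [Field k] (n d : ℕ)

/-- `U_Res`: the forms `F` of degree `n(d-1)` such that `F^⊥ ∩ k[x]_d` is `n`-dimensional and has
a basis with nonvanishing resultant. -/
def URes : Set (MvPolynomial (Fin n) k) :=
  {F | F.IsHomogeneous (n * (d - 1)) ∧ Module.finrank k (annihilatorDeg F d) = n ∧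
    ∃ b : Module.Basis (Fin n) k (annihilatorDeg F d),
      ResultantNeZero fun i => (b i : MvPolynomial (Fin n) k)}

/-- The sequence `T = (1, n, …, n, 1)`: the coefficients of `(1 + u + ⋯ + u^(d-1))^n`. -/
def seqT (i : ℕ) : ℕ :=
  ((∑ j ∈ Finset.range d, (Polynomial.X : Polynomial ℕ) ^ j) ^ n).coeff i

/-- `Gor(T)` as a set: the forms `F` of degree `n(d-1)` such that `k[x] / F^⊥` has Hilbert
function `T`. -/
def GorSet : Set (MvPolynomial (Fin n) k) :=
  {F | F.IsHomogeneous (n * (d - 1)) ∧ ∀ i, hilbertFn F i = seqT n d i}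

/-- `K = dim k[x_1, …, x_n]_d`. -/
def dimForms : ℕ := (d + n - 1).choose (n - 1)

/-! ### Catalecticant matrices and schemes -/

/-- The polynomial ring `k[z_1, …, z_M]` in the coefficients of a form of degree `s` in
`n` variables. -/
abbrev CoeffRing (s : ℕ) : Type u := MvPolynomial (Mon n s) k

/-- The generic form `∑ z_m y^m` of degree `s`. -/
def genericForm (s : ℕ) : MvPolynomial (Fin n) (CoeffRing k n s) :=
  ∑ m : Mon n s, MvPolynomial.monomial m.1 (MvPolynomial.X m)

/-- The catalecticant matrix of the generic form of degree `s`: the column of a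
monomial `x^a` of degree `i` holds the coefficients of `x^a ∘ F` with respect to the monomials of
degree `s - i`. -/
def catMatrix (s i : ℕ) : Matrix (Mon n (s - i)) (Mon n i) (CoeffRing k n s) :=
  Matrix.of fun b a => MvPolynomial.coeff b.1
    (act (genericForm k n s) (MvPolynomial.monomial a.1 1))

/-- The ideal generated by all `r`-minors of a matrix. -/
def minorsIdeal {ι κ R : Type*} [CommRing R] (A : Matrix ι κ R) (r : ℕ) : Ideal R :=
  Ideal.span {x | ∃ (p : Fin r ↪ ι) (q : Fin r ↪ κ), x = (A.submatrix p q).det}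

/-- The ideal generated by the `(K-n+1)`-minors of the catalecticant matrix `D(F)`. -/
def idealV : Ideal (CoeffRing k n (n * (d - 1))) :=
  minorsIdeal (catMatrix k n (n * (d - 1)) d) (dimForms n d - n + 1)

/-- The ideal generated by the `(t_i+1)`-minors of the `i`-th catalecticant matrices,
`1 ≤ i ≤ n(d-1)-1`. -/
def idealGor : Ideal (CoeffRing k n (n * (d - 1))) :=
  ⨆ i ∈ Finset.Icc 1 (n * (d - 1) - 1),
    minorsIdeal (catMatrix k n (n * (d - 1)) i) (seqT n d i + 1)

/-- The affine space of forms of degree `n(d-1)`, as a scheme. -/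
def formScheme : Scheme.{u} := Spec (.of (CoeffRing k n (n * (d - 1))))

/-- The closed point of the affine space of forms given by `F`: the kernel of evaluation at
the coefficients of `F`. -/
def formPoint (F : MvPolynomial (Fin n) k) : formScheme k n d :=
  (⟨RingHom.ker (MvPolynomial.aeval fun m : Mon n (n * (d - 1)) => MvPolynomial.coeff m.1 F :
      CoeffRing k n (n * (d - 1)) →ₐ[k] k), RingHom.ker_isPrime _⟩ :
    PrimeSpectrum (CoeffRing k n (n * (d - 1))))

/-- The scheme `𝐕`. -/
def schemeV : Scheme.{u} := Spec (.of (CoeffRing k n (n * (d - 1)) ⧸ idealV k n d))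

/-- The closed immersion of `𝐕` into the affine space of forms. -/
def schemeV.ι : schemeV k n d ⟶ formScheme k n d :=
  Spec.map (CommRingCat.ofHom (Ideal.Quotient.mk (idealV k n d)))

/-- The scheme `𝐆𝐨𝐫_≤(T)`. -/
def schemeGorLe : Scheme.{u} := Spec (.of (CoeffRing k n (n * (d - 1)) ⧸ idealGor k n d))

/-- The closed immersion of `𝐆𝐨𝐫_≤(T)` into the affine space of forms. -/
def schemeGorLe.ι : schemeGorLe k n d ⟶ formScheme k n d :=
  Spec.map (CommRingCat.ofHom (Ideal.Quotient.mk (idealGor k n d)))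

/-- The open subset of `𝐆𝐨𝐫_≤(T)` whose closed points are the forms in `Gor(T)`: the largest
open subset all of whose closed points are in `Gor(T)`. -/
def gorOpen : (schemeGorLe k n d).Opens :=
  sSup {O | ∀ F : MvPolynomial (Fin n) k, F.IsHomogeneous (n * (d - 1)) →
    ∀ v ∈ O, schemeGorLe.ι k n d v = formPoint k n d F → F ∈ GorSet k n d}

/-- The scheme `𝐆𝐨𝐫(T)`: the open subscheme of `𝐆𝐨𝐫_≤(T)` given by the open subset `Gor(T)`. -/
def schemeGor : Scheme.{u} := (gorOpen k n d).toScheme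

/-- The immersion of `𝐆𝐨𝐫(T)` into the affine space of forms. -/
def schemeGor.ι : schemeGor k n d ⟶ formScheme k n d :=
  (gorOpen k n d).ι ≫ schemeGorLe.ι k n d

end Schemes

end

/-! ### Smoothness and Zariski tangent spaces -/

/-- A scheme is smooth (nonsingular) at `x` if its local ring at `x` is a regular local ring. -/
def IsSmoothAt (X : Scheme.{u}) (x : X) : Prop :=
  IsRegularLocalRing (X.presheaf.stalk x)

/-- The Zariski tangent space: the dual of the cotangent space `𝔪/𝔪²` over the residue field. -/
abbrev ZariskiTangentSpace (X : Scheme.{u}) (x : X) : Type u :=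
  Module.Dual (IsLocalRing.ResidueField (X.presheaf.stalk x))
    (IsLocalRing.CotangentSpace (X.presheaf.stalk x))

/-- The dimension of the Zariski tangent space over the residue field. -/
noncomputable def tangentDim (X : Scheme.{u}) (x : X) : ℕ :=
  Module.finrank (IsLocalRing.ResidueField (X.presheaf.stalk x)) (ZariskiTangentSpace X x)

end Catalecticant

/-! At `F` both schemes have the same local ring up to isomorphism: that of an affine space of
dimension n(K-n)+1 at a rational point. Regularity at `F`, the tangent dimension, and regularity at
the points specializing to `F` all follow from this.

Geometrically, F^⊥ ∩ S_d is spanned by n forms without common zero, a complete intersection. Fix a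
set N of K-n monomials whose columns in D_d form a basis of the column space at `F`. Near `F` on 𝐕
the minors vanish, so Cramer's rule writes the other n columns as combinations of those in N with
coefficients c_ab; that is, the forms x^a - ∑ c_ab x^b annihilate the given form. Conversely, for c
near the base point these n forms are still a complete intersection. Its quotient is one-dimensional
in degree s = n(d-1), so they determine the annihilated form of degree s up to a factor t. Hence (c,
t) are n(K-n)+1 local coordinates.

Algebraically, the form is polynomial in (c, t) by an adjugate formula (`Chart.param`), and (c, t)
are elements of the local ring by Cramer's rule (`Chart.localInverse`). The lemmas
`Chart.localInverse_comp_param` and `Chart.localInverse_comp_algebraMap_param` say that the two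
invert each other as ring maps, and `Chart.nonempty_algEquiv` concludes. Reducedness of the schemes
is never needed. Only two properties of the defining ideal enter (`IsBetween`): it contains the
minors of D_d, and it vanishes at every form with Hilbert function at most T. The second makes the
ideal vanish under `Chart.param`, since the parameter ring is a polynomial ring over an infinite
field and vanishing may be tested on a nonempty open set of points (`Chart.le_ker_param`).

The input on complete intersections is their Hilbert series and socle degree
(`isCompleteIntersection_of_radical`), obtained by exchanging the generators one at a time for
linear forms. It also yields Macaulay's theorem `hilbertFn_eq_seqT`, which puts `F` in the open
subscheme 𝐆𝐨𝐫(T). -/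

namespace Catalecticant

open MvPolynomial in
attribute [local instance] MvPolynomial.gradedAlgebra

/-! ### Hilbert functions of graded quotients -/

section GradedIdeals

open MvPolynomial

variable {σ : Type*} {k : Type*} [Field k]

/-- The Hilbert function of the quotient of a polynomial ring by an ideal. -/
noncomputable def hilb (I : Ideal (MvPolynomial σ k)) (i : ℕ) : ℕ :=
  Module.finrank k ((homogeneousSubmodule σ k i).map (Ideal.Quotient.mkₐ k I).toLinearMap)

lemma homogeneousComponent_mul_of_isHomogeneous {a : MvPolynomial σ k} {e : ℕ}
    (ha : a.IsHomogeneous e) (p : MvPolynomial σ k) (i : ℕ) :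
    homogeneousComponent i (a * p) = if e ≤ i then a * homogeneousComponent (i - e) p else 0 := by
  induction p using MvPolynomial.induction_on' with
  | add p q hp hq => rw [mul_add, map_add, hp, hq]; split_ifs <;> simp [mul_add]
  | monomial u c =>
    have h1 : (monomial u c : MvPolynomial σ k).IsHomogeneous u.degree :=
      isHomogeneous_monomial c rfl
    rw [homogeneousComponent_of_mem (ha.mul h1), homogeneousComponent_of_mem h1]
    split_ifs <;> first | rfl | omega | simp

lemma isHomogeneous_sup_span_singleton {J : Ideal (MvPolynomial σ k)}
    (hJ : J.IsHomogeneous (homogeneousSubmodule σ k)) {a : MvPolynomial σ k} {e : ℕ}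
    (ha : a.IsHomogeneous e) :
    (J ⊔ Ideal.span {a}).IsHomogeneous (homogeneousSubmodule σ k) := by
  refine hJ.sup (Ideal.homogeneous_span _ _ ?_)
  rintro x rfl
  exact ⟨e, ha⟩

/-- Take the degree `i` component of an expression u = y + a v with y in `J`. The last clause covers
`i < e`, where the truncated difference `i - e` carries no information. -/
lemma exists_isHomogeneous_sub_mem {J : Ideal (MvPolynomial σ k)}
    (hJ : J.IsHomogeneous (homogeneousSubmodule σ k)) {a u : MvPolynomial σ k} {e i : ℕ}
    (ha : a.IsHomogeneous e) (hu : u.IsHomogeneous i) (h : u ∈ J ⊔ Ideal.span {a}) :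
    ∃ w : MvPolynomial σ k, w.IsHomogeneous (i - e) ∧ u - a * w ∈ J ∧ (i < e → w = 0) := by
  obtain ⟨y, hy, z, hz, hyz⟩ := Submodule.mem_sup.1 h
  obtain ⟨v, rfl⟩ := Ideal.mem_span_singleton.1 hz
  have h1 : homogeneousComponent i u = u := homogeneousComponent_eq_self hu
  have h2 := homogeneousComponent_mem_of_mem hJ hy i
  have h3 : homogeneousComponent i y = u - homogeneousComponent i (a * v) := by
    rw [← hyz, map_add] at h1
    rw [← hyz, ← h1, add_sub_cancel_right]
  rw [h3, homogeneousComponent_mul_of_isHomogeneous ha] at h2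
  by_cases hle : e ≤ i
  · rw [if_pos hle] at h2
    exact ⟨_, homogeneousComponent_isHomogeneous _ _, h2, fun h => by omega⟩
  · rw [if_neg hle] at h2
    exact ⟨0, isHomogeneous_zero _ _ _, by simpa using h2, fun _ => rfl⟩

lemma mem_hilb_space {I : Ideal (MvPolynomial σ k)} {i : ℕ} {x : MvPolynomial σ k ⧸ I} :
    x ∈ (homogeneousSubmodule σ k i).map (Ideal.Quotient.mkₐ k I).toLinearMap ↔
      ∃ u : MvPolynomial σ k, u.IsHomogeneous i ∧ Ideal.Quotient.mk I u = x := by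
  simp [Submodule.mem_map]

instance [Finite σ] (i : ℕ) : Module.Finite k (homogeneousSubmodule σ k i) :=
  Module.Finite.iff_fg.2 (homogeneousSubmodule_fg _ _ i)

/-- Multiplication by `a` gives the exact sequence 0 → (S/J)(-e) → S/J → S/(J, a) → 0; count
dimensions in degree `i`. -/
lemma hilb_sup_span_singleton [Finite σ] {J : Ideal (MvPolynomial σ k)}
    (hJ : J.IsHomogeneous (homogeneousSubmodule σ k)) {a : MvPolynomial σ k} {e : ℕ}
    (ha : a.IsHomogeneous e) (hreg : ∀ u, a * u ∈ J → u ∈ J) (i : ℕ) :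
    hilb (J ⊔ Ideal.span {a}) i + (if e ≤ i then hilb J (i - e) else 0) = hilb J i := by
  set V : ℕ → Submodule k (MvPolynomial σ k ⧸ J) := fun i =>
    (homogeneousSubmodule σ k i).map (Ideal.Quotient.mkₐ k J).toLinearMap with hV
  let f : (MvPolynomial σ k ⧸ J) →ₗ[k] (MvPolynomial σ k ⧸ (J ⊔ Ideal.span {a})) :=
    (Ideal.Quotient.factorₐ k (le_sup_left : J ≤ J ⊔ Ideal.span {a})).toLinearMap
  have hmap : (V i).map f = (homogeneousSubmodule σ k i).map
      (Ideal.Quotient.mkₐ k (J ⊔ Ideal.span {a})).toLinearMap := by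
    rw [hV, ← Submodule.map_comp]
    rfl
  have hrn := LinearMap.finrank_range_add_finrank_ker (f.domRestrict (V i))
  rw [LinearMap.range_domRestrict, hmap, LinearMap.ker_domRestrict] at hrn
  change _ = Module.finrank k (V i)
  rw [← hrn]
  refine congrArg (hilb (J ⊔ Ideal.span {a}) i + ·) ?_
  let m : (MvPolynomial σ k ⧸ J) →ₗ[k] (MvPolynomial σ k ⧸ J) :=
    LinearMap.mulLeft k (Ideal.Quotient.mk J a)
  have hm : Function.Injective m := by
    rw [← LinearMap.ker_eq_bot, LinearMap.ker_eq_bot']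
    intro x hx
    obtain ⟨u, rfl⟩ := Ideal.Quotient.mk_surjective x
    change Ideal.Quotient.mk J a * Ideal.Quotient.mk J u = 0 at hx
    rw [← map_mul, Ideal.Quotient.eq_zero_iff_mem] at hx
    exact Ideal.Quotient.eq_zero_iff_mem.2 (hreg u hx)
  have hker : ∀ u : MvPolynomial σ k, u.IsHomogeneous i → f (Ideal.Quotient.mk J u) = 0 →
      ∃ w : MvPolynomial σ k, w.IsHomogeneous (i - e) ∧ u - a * w ∈ J ∧ (i < e → w = 0) := by
    intro u hu h0
    refine exists_isHomogeneous_sub_mem hJ ha hu ?_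
    exact Ideal.Quotient.eq_zero_iff_mem.1 h0
  split_ifs with hle
  · have key : (LinearMap.ker f).comap (V i).subtype = ((V (i - e)).map m).comap (V i).subtype := by
      ext ⟨x, hx⟩
      obtain ⟨u, hu, rfl⟩ := mem_hilb_space.1 hx
      simp only [Submodule.mem_comap, Submodule.subtype_apply, LinearMap.mem_ker]
      constructor
      · intro h0
        obtain ⟨w, hw, hw', -⟩ := hker u hu h0
        refine ⟨Ideal.Quotient.mk J w, mem_hilb_space.2 ⟨w, hw, rfl⟩, ?_⟩
        change Ideal.Quotient.mk J a * Ideal.Quotient.mk J w = _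
        rw [← map_mul]
        exact (Ideal.Quotient.eq.2 hw').symm
      · rintro ⟨y, hy, hy'⟩
        obtain ⟨w, rfl⟩ := Ideal.Quotient.mk_surjective y
        rw [← hy']
        change Ideal.Quotient.mk _ (a * w) = 0
        exact Ideal.Quotient.eq_zero_iff_mem.2
          (Ideal.mem_sup_right (Ideal.mul_mem_right _ _ (Ideal.mem_span_singleton_self a)))
    have hle' : (V (i - e)).map m ≤ V i := by
      rintro _ ⟨y, hy, rfl⟩
      obtain ⟨w, hw, rfl⟩ := mem_hilb_space.1 hy
      refine mem_hilb_space.2 ⟨a * w, ?_, rfl⟩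
      have := ha.mul hw
      rwa [Nat.add_sub_cancel' hle] at this
    rw [key, (Submodule.comapSubtypeEquivOfLe hle').finrank_eq]
    exact (Submodule.equivMapOfInjective m hm _).finrank_eq
  · symm
    rw [Submodule.finrank_eq_zero]
    rw [eq_bot_iff]
    rintro ⟨x, hx⟩ h0
    obtain ⟨u, hu, rfl⟩ := mem_hilb_space.1 hx
    obtain ⟨w, hw, hw', hw0⟩ := hker u hu h0
    rw [hw0 (by omega), mul_zero, sub_zero] at hw'
    simpa using Ideal.Quotient.eq_zero_iff_mem.2 hw'

end GradedIdeals

/-! ### Permutation of regular sequences of forms -/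

section RegularSequences

open MvPolynomial RingTheory.Sequence
open scoped Pointwise

variable {σ : Type*} {k : Type*} [Field k]

lemma isHomogeneous_ofList {L : List (MvPolynomial σ k)}
    (hL : ∀ g ∈ L, ∃ e, 0 < e ∧ g.IsHomogeneous e) :
    (Ideal.ofList L).IsHomogeneous (homogeneousSubmodule σ k) := by
  refine Ideal.homogeneous_span _ _ fun x hx => ?_
  obtain ⟨e, -, he⟩ := hL x hx
  exact ⟨e, he⟩

/-- The graded Nakayama lemma for the `b`-torsion of the quotient by a homogeneous ideal. -/
lemma torsionBy_eq_bot_of_isHomogeneous {J : Ideal (MvPolynomial σ k)}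
    (hJ : J.IsHomogeneous (homogeneousSubmodule σ k)) {a b : MvPolynomial σ k} {e : ℕ}
    (he : 0 < e) (ha : a.IsHomogeneous e)
    (hK : Submodule.torsionBy (MvPolynomial σ k) (MvPolynomial σ k ⧸ J) b =
      a • Submodule.torsionBy (MvPolynomial σ k) (MvPolynomial σ k ⧸ J) b) :
    Submodule.torsionBy (MvPolynomial σ k) (MvPolynomial σ k ⧸ J) b = ⊥ := by
  have hiff : ∀ u, (Submodule.Quotient.mk u : MvPolynomial σ k ⧸ J) ∈
      Submodule.torsionBy (MvPolynomial σ k) (MvPolynomial σ k ⧸ J) b ↔ b * u ∈ J := by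
    intro u
    rw [Submodule.mem_torsionBy_iff, ← Submodule.Quotient.mk_smul,
      Submodule.Quotient.mk_eq_zero, smul_eq_mul]
  have hstep : ∀ u, b * u ∈ J → ∃ v, b * v ∈ J ∧ u - a * v ∈ J := by
    intro u hu
    rw [← hiff, hK] at hu
    obtain ⟨y, hy, hy'⟩ := hu
    obtain ⟨v, rfl⟩ := Submodule.Quotient.mk_surjective J y
    refine ⟨v, (hiff v).1 hy, ?_⟩
    have h2 : (Submodule.Quotient.mk (a * v) : MvPolynomial σ k ⧸ J) =
      Submodule.Quotient.mk u := hy'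
    exact (Submodule.Quotient.eq J).1 h2.symm
  -- Induction on the degree replaces Nakayama's lemma: modulo `J`, the component of degree `i` of
  -- `u` is `a` times a component of another torsion element, of degree `i - e < i`.
  have hhom : ∀ i u, b * u ∈ J → homogeneousComponent i u ∈ J := by
    intro i
    induction i using Nat.strong_induction_on with
    | _ i ih =>
      intro u hu
      obtain ⟨v, hv, huv⟩ := hstep u hu
      have h1 := homogeneousComponent_mem_of_mem hJ huv i
      rw [map_sub, homogeneousComponent_mul_of_isHomogeneous ha] at h1
      split_ifs at h1 with hle
      · have := J.add_mem h1 (J.mul_mem_left a (ih (i - e) (by omega) v hv))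
        simpa using this
      · simpa using h1
  rw [eq_bot_iff]
  intro x hx
  obtain ⟨u, rfl⟩ := Submodule.Quotient.mk_surjective J x
  rw [hiff] at hx
  rw [Submodule.mem_bot, Submodule.Quotient.mk_eq_zero]
  exact (mem_iff_homogeneousComponent_mem hJ u).2 fun i => hhom i u hx

/-- Regular sequences of forms of positive degree may be permuted. -/
lemma isWeaklyRegular_perm_of_isHomogeneous {L L' : List (MvPolynomial σ k)}
    (hL : ∀ g ∈ L, ∃ e, 0 < e ∧ g.IsHomogeneous e)
    (h : IsWeaklyRegular (MvPolynomial σ k) L) (hp : L.Perm L') :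
    IsWeaklyRegular (MvPolynomial σ k) L' := by
  refine h.prototype_perm hp ?_
  intro a b rs' hsub
  have hmem : ∀ g ∈ a :: b :: rs', ∃ e, 0 < e ∧ g.IsHomogeneous e :=
    fun g hg => hL g (hsub.subset hg)
  obtain ⟨e, he, ha⟩ := hmem a (by simp)
  refine torsionBy_eq_bot_of_isHomogeneous ?_ he ha
  rw [smul_eq_mul, Ideal.mul_top]
  exact isHomogeneous_ofList fun g hg => hmem g (by simp [hg])

lemma isWeaklyRegular_append_singleton_iff {R : Type*} [CommRing R] (L : List R) (a : R) :
    IsWeaklyRegular R (L ++ [a]) ↔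
      IsWeaklyRegular R L ∧ ∀ u, a * u ∈ Ideal.ofList L → u ∈ Ideal.ofList L := by
  rw [isWeaklyRegular_append_iff, isWeaklyRegular_singleton_iff,
    isSMulRegular_quotient_iff_mem_of_smul_mem]
  simp

end RegularSequences

/-! ### Exchange of a generator for a linear form -/

section Exchange

open MvPolynomial

variable {σ : Type*} {k : Type*} [Field k]

lemma linearForm_mul_mem {I : Ideal (MvPolynomial σ k)} {u ℓ : MvPolynomial σ k}
    (hℓ : ℓ.IsHomogeneous 1) (h : ∀ j, X j * u ∈ I) : ℓ * u ∈ I := by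
  have hmem : ℓ ∈ Submodule.span k (Set.range (X : σ → MvPolynomial σ k)) := by
    rw [← homogeneousSubmodule_one_eq_span_X]; exact hℓ
  clear hℓ
  induction hmem using Submodule.span_induction with
  | mem x hx => obtain ⟨j, rfl⟩ := hx; exact h j
  | zero => simp
  | add x y _ _ hx hy => rw [add_mul]; exact I.add_mem hx hy
  | smul c x _ hx => rw [smul_mul_assoc]; exact Submodule.smul_of_tower_mem I c hx

/-- If `f * u` lies in `J`, then so does `ℓ ^ N * u`, and `ℓ` can be cancelled. Thus `f` inherits
regularity modulo `J` from `ℓ`, without any unmixedness theorem. -/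
lemma mul_mem_of_pow_mem_sup {R : Type*} [CommRing R] {J : Ideal R} {f ℓ : R} {N : ℕ}
    (hN : ℓ ^ N ∈ J ⊔ Ideal.span {f}) (hreg : ∀ u, ℓ * u ∈ J → u ∈ J) (u : R) (h : f * u ∈ J) :
    u ∈ J := by
  have hpow : ∀ N : ℕ, ℓ ^ N * u ∈ J → u ∈ J := by
    intro N
    induction N with
    | zero => simp
    | succ N ih => intro h; rw [pow_succ', mul_assoc] at h; exact ih (hreg _ h)
  apply hpow N
  obtain ⟨y, hy, z, hz, hyz⟩ := Submodule.mem_sup.1 hN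
  obtain ⟨v, rfl⟩ := Ideal.mem_span_singleton.1 hz
  rw [← hyz, add_mul]
  refine J.add_mem (J.mul_mem_right _ hy) ?_
  rw [mul_right_comm]
  exact J.mul_mem_right _ h

/-- The Hilbert series of the quotient of a polynomial ring by an ideal. -/
noncomputable def hilbSeries (I : Ideal (MvPolynomial σ k)) : PowerSeries ℤ :=
  PowerSeries.mk fun i => (hilb I i : ℤ)

lemma hilbSeries_sup_span_singleton [Finite σ] {J : Ideal (MvPolynomial σ k)}
    (hJ : J.IsHomogeneous (homogeneousSubmodule σ k)) {a : MvPolynomial σ k} {e : ℕ}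
    (ha : a.IsHomogeneous e) (hreg : ∀ u, a * u ∈ J → u ∈ J) :
    hilbSeries (J ⊔ Ideal.span {a}) = (1 - PowerSeries.X ^ e) * hilbSeries J := by
  ext i
  rw [sub_mul, one_mul, map_sub, PowerSeries.coeff_X_pow_mul']
  simp only [hilbSeries, PowerSeries.coeff_mk]
  have := hilb_sup_span_singleton hJ ha hreg i
  split_ifs with h
  · rw [if_pos h] at this; omega
  · rw [if_neg h] at this; omega

/-- The two series are (1 - X^e) H and (1 - X) H, with H the Hilbert series of the quotient by `J`.
-/
lemma hilbSeries_exchange [Finite σ] {J : Ideal (MvPolynomial σ k)}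
    (hJ : J.IsHomogeneous (homogeneousSubmodule σ k)) {f ℓ : MvPolynomial σ k} {e : ℕ}
    (hf : f.IsHomogeneous e) (hℓ : ℓ.IsHomogeneous 1)
    (hregf : ∀ u, f * u ∈ J → u ∈ J) (hregℓ : ∀ u, ℓ * u ∈ J → u ∈ J) :
    hilbSeries (J ⊔ Ideal.span {f}) =
      (∑ j ∈ Finset.range e, PowerSeries.X ^ j) * hilbSeries (J ⊔ Ideal.span {ℓ}) := by
  rw [hilbSeries_sup_span_singleton hJ hf hregf, hilbSeries_sup_span_singleton hJ hℓ hregℓ,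
    ← mul_assoc, pow_one]
  congr 1
  have := geom_sum_mul (PowerSeries.X : PowerSeries ℤ) e
  linear_combination this

/-- A socle element `u` modulo (J, f) satisfies ℓu ≡ fv mod J. Cancelling `f` shows that `v` is a
socle element modulo (J, ℓ), of degree i + 1 - e; once v ≡ ℓw, cancelling `ℓ` gives u ≡ fw. The
socle degree therefore moves by e - 1. -/
lemma socle_exchange {J : Ideal (MvPolynomial σ k)}
    (hJ : J.IsHomogeneous (homogeneousSubmodule σ k)) {f ℓ : MvPolynomial σ k} {e : ℕ}
    (hf : f.IsHomogeneous e) (hℓ : ℓ.IsHomogeneous 1)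
    (hregf : ∀ u, f * u ∈ J → u ∈ J) (hregℓ : ∀ u, ℓ * u ∈ J → u ∈ J) {c τ : ℕ}
    (hsoc : ∀ (i : ℕ) (u : MvPolynomial σ k), u.IsHomogeneous i → i + c ≠ τ →
      (∀ j, X j * u ∈ J ⊔ Ideal.span {ℓ}) → u ∈ J ⊔ Ideal.span {ℓ})
    (i : ℕ) (u : MvPolynomial σ k) (hu : u.IsHomogeneous i) (hi : i + c + 1 ≠ τ + e)
    (hXu : ∀ j, X j * u ∈ J ⊔ Ideal.span {f}) : u ∈ J ⊔ Ideal.span {f} := by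
  obtain ⟨v, hv, hvJ, hv0⟩ := exists_isHomogeneous_sub_mem hJ hf (hℓ.mul hu)
    (linearForm_mul_mem hℓ hXu)
  have hvmem : v ∈ J ⊔ Ideal.span {ℓ} := by
    by_cases hlt : 1 + i < e
    · rw [hv0 hlt]; exact zero_mem _
    refine hsoc _ v hv (by omega) fun j => ?_
    obtain ⟨y, hy, z, hz, hyz⟩ := Submodule.mem_sup.1 (hXu j)
    obtain ⟨w, rfl⟩ := Ideal.mem_span_singleton.1 hz
    have h1 : X j * v - ℓ * w ∈ J := by
      apply hregf
      have : f * (X j * v - ℓ * w) = ℓ * y - X j * (ℓ * u - f * v) := by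
        linear_combination (-ℓ) * hyz
      rw [this]
      exact J.sub_mem (J.mul_mem_left _ hy) (J.mul_mem_left _ hvJ)
    have h2 := (J ⊔ Ideal.span {ℓ}).add_mem (Ideal.mem_sup_left h1)
      (Ideal.mem_sup_right (Ideal.mul_mem_right w _ (Ideal.mem_span_singleton_self ℓ)))
    simpa using h2
  obtain ⟨y, hy, z, hz, hyz⟩ := Submodule.mem_sup.1 hvmem
  obtain ⟨w, rfl⟩ := Ideal.mem_span_singleton.1 hz
  have h1 : u - f * w ∈ J := by
    apply hregℓ
    have : ℓ * (u - f * w) = (ℓ * u - f * v) + f * y := by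
      linear_combination (-f) * hyz
    rw [this]
    exact J.add_mem hvJ (J.mul_mem_left _ hy)
  have h2 := (J ⊔ Ideal.span {f}).add_mem (Ideal.mem_sup_left h1)
    (Ideal.mem_sup_right (Ideal.mul_mem_right w _ (Ideal.mem_span_singleton_self f)))
  simpa using h2

end Exchange

/-! ### Linear forms as parameters -/

section LinearParameter

open MvPolynomial

variable {σ : Type*} {k : Type*} [Field k]

/-- The homogeneous core of a prime is prime and still contains the homogeneous ideal `I`, so
minimality forces equality. -/
lemma isHomogeneous_of_mem_minimalPrimes {I Q : Ideal (MvPolynomial σ k)}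
    (hI : I.IsHomogeneous (homogeneousSubmodule σ k)) (hQ : Q ∈ I.minimalPrimes) :
    Q.IsHomogeneous (homogeneousSubmodule σ k) := by
  have h1 : (Q.homogeneousCore (homogeneousSubmodule σ k)).toIdeal.IsPrime :=
    hQ.1.1.homogeneousCore
  have h2 : I ≤ (Q.homogeneousCore (homogeneousSubmodule σ k)).toIdeal := by
    rw [← hI.toIdeal_homogeneousCore_eq_self]
    exact Ideal.homogeneousCore_mono _ hQ.1.2
  have h3 := Ideal.toIdeal_homogeneousCore_le (homogeneousSubmodule σ k) Q
  have h4 : Q = (Q.homogeneousCore (homogeneousSubmodule σ k)).toIdeal :=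
    le_antisymm (hQ.2 ⟨h1, h2⟩ h3) h3
  rw [h4]
  exact HomogeneousIdeal.isHomogeneous _

lemma constantCoeff_eq_zero_of_mem {Q : Ideal (MvPolynomial σ k)} (hQ : Q.IsPrime)
    (hh : Q.IsHomogeneous (homogeneousSubmodule σ k)) {u : MvPolynomial σ k} (hu : u ∈ Q) :
    u ∈ RingHom.ker (constantCoeff : MvPolynomial σ k →+* k) := by
  have h0 := homogeneousComponent_mem_of_mem hh hu 0
  rw [homogeneousComponent_zero] at h0
  by_contra hne
  exact hQ.ne_top (Ideal.eq_top_of_isUnit_mem _ h0 ((Ne.isUnit (fun h => hne h)).map C))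

lemma ker_constantCoeff_le {Q : Ideal (MvPolynomial σ k)} (h : ∀ j, X j ∈ Q) :
    RingHom.ker (constantCoeff : MvPolynomial σ k →+* k) ≤ Q := by
  intro u hu
  have h1 : u ∈ Ideal.span (X '' (Set.univ : Set σ) : Set (MvPolynomial σ k)) := by
    rw [mem_ideal_span_X_image]
    intro m hm
    by_contra hcon
    push Not at hcon
    have : m = 0 := Finsupp.ext fun i => hcon i trivial
    subst this
    exact (mem_support_iff.1 hm) hu
  refine (Ideal.span_le.2 ?_) h1
  rintro _ ⟨j, -, rfl⟩
  exact h j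

lemma constantCoeff_of_isHomogeneous {f : MvPolynomial σ k} {e : ℕ} (he : 0 < e)
    (hf : f.IsHomogeneous e) : f ∈ RingHom.ker (constantCoeff : MvPolynomial σ k →+* k) :=
  hf.coeff_eq_zero (by simpa using he.ne)

/-- A form that completes homogeneous equations to a system of parameters may be replaced by a
linear form. -/
lemma exists_linearForm_parameter [Finite σ] [Infinite k] {J : Ideal (MvPolynomial σ k)}
    (hJ : J.IsHomogeneous (homogeneousSubmodule σ k)) {f : MvPolynomial σ k} {e : ℕ} (he : 0 < e)
    (hf : f.IsHomogeneous e) (hrad : ∀ j, X j ∈ (J ⊔ Ideal.span {f}).radical) :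
    ∃ ℓ : MvPolynomial σ k, ℓ.IsHomogeneous 1 ∧
      ∀ j, X j ∈ (J ⊔ Ideal.span {ℓ}).radical := by
  classical
  have hfin : J.minimalPrimes.Finite := J.finite_minimalPrimes_of_isNoetherianRing
  let V : Ideal (MvPolynomial σ k) → Submodule k (homogeneousSubmodule σ k 1) := fun P =>
    (P.restrictScalars k).comap (homogeneousSubmodule σ k 1).subtype
  let s := (hfin.toFinset.image V).filter (· ≠ ⊤)
  have hs : (⊤ : Submodule k (homogeneousSubmodule σ k 1)) ∉ s := by simp [s]
  -- Over an infinite field finitely many proper subspaces do not cover the linear forms. So `ℓ`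
  -- avoids every minimal prime of `J` that does not contain all linear forms.
  obtain ⟨⟨ℓ, hℓ⟩, hℓs⟩ := (Set.ne_univ_iff_exists_notMem _).1
    (Subspace.biUnion_ne_univ_of_top_notMem hs)
  have hnot : ∀ P ∈ J.minimalPrimes, V P ≠ ⊤ → ℓ ∉ P := by
    intro P hP hV hmem
    refine hℓs (Set.mem_biUnion (x := V P) ?_ hmem)
    simp only [s, Finset.coe_filter, Finset.mem_image, Set.Finite.mem_toFinset]
    exact ⟨⟨P, hP, rfl⟩, hV⟩
  refine ⟨ℓ, hℓ, fun j => ?_⟩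
  rw [← Ideal.sInf_minimalPrimes, Ideal.mem_sInf]
  intro Q hQ
  have hQp : Q.IsPrime := hQ.1.1
  have hQh := isHomogeneous_of_mem_minimalPrimes (isHomogeneous_sup_span_singleton hJ hℓ) hQ
  obtain ⟨P, hP, hPQ⟩ := Ideal.exists_minimalPrimes_le (le_sup_left.trans hQ.1.2)
  have hPp : P.IsPrime := hP.1.1
  by_cases hV : V P = ⊤
  · have : (⟨X j, isHomogeneous_X k j⟩ : homogeneousSubmodule σ k 1) ∈ V P := by
      rw [hV]; trivial
    exact hPQ this
  have hℓQ : ℓ ∈ Q := hQ.1.2 (Ideal.mem_sup_right (Ideal.mem_span_singleton_self ℓ))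
  by_contra hjQ
  set m := RingHom.ker (constantCoeff : MvPolynomial σ k →+* k) with hm
  have hmp : m.IsPrime := RingHom.ker_isPrime _
  have hQm : Q ≤ m := fun u hu => constantCoeff_eq_zero_of_mem hQp hQh hu
  have hjm : X j ∈ m := by simp [hm]
  -- The irrelevant ideal `m` is minimal over `P + (f)`, so m/P has height at most 1 by Krull. If
  -- `Q` misses a variable, Q/P is strictly smaller, hence zero, and `ℓ` would lie in `P`.
  have hmin : m ∈ (P ⊔ Ideal.span {f}).minimalPrimes := by
    refine ⟨⟨hmp, sup_le (hPQ.trans hQm) ?_⟩, ?_⟩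
    · rw [Ideal.span_singleton_le_iff_mem]
      exact constantCoeff_of_isHomogeneous he hf
    · rintro r ⟨hr, hle⟩ -
      refine ker_constantCoeff_le fun j => ?_
      have h1 : J ⊔ Ideal.span {f} ≤ r := (sup_le_sup_right hP.1.2 _).trans hle
      exact (hr.radical_le_iff.2 h1) (hrad j)
  have hht := Ideal.map_height_le_one_of_mem_minimalPrimes hmin
  have hsurj : Function.Surjective (Ideal.Quotient.mk P) := Ideal.Quotient.mk_surjective
  have hker : RingHom.ker (Ideal.Quotient.mk P) = P := Ideal.mk_ker
  have hcm : (m.map (Ideal.Quotient.mk P)).comap (Ideal.Quotient.mk P) = m := by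
    rw [Ideal.comap_map_of_surjective' _ hsurj, hker, sup_eq_left]; exact hPQ.trans hQm
  have hcQ : (Q.map (Ideal.Quotient.mk P)).comap (Ideal.Quotient.mk P) = Q := by
    rw [Ideal.comap_map_of_surjective' _ hsurj, hker, sup_eq_left]; exact hPQ
  have hmp' : (m.map (Ideal.Quotient.mk P)).IsPrime :=
    Ideal.map_isPrime_of_surjective hsurj (by rw [hker]; exact hPQ.trans hQm)
  have hQp' : (Q.map (Ideal.Quotient.mk P)).IsPrime :=
    Ideal.map_isPrime_of_surjective hsurj (by rw [hker]; exact hPQ)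
  have hlt : Q.map (Ideal.Quotient.mk P) < m.map (Ideal.Quotient.mk P) := by
    refine lt_of_le_of_ne (Ideal.map_mono hQm) fun heq => hjQ ?_
    rw [← hcQ, heq, hcm]; exact hjm
  have h0 := (Ideal.height_le_iff (n := 1)).1 (by exact_mod_cast hht) _ hQp' hlt
  have h0' : (Q.map (Ideal.Quotient.mk P)).height = 0 := by
    simpa using h0
  rw [Ideal.height_eq_zero_iff] at h0'
  have hbot : Q.map (Ideal.Quotient.mk P) = ⊥ := by
    have : IsDomain (MvPolynomial σ k ⧸ P) := inferInstance
    rw [IsDomain.minimalPrimes_eq_singleton_bot] at h0'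
    exact h0'
  refine hnot P hP hV ?_
  have : ℓ ∈ (Q.map (Ideal.Quotient.mk P)).comap (Ideal.Quotient.mk P) := by rwa [hcQ]
  rw [hbot] at this
  exact Ideal.Quotient.eq_zero_iff_mem.1 this

end LinearParameter

/-! ### Hilbert series and socle of a complete intersection -/

section CompleteIntersection

open MvPolynomial RingTheory.Sequence

variable {σ : Type*} [Fintype σ] [DecidableEq σ] {k : Type*} [Field k]

/-- The members of a finite family other than the one with index `i`. -/
noncomputable def othersList {R : Type*} (g : σ → R) (i : σ) : List R :=
  (Finset.univ.erase i).toList.map g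

lemma othersList_update {R : Type*} (g : σ → R) (i : σ) (f : R) :
    othersList (Function.update g i f) i = othersList g i := by
  refine List.map_congr_left fun j hj => ?_
  have : j ≠ i := by simpa using hj
  simp [this]

lemma toList_map_perm {R : Type*} (g : σ → R) (i : σ) :
    (Finset.univ.toList.map g).Perm (othersList g i ++ [g i]) := by
  have h : (Finset.univ : Finset σ).toList.Perm ((Finset.univ.erase i).toList ++ [i]) := by
    refine (List.perm_ext_iff_of_nodup (Finset.nodup_toList _) ?_).2 fun j => ?_
    · simp [List.nodup_append, Finset.nodup_toList]
    · simp [em']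
  simpa [othersList] using h.map g

lemma ofList_toList_map {R : Type*} [CommRing R] (g : σ → R) :
    Ideal.ofList (Finset.univ.toList.map g) = Ideal.span (Set.range g) := by
  rw [Ideal.ofList]
  congr 1
  ext x
  simp

lemma ofList_othersList_sup {R : Type*} [CommRing R] (g : σ → R) (i : σ) :
    Ideal.ofList (othersList g i) ⊔ Ideal.span {g i} = Ideal.span (Set.range g) := by
  rw [← Ideal.ofList_singleton, ← Ideal.ofList_append, ← ofList_toList_map, Ideal.ofList,
    Ideal.ofList]
  congr 1
  ext x
  exact (toList_map_perm g i).mem_iff.symm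

/-- The properties of a homogeneous complete intersection with generators `g` of degrees `e`:
regularity, the Hilbert series, and the concentration of the socle in one degree. -/
structure IsCompleteIntersection (g : σ → MvPolynomial σ k) (e : σ → ℕ) : Prop where
  regular : IsWeaklyRegular (MvPolynomial σ k) (Finset.univ.toList.map g)
  hilbSeries_eq : hilbSeries (Ideal.span (Set.range g)) =
    ∏ i, ∑ j ∈ Finset.range (e i), PowerSeries.X ^ j
  socle : ∀ (i : ℕ) (u : MvPolynomial σ k), u.IsHomogeneous i → i + Fintype.card σ ≠ ∑ j, e j →
    (∀ j, X j * u ∈ Ideal.span (Set.range g)) → u ∈ Ideal.span (Set.range g)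

lemma isWeaklyRegular_map_X (l : List σ) (hl : l.Nodup) :
    IsWeaklyRegular (MvPolynomial σ k) (l.map (X : σ → MvPolynomial σ k)) := by
  induction l using List.reverseRecOn with
  | nil => exact IsWeaklyRegular.nil _ _
  | append_singleton l a ih =>
    rw [List.nodup_append] at hl
    rw [List.map_append, List.map_singleton, isWeaklyRegular_append_singleton_iff]
    refine ⟨ih hl.1, fun u hu => ?_⟩
    have hspan : Ideal.ofList (l.map (X : σ → MvPolynomial σ k)) =
        Ideal.span (X '' {j | j ∈ l}) := by
      rw [Ideal.ofList]; congr 1; ext x; simp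
    rw [hspan, mem_ideal_span_X_image] at hu ⊢
    intro m hm
    obtain ⟨i, hi, hne⟩ := hu (Finsupp.single a 1 + m) (by
      rw [mem_support_iff] at hm ⊢
      rwa [coeff_X_mul])
    refine ⟨i, hi, ?_⟩
    have hia : i ≠ a := fun h => hl.2.2 i hi a (by simp) h
    simpa [Finsupp.single_apply, hia.symm] using hne

lemma linearForm_eq_sum {ℓ : MvPolynomial σ k} (hℓ : ℓ.IsHomogeneous 1) :
    ℓ = ∑ j, coeff (Finsupp.single j 1) ℓ • X j := by
  ext u
  rw [coeff_sum]
  simp only [coeff_smul, coeff_X, smul_eq_mul, mul_ite, mul_one, mul_zero]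
  by_cases hu : u.degree = 1
  · obtain ⟨i, rfl⟩ : ∃ i, u = Finsupp.single i 1 :=
      (Finsupp.sum_eq_one_iff u).1 hu
    simp [Finsupp.single_left_inj]
  · rw [hℓ.coeff_eq_zero hu, Finset.sum_eq_zero]
    intro j _
    rw [if_neg]
    rintro rfl
    simp at hu

lemma hilbSeries_span_range_X :
    hilbSeries (Ideal.span (Set.range (X : σ → MvPolynomial σ k))) = 1 := by
  have hI : ∀ u : MvPolynomial σ k, u ∈ Ideal.span (Set.range (X : σ → MvPolynomial σ k)) ↔
      coeff 0 u = 0 := by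
    intro u
    rw [← Set.image_univ, mem_ideal_span_X_image]
    constructor
    · intro h
      by_contra hne
      obtain ⟨i, -, hi⟩ := h 0 (mem_support_iff.2 hne)
      exact hi rfl
    · intro h m hm
      by_contra hcon
      push Not at hcon
      have : m = 0 := Finsupp.ext fun i => hcon i trivial
      subst this
      exact (mem_support_iff.1 hm) h
  ext i
  rw [hilbSeries, PowerSeries.coeff_mk, PowerSeries.coeff_one, hilb]
  split_ifs with h
  · subst h
    have : (homogeneousSubmodule σ k 0).map
        (Ideal.Quotient.mkₐ k (Ideal.span (Set.range (X : σ → MvPolynomial σ k)))).toLinearMap =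
        Submodule.span k {1} := by
      rw [homogeneousSubmodule_zero, Submodule.one_eq_span, Submodule.map_span]
      simp
    rw [this, finrank_span_singleton]
    · rfl
    · intro h1
      have : (1 : MvPolynomial σ k) ∈ Ideal.span (Set.range (X : σ → MvPolynomial σ k)) :=
        Ideal.Quotient.eq_zero_iff_mem.1 (by simpa using h1)
      rw [hI] at this
      simp at this
  · rw [Nat.cast_eq_zero, Submodule.finrank_eq_zero, eq_bot_iff]
    intro x hx
    obtain ⟨u, hu, rfl⟩ := mem_hilb_space.1 hx
    rw [Submodule.mem_bot, Ideal.Quotient.eq_zero_iff_mem, hI]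
    exact hu.coeff_eq_zero (by simpa using Ne.symm h)

/-- The linear forms have no common zero but the origin, so their coefficient matrix is invertible.
A linear change of coordinates then carries the variables to the `g i`, and the quotient is the base
field. -/
lemma isCompleteIntersection_of_linear {g : σ → MvPolynomial σ k}
    (hg : ∀ i, (g i).IsHomogeneous 1)
    (hrad : ∀ j, X j ∈ (Ideal.span (Set.range g)).radical) :
    IsCompleteIntersection g fun _ => 1 := by
  let C : Matrix σ σ k := Matrix.of fun i j => coeff (Finsupp.single j 1) (g i)
  have hgC : ∀ i, g i = ∑ j, C i j • X j := fun i => linearForm_eq_sum (hg i)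
  have hinj : Function.Injective C.mulVec := by
    rw [← Matrix.coe_mulVecLin, ← LinearMap.ker_eq_bot, LinearMap.ker_eq_bot']
    intro p hp
    have hle : Ideal.span (Set.range g) ≤ RingHom.ker (eval p) := by
      rw [Ideal.span_le]
      rintro _ ⟨i, rfl⟩
      have : (C.mulVec p) i = 0 := congrFun hp i
      rw [SetLike.mem_coe, RingHom.mem_ker, hgC]
      simpa [smul_eval, Matrix.mulVec, dotProduct] using this
    funext j
    have h1 := (RingHom.ker_isPrime (eval p)).radical_le_iff.2 hle (hrad j)
    simpa [RingHom.mem_ker] using h1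
  have hunit : IsUnit C := Matrix.mulVec_injective_iff_isUnit.1 hinj
  have hdet : IsUnit C.det := (Matrix.isUnit_iff_isUnit_det C).1 hunit
  have hX : ∀ j, (X j : MvPolynomial σ k) = ∑ i, C⁻¹ j i • g i := by
    intro j
    simp_rw [hgC, Finset.smul_sum, smul_smul]
    rw [Finset.sum_comm]
    simp_rw [← Finset.sum_smul]
    have : ∀ l, ∑ i, C⁻¹ j i * C i l = (1 : Matrix σ σ k) j l := by
      intro l; rw [← Matrix.nonsing_inv_mul C hdet, Matrix.mul_apply]
    simp [this, Matrix.one_apply]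
  have hspan : Ideal.span (Set.range g) = Ideal.span (Set.range X) := by
    apply le_antisymm
    · rw [Ideal.span_le]
      rintro _ ⟨i, rfl⟩
      rw [SetLike.mem_coe, hgC]
      exact Ideal.sum_mem _ fun j _ =>
        Submodule.smul_of_tower_mem _ _ (Ideal.subset_span ⟨j, rfl⟩)
    · rw [Ideal.span_le]
      rintro _ ⟨i, rfl⟩
      rw [SetLike.mem_coe, hX]
      exact Ideal.sum_mem _ fun j _ =>
        Submodule.smul_of_tower_mem _ _ (Ideal.subset_span ⟨j, rfl⟩)
  refine ⟨?_, ?_, ?_⟩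
  · let φ : MvPolynomial σ k →ₐ[k] MvPolynomial σ k := aeval g
    let ψ : MvPolynomial σ k →ₐ[k] MvPolynomial σ k := aeval fun j => ∑ i, C⁻¹ j i • X i
    let E : MvPolynomial σ k ≃ₐ[k] MvPolynomial σ k := AlgEquiv.ofAlgHom φ ψ
      (by
        ext1 j
        simp only [AlgHom.comp_apply, ψ, φ, aeval_X, map_sum, map_smul, AlgHom.id_apply]
        exact (hX j).symm)
      (by
        ext1 i
        simp only [AlgHom.comp_apply, ψ, φ, aeval_X, AlgHom.id_apply]
        rw [hgC, map_sum]
        simp only [map_smul, aeval_X, Finset.smul_sum, smul_smul]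
        rw [Finset.sum_comm]
        simp_rw [← Finset.sum_smul]
        have : ∀ l, ∑ j, C i j * C⁻¹ j l = (1 : Matrix σ σ k) i l := by
          intro l; rw [← Matrix.mul_nonsing_inv C hdet, Matrix.mul_apply]
        simp [this, Matrix.one_apply])
    have hXreg := isWeaklyRegular_map_X (k := k) (Finset.univ : Finset σ).toList
      (Finset.nodup_toList _)
    refine (AddEquiv.isWeaklyRegular_congr (e := E.toRingEquiv.toAddEquiv)
      (as := Finset.univ.toList.map X) (bs := Finset.univ.toList.map g) ?_).1 hXreg
    rw [List.forall₂_map_left_iff, List.forall₂_map_right_iff, List.forall₂_same]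
    intro i _ x
    change E (X i * x) = g i * E x
    rw [map_mul]
    congr 1
    exact aeval_X g i
  · rw [hspan, hilbSeries_span_range_X]
    simp
  · intro i u hu hi _
    rw [hspan, ← Set.image_univ, mem_ideal_span_X_image]
    intro m hm
    by_contra hcon
    push Not at hcon
    have : m = 0 := Finsupp.ext fun i => hcon i trivial
    subst this
    refine (mem_support_iff.1 hm) (hu.coeff_eq_zero ?_)
    intro h0
    apply hi
    simp at h0
    simp [← h0]

/-- After moving `ℓ` to the end, regularity of the exchanged family says that the other generators
are regular and `ℓ` is regular modulo them. By the radical hypothesis `ℓ` is nilpotent modulo `g`,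
so `g i` is regular too, and the exchange lemmas transfer series and socle. -/
lemma IsCompleteIntersection.exchange {g : σ → MvPolynomial σ k} {e : σ → ℕ}
    (he : ∀ i, 0 < e i) (hg : ∀ i, (g i).IsHomogeneous (e i))
    (hrad : ∀ j, X j ∈ (Ideal.span (Set.range g)).radical) {i : σ} {ℓ : MvPolynomial σ k}
    (hℓ : ℓ.IsHomogeneous 1)
    (h : IsCompleteIntersection (Function.update g i ℓ) (Function.update e i 1)) :
    IsCompleteIntersection g e := by
  set J := Ideal.ofList (othersList g i) with hJdef
  have hmem : ∀ f ∈ othersList g i, ∃ e, 0 < e ∧ f.IsHomogeneous e := by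
    intro f hf
    obtain ⟨j, -, rfl⟩ := List.mem_map.1 hf
    exact ⟨e j, he j, hg j⟩
  have hJ : J.IsHomogeneous (homogeneousSubmodule σ k) := isHomogeneous_ofList hmem
  have hJf : J ⊔ Ideal.span {g i} = Ideal.span (Set.range g) := ofList_othersList_sup g i
  have hJℓ : J ⊔ Ideal.span {ℓ} = Ideal.span (Set.range (Function.update g i ℓ)) := by
    rw [← ofList_othersList_sup _ i, othersList_update, Function.update_self]
  have hhom : ∀ f ∈ Finset.univ.toList.map (Function.update g i ℓ),
      ∃ e, 0 < e ∧ f.IsHomogeneous e := by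
    intro f hf
    obtain ⟨j, -, rfl⟩ := List.mem_map.1 hf
    by_cases hj : j = i
    · subst hj; exact ⟨1, one_pos, by simpa using hℓ⟩
    · exact ⟨e j, he j, by simpa [hj] using hg j⟩
  have hreg := isWeaklyRegular_perm_of_isHomogeneous hhom h.regular (toList_map_perm _ i)
  rw [isWeaklyRegular_append_singleton_iff, othersList_update, Function.update_self] at hreg
  obtain ⟨hregJ, hregℓ⟩ := hreg
  have hℓrad : ℓ ∈ (J ⊔ Ideal.span {g i}).radical := by
    rw [hJf]
    have := linearForm_mul_mem (I := (Ideal.span (Set.range g)).radical) (u := 1) hℓ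
      (fun j => by rw [mul_one]; exact hrad j)
    rwa [mul_one] at this
  obtain ⟨N, hN⟩ := hℓrad
  have hregf : ∀ u, g i * u ∈ J → u ∈ J := mul_mem_of_pow_mem_sup hN hregℓ
  have hsum : ∑ j, e j + 1 = ∑ j, Function.update e i 1 j + e i := by
    rw [← Finset.add_sum_erase _ e (Finset.mem_univ i),
      ← Finset.add_sum_erase _ (Function.update e i 1) (Finset.mem_univ i),
      Function.update_self]
    have : ∑ j ∈ Finset.univ.erase i, Function.update e i 1 j =
        ∑ j ∈ Finset.univ.erase i, e j :=
      Finset.sum_congr rfl fun j hj => by simp [(Finset.mem_erase.1 hj).1]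
    omega
  refine ⟨?_, ?_, ?_⟩
  · refine isWeaklyRegular_perm_of_isHomogeneous ?_ ?_ (toList_map_perm g i).symm
    · intro f hf
      have := (toList_map_perm g i).mem_iff.2 hf
      obtain ⟨j, -, rfl⟩ := List.mem_map.1 this
      exact ⟨e j, he j, hg j⟩
    · rw [isWeaklyRegular_append_singleton_iff]
      exact ⟨hregJ, hregf⟩
  · rw [← hJf, hilbSeries_exchange hJ (hg i) hℓ hregf hregℓ, hJℓ, h.hilbSeries_eq,
      ← Finset.mul_prod_erase _ _ (Finset.mem_univ i),
      ← Finset.mul_prod_erase (Finset.univ) (fun i => ∑ j ∈ Finset.range (e i), _)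
        (Finset.mem_univ i), Function.update_self]
    simp only [Finset.range_one, Finset.sum_singleton, pow_zero, one_mul]
    congr 1
    exact Finset.prod_congr rfl fun j hj => by simp [(Finset.mem_erase.1 hj).1]
  · intro a u hu ha hXu
    rw [← hJf] at hXu ⊢
    refine socle_exchange hJ (hg i) hℓ hregf hregℓ (c := Fintype.card σ)
      (τ := ∑ j, Function.update e i 1 j) ?_ a u hu (by omega) hXu
    rw [hJℓ]
    exact h.socle

/-- As many forms of positive degree as there are variables, with radical the irrelevant ideal,
form a complete intersection. -/
theorem isCompleteIntersection_of_radical [Infinite k] {g : σ → MvPolynomial σ k} {e : σ → ℕ}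
    (he : ∀ i, 0 < e i) (hg : ∀ i, (g i).IsHomogeneous (e i))
    (hrad : ∀ j, X j ∈ (Ideal.span (Set.range g)).radical) : IsCompleteIntersection g e := by
  -- Each exchange lowers the number of generators of degree other than 1; the linear form is chosen
  -- so that the radical hypothesis survives.
  induction hn : (Finset.univ.filter fun i => e i ≠ 1).card generalizing g e with
  | zero =>
    have h1 : e = fun _ => 1 := by
      funext i
      by_contra hi
      rw [Finset.card_eq_zero] at hn
      have : i ∈ Finset.univ.filter fun i => e i ≠ 1 := by simp [hi]
      rw [hn] at this
      simp at this
    subst h1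
    exact isCompleteIntersection_of_linear hg hrad
  | succ N ih =>
    obtain ⟨i, hi⟩ := Finset.card_pos.1 (by omega : 0 < (Finset.univ.filter fun i => e i ≠ 1).card)
    have hJ : (Ideal.ofList (othersList g i)).IsHomogeneous (homogeneousSubmodule σ k) := by
      refine isHomogeneous_ofList fun f hf => ?_
      obtain ⟨j, -, rfl⟩ := List.mem_map.1 hf
      exact ⟨e j, he j, hg j⟩
    obtain ⟨ℓ, hℓ, hℓrad⟩ := exists_linearForm_parameter hJ (he i) (hg i)
      (by rw [ofList_othersList_sup]; exact hrad)
    refine IsCompleteIntersection.exchange he hg hrad hℓ (i := i) (ih ?_ ?_ ?_ ?_)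
    · intro j
      by_cases hj : j = i
      · subst hj; simp
      · simpa [hj] using he j
    · intro j
      by_cases hj : j = i
      · subst hj; simpa using hℓ
      · simpa [hj] using hg j
    · rwa [← ofList_othersList_sup _ i, othersList_update, Function.update_self]
    · have : (Finset.univ.filter fun j => Function.update e i 1 j ≠ 1) =
          (Finset.univ.filter fun j => e j ≠ 1).erase i := by
        ext j
        by_cases hj : j = i
        · subst hj; simp
        · simp [hj]
      rw [this, Finset.card_erase_of_mem hi, hn]
      rfl

end CompleteIntersection

/-! ### The apolarity pairing -/

section Pairing

open MvPolynomial

variable {n : ℕ} {R : Type*} [CommRing R]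

/-- The product of the factorials of the exponents. -/
def mfact (m : Fin n →₀ ℕ) : ℕ := ∏ i, (m i).factorial

@[simp] lemma mfact_zero : mfact (0 : Fin n →₀ ℕ) = 1 := by simp [mfact]

lemma mfact_ne_zero (m : Fin n →₀ ℕ) : mfact m ≠ 0 :=
  Finset.prod_ne_zero_iff.2 fun _ _ => Nat.factorial_ne_zero _

lemma mfact_add_single (m : Fin n →₀ ℕ) (i : Fin n) :
    mfact (m + Finsupp.single i 1) = mfact m * (m i + 1) := by
  rw [mfact, mfact, ← Finset.mul_prod_erase _ _ (Finset.mem_univ i),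
    ← Finset.mul_prod_erase _ (fun i => (m i).factorial) (Finset.mem_univ i)]
  have : ∏ j ∈ Finset.univ.erase i, ((m + Finsupp.single i 1 : Fin n →₀ ℕ) j).factorial =
      ∏ j ∈ Finset.univ.erase i, (m j).factorial :=
    Finset.prod_congr rfl fun j hj => by
      simp [(Finset.mem_erase.1 hj).1.symm]
  rw [this]
  simp [Nat.factorial_succ]
  ring

lemma monomialOp_zero : monomialOp R (0 : Fin n →₀ ℕ) = 1 := by
  simp [monomialOp]

lemma monomialOp_single (i : Fin n) : monomialOp R (Finsupp.single i 1) = partialOp R i := by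
  have key : ∀ l : List (Fin n), l.Nodup →
      (l.map fun j => partialOp R j ^ (Finsupp.single i 1 : Fin n →₀ ℕ) j).prod =
        if i ∈ l then partialOp R i else 1 := by
    intro l hl
    induction l with
    | nil => simp
    | cons j l ih =>
      rw [List.nodup_cons] at hl
      rw [List.map_cons, List.prod_cons, ih hl.2]
      by_cases hij : i = j
      · subst hij; simp [hl.1]
      · simp [hij]
  rw [monomialOp, key _ (List.nodup_finRange n)]
  simp

/-- Differentiating monomials produces quotients of factorials; with both sides cleared of
denominators the formula holds over any commutative ring. -/
lemma mfact_mul_coeff_monomialOp (a : Fin n →₀ ℕ) (G : MvPolynomial (Fin n) R)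
    (b : Fin n →₀ ℕ) :
    (mfact b : R) * coeff b (monomialOp R a G) = mfact (a + b) * coeff (a + b) G := by
  induction a using Finsupp.induction_linear generalizing G b with
  | zero => simp [monomialOp_zero]
  | add f g hf hg =>
    rw [monomialOp_add, Module.End.mul_apply, hf, hg, ← add_assoc, add_comm g f]
  | single i e =>
    induction e generalizing b with
    | zero => simp [monomialOp_zero]
    | succ e ih =>
      rw [Nat.add_comm e 1, Finsupp.single_add, monomialOp_add, Module.End.mul_apply,
        monomialOp_single]
      change (mfact b : R) * coeff b (pderiv i _) = _
      have h := ih (b + Finsupp.single i 1)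
      rw [mfact_add_single, ← add_assoc] at h
      rw [coeff_pderiv]
      have hcomm : Finsupp.single i 1 + Finsupp.single i e + b =
        Finsupp.single i e + b + Finsupp.single i 1 := by abel
      rw [hcomm, ← h]
      push_cast
      ring

/-- The pairing of differential operators and forms: the constant term of `h ∘ F`. -/
noncomputable def pairing (F : MvPolynomial (Fin n) R) : MvPolynomial (Fin n) R →ₗ[R] R :=
  lcoeff R 0 ∘ₗ act F

lemma pairing_apply (F h : MvPolynomial (Fin n) R) : pairing F h = coeff 0 (act F h) := rfl

lemma pairing_monomial (F : MvPolynomial (Fin n) R) (a : Fin n →₀ ℕ) :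
    pairing F (monomial a 1) = mfact a * coeff a F := by
  have := mfact_mul_coeff_monomialOp a F 0
  rw [pairing_apply, act_monomial, one_smul]
  simpa using this

lemma pairing_mul (F g h : MvPolynomial (Fin n) R) : pairing F (g * h) = pairing (act F h) g := by
  rw [pairing_apply, pairing_apply, act_mul]

lemma mfact_mul_coeff_act (F h : MvPolynomial (Fin n) R) (b : Fin n →₀ ℕ) :
    (mfact b : R) * coeff b (act F h) = pairing F (monomial b 1 * h) := by
  rw [pairing_mul, pairing_monomial]

/-- The functional on polynomials given by its values on the monomials of degree `s`. -/
noncomputable def evForm {s : ℕ} (W : Mon n s → R) : MvPolynomial (Fin n) R →ₗ[R] R :=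
  ∑ u, W u • lcoeff R u.1

lemma evForm_apply {s : ℕ} (W : Mon n s → R) (h : MvPolynomial (Fin n) R) :
    evForm W h = ∑ u, W u * coeff u.1 h := by
  simp [evForm]

lemma evForm_monomial {s : ℕ} (W : Mon n s → R) (u : Mon n s) :
    evForm W (monomial u.1 1) = W u := by
  classical
  rw [evForm_apply, Finset.sum_eq_single u]
  · simp
  · intro v _ hv
    rw [coeff_monomial, if_neg (fun h => hv (Subtype.ext h.symm)), mul_zero]
  · simp

lemma evForm_of_isHomogeneous {s e : ℕ} (W : Mon n s → R) {h : MvPolynomial (Fin n) R}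
    (hh : h.IsHomogeneous e) (hne : e ≠ s) : evForm W h = 0 := by
  rw [evForm_apply]
  refine Finset.sum_eq_zero fun u _ => ?_
  rw [hh.coeff_eq_zero (by rw [u.2]; exact hne.symm), mul_zero]

lemma ext_monomial {M : Type*} [AddCommMonoid M] [Module R M]
    {f g : MvPolynomial (Fin n) R →ₗ[R] M} (h : ∀ a, f (monomial a 1) = g (monomial a 1)) :
    f = g := (basisMonomials (Fin n) R).ext fun a => by simpa using h a

/-- Multiplying coefficients by factorials turns differentiation into contraction: in these
coordinates the pairing is the plain dot product of coefficients. All linear algebra below is done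
in them. -/
lemma pairing_eq_evForm {s : ℕ} {F : MvPolynomial (Fin n) R} (hF : F.IsHomogeneous s) :
    pairing F = evForm fun u : Mon n s => (mfact u.1 : R) * coeff u.1 F := by
  refine ext_monomial fun a => ?_
  rw [pairing_monomial]
  by_cases ha : a.degree = s
  · exact (evForm_monomial (fun u : Mon n s => (mfact u.1 : R) * coeff u.1 F) ⟨a, ha⟩).symm
  · rw [evForm_of_isHomogeneous _ (isHomogeneous_monomial 1 rfl) ha, hF.coeff_eq_zero ha, mul_zero]

variable {k : Type*} [Field k]

/-- The form whose coefficients are given by a point of the space of coefficients. -/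
noncomputable def formOf {s : ℕ} (c : Mon n s → R) : MvPolynomial (Fin n) R :=
  ∑ m, monomial m.1 (c m)

lemma coeff_formOf {s : ℕ} (c : Mon n s → R) (m : Mon n s) : coeff m.1 (formOf c) = c m := by
  classical
  rw [formOf, coeff_sum, Finset.sum_eq_single m]
  · simp
  · intro v _ hv
    rw [coeff_monomial, if_neg (fun h => hv (Subtype.ext h))]
  · simp

lemma isHomogeneous_formOf {s : ℕ} (c : Mon n s → R) : (formOf c).IsHomogeneous s :=
  IsHomogeneous.sum _ _ _ fun m _ => isHomogeneous_monomial _ m.2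

lemma formOf_coeff {s : ℕ} {F : MvPolynomial (Fin n) R} (hF : F.IsHomogeneous s) :
    formOf (fun m : Mon n s => coeff m.1 F) = F := by
  ext a
  by_cases ha : a.degree = s
  · exact coeff_formOf (fun m : Mon n s => coeff m.1 F) ⟨a, ha⟩
  · rw [hF.coeff_eq_zero ha, (isHomogeneous_formOf _).coeff_eq_zero ha]

lemma genericForm_eq (s : ℕ) : genericForm k n s = formOf X := rfl

/-- Up to the row factor, a catalecticant entry depends only on the product of its row and column
monomials. The target `A` is arbitrary, so that the formula serves for closed points, local rings
and the parameter ring alike. -/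
lemma mfact_mul_catMatrix {A : Type*} [CommRing A] [Algebra k A] {s i : ℕ}
    (φ : CoeffRing k n s →ₐ[k] A) (b : Mon n (s - i)) (a : Mon n i) :
    (mfact b.1 : A) * φ (catMatrix k n s i b a) =
      evForm (fun u => (mfact u.1 : A) * φ (X u)) (monomial (b.1 + a.1) 1) := by
  have h := mfact_mul_coeff_act (genericForm k n s) (monomial a.1 1) b.1
  rw [genericForm_eq, pairing_eq_evForm (isHomogeneous_formOf X), ← genericForm_eq, monomial_mul, one_mul] at h
  have h2 := congrArg φ h
  rw [map_mul, map_natCast] at h2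
  rw [catMatrix, Matrix.of_apply, h2, evForm_apply, evForm_apply, map_sum]
  refine Finset.sum_congr rfl fun u _ => ?_
  rw [genericForm_eq, coeff_formOf, map_mul, map_mul, map_natCast, coeff_monomial, coeff_monomial]
  split_ifs <;> simp

/-- In characteristic 0 the coefficients of h ∘ F are recovered from the pairings of `F` with the
monomial multiples of `h`. -/
lemma mem_annihilator_iff [CharZero k] {F h : MvPolynomial (Fin n) k} :
    h ∈ annihilator F ↔ ∀ g, pairing F (g * h) = 0 := by
  constructor
  · intro hh g
    rw [pairing_mul, show act F h = 0 from hh]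
    have : pairing (0 : MvPolynomial (Fin n) k) = 0 :=
      ext_monomial fun a => by simp [pairing_monomial]
    rw [this, LinearMap.zero_apply]
  · intro hh
    change act F h = 0
    ext b
    have := mfact_mul_coeff_act F h b
    rw [hh, mul_eq_zero] at this
    simpa [mfact_ne_zero] using this

end Pairing

/-! ### Catalecticant ranks and minors -/

section Rank

open MvPolynomial

variable {n : ℕ} {k : Type*} [Field k]

lemma homogeneousSubmodule_eq_span (i : ℕ) : homogeneousSubmodule (Fin n) k i =
    Submodule.span k (Set.range fun a : Mon n i => (monomial a.1 1 : MvPolynomial (Fin n) k)) := by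
  apply le_antisymm
  · intro h hh
    rw [h.as_sum]
    refine Submodule.sum_mem _ fun a ha => ?_
    have : (monomial a (coeff a h) : MvPolynomial (Fin n) k) = coeff a h • monomial a 1 := by
      simp [smul_monomial]
    rw [this]
    refine Submodule.smul_mem _ _ (Submodule.subset_span ⟨⟨a, ?_⟩, rfl⟩)
    by_contra hne
    exact (mem_support_iff.1 ha) (IsHomogeneous.coeff_eq_zero hh hne)
  · rw [Submodule.span_le]
    rintro _ ⟨a, rfl⟩
    exact isHomogeneous_monomial _ a.2

lemma finrank_map_eq_of_ker {V V₁ V₂ : Type*} [AddCommGroup V] [Module k V] [AddCommGroup V₁]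
    [Module k V₁] [AddCommGroup V₂] [Module k V₂] {U : Submodule k V} [Module.Finite k U]
    {f : V →ₗ[k] V₁} {g : V →ₗ[k] V₂} (h : ∀ x ∈ U, f x = 0 ↔ g x = 0) :
    Module.finrank k (U.map f) = Module.finrank k (U.map g) := by
  have hf := LinearMap.finrank_range_add_finrank_ker (f.domRestrict U)
  have hg := LinearMap.finrank_range_add_finrank_ker (g.domRestrict U)
  have hk : LinearMap.ker (f.domRestrict U) = LinearMap.ker (g.domRestrict U) := by
    ext ⟨x, hx⟩
    simpa using h x hx
  rw [LinearMap.range_domRestrict] at hf hg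
  rw [hk] at hf
  omega

lemma pairing_formOf {s : ℕ} (c : Mon n s → k) :
    pairing (formOf c) = evForm fun u : Mon n s => (mfact u.1 : k) * c u := by
  rw [pairing_eq_evForm (isHomogeneous_formOf c)]
  congr 1
  funext u
  rw [coeff_formOf]

lemma map_catMatrix_apply [CharZero k] {s i : ℕ} (φ : CoeffRing k n s →ₐ[k] k)
    (b : Mon n (s - i)) (a : Mon n i) : φ (catMatrix k n s i b a) =
      coeff b.1 (act (formOf fun m => φ (X m)) (monomial a.1 1)) := by
  have h1 := mfact_mul_catMatrix φ b a
  have h2 := mfact_mul_coeff_act (formOf fun m => φ (X m)) (monomial a.1 1) b.1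
  rw [monomial_mul, one_mul, pairing_formOf, ← h1] at h2
  have h3 : (mfact b.1 : k) ≠ 0 := Nat.cast_ne_zero.2 (mfact_ne_zero _)
  exact (mul_left_cancel₀ h3 h2).symm

lemma act_eq_zero_of_coeff [CharZero k] {s i : ℕ} (hi : i ≤ s) {F h : MvPolynomial (Fin n) k}
    (hF : F.IsHomogeneous s) (hh : h.IsHomogeneous i)
    (h0 : ∀ b : Mon n (s - i), coeff b.1 (act F h) = 0) : act F h = 0 := by
  ext b
  rw [coeff_zero]
  by_cases hb : b.degree = s - i
  · exact h0 ⟨b, hb⟩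
  · have h2 := mfact_mul_coeff_act F h b
    rw [pairing_eq_evForm hF,
      evForm_of_isHomogeneous _ ((isHomogeneous_monomial 1 rfl).mul hh) (by omega),
      mul_eq_zero] at h2
    simpa [mfact_ne_zero] using h2

/-- The columns span the image of the forms of degree `i` under h ↦ h ∘ F, and this map has the same
kernel as the projection to S/F^⊥. -/
lemma rank_catMatrix_map [CharZero k] {s i : ℕ} (hi : i ≤ s) (φ : CoeffRing k n s →ₐ[k] k) :
    ((catMatrix k n s i).map φ).rank = hilbertFn (formOf fun m => φ (X m)) i := by
  set F := formOf fun m => φ (X m) with hFdef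
  let T : MvPolynomial (Fin n) k →ₗ[k] (Mon n (s - i) → k) :=
    (LinearMap.pi fun b => lcoeff k b.1) ∘ₗ act F
  rw [Matrix.rank_eq_finrank_span_cols]
  have hspan : Submodule.span k (Set.range ((catMatrix k n s i).map φ).col) =
      (homogeneousSubmodule (Fin n) k i).map T := by
    rw [homogeneousSubmodule_eq_span, Submodule.map_span, ← Set.range_comp]
    congr 2
    funext a
    funext b
    exact map_catMatrix_apply φ b a
  rw [hspan, hilbertFn]
  refine finrank_map_eq_of_ker fun h hh => ?_
  have hmk : (Ideal.Quotient.mkₐ k (annihilator F)).toLinearMap h = 0 ↔ act F h = 0 :=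
    Ideal.Quotient.eq_zero_iff_mem
  rw [hmk]
  constructor
  · intro h0
    exact act_eq_zero_of_coeff hi (isHomogeneous_formOf _) hh fun b => congrFun h0 b
  · intro h0
    funext b
    change coeff b.1 (act F h) = 0
    rw [h0, coeff_zero]

lemma minorsIdeal_le_ker {ι κ A : Type*} [Fintype κ] [CommRing A] (M : Matrix ι κ A)
    (φ : A →+* k) {r : ℕ} (h : (M.map φ).rank < r) : minorsIdeal M r ≤ RingHom.ker φ := by
  rw [minorsIdeal, Ideal.span_le]
  rintro _ ⟨p, q, rfl⟩
  rw [SetLike.mem_coe, RingHom.mem_ker, RingHom.map_det]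
  by_contra hne
  have h1 := Matrix.rank_of_det_ne_zero hne
  have h2 := Matrix.rank_submatrix_le (M.map φ) p q
  rw [Fintype.card_fin] at h1
  have h3 : φ.mapMatrix (M.submatrix p q) = (M.map φ).submatrix p q := rfl
  rw [h3] at h1
  omega

lemma exists_rows_det_ne_zero {ι κ : Type*} [Finite ι] [Fintype κ] [DecidableEq κ]
    (M : Matrix ι κ k) (hM : LinearIndependent k M.col) :
    ∃ f : κ → ι, Function.Injective f ∧ (M.submatrix f id).det ≠ 0 := by
  classical
  cases nonempty_fintype ι
  have hrank : Module.finrank k (Submodule.span k (Set.range M.row)) = Fintype.card κ := by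
    rw [← Matrix.rank_eq_finrank_span_row, ← Matrix.rank_transpose]
    exact LinearIndependent.rank_matrix (M := M.transpose) hM
  obtain ⟨τ, a, ha, hsp, hli⟩ := exists_linearIndependent' k M.row
  have : Finite τ := Finite.of_injective a ha
  cases nonempty_fintype τ
  have hcard : Fintype.card τ = Fintype.card κ := by
    rw [linearIndependent_iff_card_eq_finrank_span.1 hli, Set.finrank, hsp, hrank]
  let e : κ ≃ τ := (Fintype.equivOfCardEq hcard).symm
  refine ⟨a ∘ e, ha.comp e.injective, ?_⟩
  have h2 : LinearIndependent k (M.submatrix (a ∘ e) id).row := hli.comp e e.injective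
  have h3 := Matrix.linearIndependent_rows_iff_isUnit.1 h2
  rw [Matrix.isUnit_iff_isUnit_det] at h3
  exact h3.ne_zero

lemma exists_minor_ne_zero {ι κ : Type*} [Finite ι] [Fintype κ]
    (M : Matrix ι κ k) : ∃ (p : Fin M.rank ↪ ι) (q : Fin M.rank ↪ κ),
      (M.submatrix p q).det ≠ 0 := by
  classical
  obtain ⟨τ, a, ha, hsp, hli⟩ := exists_linearIndependent' k M.col
  have : Finite τ := Finite.of_injective a ha
  cases nonempty_fintype τ
  have hcard : Fintype.card τ = M.rank := by
    rw [linearIndependent_iff_card_eq_finrank_span.1 hli, Set.finrank, hsp,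
      Matrix.rank_eq_finrank_span_cols]
  let e : Fin M.rank ≃ τ := (Fintype.equivFinOfCardEq hcard).symm
  obtain ⟨f, hf, hdet⟩ := exists_rows_det_ne_zero (M.submatrix id (a ∘ e))
    (hli.comp e e.injective)
  exact ⟨⟨f, hf⟩, ⟨a ∘ e, ha.comp e.injective⟩, hdet⟩

end Rank

/-! ### End values of the sequence T -/

section SequenceT

lemma natDegree_geom_sum_X (d : ℕ) :
    (∑ j ∈ Finset.range (d + 1), (Polynomial.X : Polynomial ℕ) ^ j).natDegree = d := by
  apply le_antisymm
  · refine Polynomial.natDegree_sum_le_of_forall_le _ _ fun j hj => ?_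
    rw [Polynomial.natDegree_X_pow]
    exact Nat.lt_succ_iff.1 (Finset.mem_range.1 hj)
  · refine Polynomial.le_natDegree_of_ne_zero ?_
    simp [Polynomial.coeff_X_pow]

lemma monic_geom_sum_X_pow (n d : ℕ) :
    ((∑ j ∈ Finset.range (d + 1), (Polynomial.X : Polynomial ℕ) ^ j) ^ n).Monic :=
  (Polynomial.monic_geom_sum_X (Nat.succ_ne_zero d)).pow n

lemma natDegree_geom_sum_X_pow (n d : ℕ) :
    ((∑ j ∈ Finset.range (d + 1), (Polynomial.X : Polynomial ℕ) ^ j) ^ n).natDegree = n * d := by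
  rw [(Polynomial.monic_geom_sum_X (Nat.succ_ne_zero d)).natDegree_pow, natDegree_geom_sum_X]

lemma seqT_top {n d : ℕ} (hd : 0 < d) : seqT n d (n * (d - 1)) = 1 := by
  obtain ⟨d, rfl⟩ := Nat.exists_eq_add_of_le' hd
  have := (monic_geom_sum_X_pow n d).coeff_natDegree
  rwa [natDegree_geom_sum_X_pow] at this

lemma seqT_eq_zero {n d i : ℕ} (hd : 0 < d) (hi : n * (d - 1) < i) : seqT n d i = 0 := by
  obtain ⟨d, rfl⟩ := Nat.exists_eq_add_of_le' hd
  refine Polynomial.coeff_eq_zero_of_natDegree_lt ?_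
  rw [natDegree_geom_sum_X_pow]
  exact hi

lemma seqT_zero {n d : ℕ} (hd : 0 < d) : seqT n d 0 = 1 := by
  obtain ⟨d, rfl⟩ := Nat.exists_eq_add_of_le' hd
  rw [seqT, Polynomial.coeff_zero_eq_eval_zero]
  simp [Polynomial.eval_pow, Finset.sum_range_succ', Polynomial.eval_finsetSum]

end SequenceT

/-! ### Complete intersections of n forms of degree d -/

section EqualDegrees

open MvPolynomial

variable {n d : ℕ} {k : Type*} [Field k] [Infinite k] {ι : Type*} [Fintype ι]

lemma isCompleteIntersection_reindex (hd : 0 < d) (hcard : Fintype.card ι = n)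
    {g : ι → MvPolynomial (Fin n) k} (hg : ∀ i, (g i).IsHomogeneous d)
    (hrad : ∀ j, X j ∈ (Ideal.span (Set.range g)).radical) :
    ∃ e : Fin n ≃ ι, IsCompleteIntersection (g ∘ e) (fun _ => d) ∧
      Set.range (g ∘ e) = Set.range g := by
  let e : Fin n ≃ ι := (Fintype.equivFinOfCardEq hcard).symm
  have hr : Set.range (g ∘ e) = Set.range g := e.surjective.range_comp g
  exact ⟨e, isCompleteIntersection_of_radical (fun _ => hd) (fun i => hg (e i))
    (by rw [hr]; exact hrad), hr⟩

lemma hilb_eq_seqT (hd : 0 < d) (hcard : Fintype.card ι = n)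
    {g : ι → MvPolynomial (Fin n) k} (hg : ∀ i, (g i).IsHomogeneous d)
    (hrad : ∀ j, X j ∈ (Ideal.span (Set.range g)).radical) (i : ℕ) :
    hilb (Ideal.span (Set.range g)) i = seqT n d i := by
  obtain ⟨e, hci, hr⟩ := isCompleteIntersection_reindex hd hcard hg hrad
  have h := congrArg (PowerSeries.coeff i) hci.hilbSeries_eq
  rw [hr, hilbSeries, PowerSeries.coeff_mk, Finset.prod_const, Finset.card_univ,
    Fintype.card_fin] at h
  have h2 : ((∑ j ∈ Finset.range d, (PowerSeries.X : PowerSeries ℤ) ^ j) ^ n) =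
      ((((∑ j ∈ Finset.range d, (Polynomial.X : Polynomial ℕ) ^ j) ^ n).map
        (Nat.castRingHom ℤ) : Polynomial ℤ) : PowerSeries ℤ) := by
    rw [Polynomial.map_pow, Polynomial.coe_pow, Polynomial.map_sum]
    congr 1
    simp only [Polynomial.map_pow, Polynomial.map_X]
    have := map_sum (Polynomial.coeToPowerSeries.ringHom (R := ℤ))
      (fun j => (Polynomial.X : Polynomial ℤ) ^ j) (Finset.range d)
    simp only [map_pow, Polynomial.coeToPowerSeries.ringHom_apply, Polynomial.coe_X] at this
    exact this.symm
  rw [h2, Polynomial.coeff_coe, Polynomial.coeff_map] at h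
  exact Nat.cast_injective (R := ℤ) h

lemma socle_eq (hd : 0 < d) (hcard : Fintype.card ι = n)
    {g : ι → MvPolynomial (Fin n) k} (hg : ∀ i, (g i).IsHomogeneous d)
    (hrad : ∀ j, X j ∈ (Ideal.span (Set.range g)).radical) {i : ℕ} {u : MvPolynomial (Fin n) k}
    (hu : u.IsHomogeneous i) (hi : i ≠ n * (d - 1))
    (hX : ∀ j, X j * u ∈ Ideal.span (Set.range g)) : u ∈ Ideal.span (Set.range g) := by
  obtain ⟨e, hci, hr⟩ := isCompleteIntersection_reindex hd hcard hg hrad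
  rw [← hr] at hX ⊢
  refine hci.socle i u hu ?_ hX
  obtain ⟨d, rfl⟩ := Nat.exists_eq_add_of_le' hd
  rw [Finset.sum_const, Finset.card_univ, Fintype.card_fin, smul_eq_mul]
  intro h
  apply hi
  rw [Nat.add_sub_cancel]
  rw [mul_add, Nat.succ_eq_add_one, zero_add, mul_one] at h
  omega

end EqualDegrees

/-! ### Functionals vanishing on an ideal -/

section Functionals

open MvPolynomial

variable {n : ℕ} {k : Type*} [Field k]

/-- The functionals on forms of degree `e` that vanish on an ideal. -/
def killSpace (I : Ideal (MvPolynomial (Fin n) k)) (e : ℕ) : Submodule k (Mon n e → k) where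
  carrier := {W | ∀ h ∈ I, evForm W h = 0}
  zero_mem' h _ := by simp [evForm_apply]
  add_mem' {V W} hV hW h hh := by
    have h1 := hV h hh
    have h2 := hW h hh
    rw [evForm_apply] at h1 h2 ⊢
    simp only [Pi.add_apply, add_mul, Finset.sum_add_distrib, h1, h2, add_zero]
  smul_mem' c W hW h hh := by
    have h1 := hW h hh
    rw [evForm_apply] at h1 ⊢
    simp only [Pi.smul_apply, smul_eq_mul, mul_assoc, ← Finset.mul_sum, h1, mul_zero]

lemma mem_killSpace {I : Ideal (MvPolynomial (Fin n) k)} {e : ℕ} {W : Mon n e → k} :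
    W ∈ killSpace I e ↔ ∀ h ∈ I, evForm W h = 0 := Iff.rfl

/-- `formOf` as a linear map. -/
noncomputable def formOfₗ (e : ℕ) : (Mon n e → k) →ₗ[k] MvPolynomial (Fin n) k :=
  ∑ m, (monomial m.1) ∘ₗ LinearMap.proj m

lemma formOfₗ_apply {e : ℕ} (c : Mon n e → k) : formOfₗ e c = formOf c := by
  simp [formOfₗ, formOf]

lemma range_formOfₗ (e : ℕ) :
    LinearMap.range (formOfₗ e) = homogeneousSubmodule (Fin n) k e := by
  ext h
  constructor
  · rintro ⟨c, rfl⟩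
    rw [formOfₗ_apply]
    exact isHomogeneous_formOf c
  · intro hh
    exact ⟨_, by rw [formOfₗ_apply]; exact formOf_coeff hh⟩

lemma evForm_formOf {e : ℕ} (W c : Mon n e → k) : evForm W (formOf c) = W ⬝ᵥ c := by
  rw [evForm_apply]
  exact Finset.sum_congr rfl fun u _ => by rw [coeff_formOf]

lemma evForm_homogeneousComponent {e : ℕ} (W : Mon n e → k) (h : MvPolynomial (Fin n) k) :
    evForm W (homogeneousComponent e h) = evForm W h := by
  rw [evForm_apply, evForm_apply]
  exact Finset.sum_congr rfl fun u _ => by rw [coeff_homogeneousComponent, if_pos u.2]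

/-- These functionals are the dual of the degree `e` piece of the quotient by `I`: under the dot
product they form the annihilator of the degree `e` piece of `I`. -/
lemma finrank_killSpace {I : Ideal (MvPolynomial (Fin n) k)}
    (hI : I.IsHomogeneous (homogeneousSubmodule (Fin n) k)) (e : ℕ) :
    Module.finrank k (killSpace I e) = hilb I e := by
  classical
  let U : Submodule k (Mon n e → k) := (I.restrictScalars k).comap (formOfₗ e)
  have hU : ∀ c, c ∈ U ↔ formOf c ∈ I := fun c => by
    rw [← formOfₗ_apply]; rfl
  have h1 : killSpace I e = U.dualAnnihilator.comap
      (dotProductEquiv k (Mon n e)).toLinearMap := by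
    ext W
    rw [mem_killSpace, Submodule.mem_comap, Submodule.mem_dualAnnihilator]
    constructor
    · intro hW c hc
      have := hW _ ((hU c).1 hc)
      rwa [evForm_formOf] at this
    · intro hW h hh
      rw [← evForm_homogeneousComponent]
      have h2 : formOf (fun m : Mon n e => coeff m.1 (homogeneousComponent e h)) =
        homogeneousComponent e h := formOf_coeff (homogeneousComponent_isHomogeneous _ _)
      rw [← h2, evForm_formOf]
      refine hW _ ((hU _).2 ?_)
      rw [h2]
      exact homogeneousComponent_mem_of_mem hI hh e
  have h2 : Module.finrank k (killSpace I e) = Module.finrank k U.dualAnnihilator := by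
    rw [h1]
    exact (LinearEquiv.ofSubmodule' (dotProductEquiv k (Mon n e)) _).finrank_eq
  have h3 := Subspace.finrank_add_finrank_dualAnnihilator_eq U
  let f := (Ideal.Quotient.mkₐ k I).toLinearMap ∘ₗ formOfₗ e
  have h4 : LinearMap.ker f = U := by
    ext c
    rw [hU, LinearMap.mem_ker, ← formOfₗ_apply]
    exact Ideal.Quotient.eq_zero_iff_mem
  have h5 : LinearMap.range f =
      (homogeneousSubmodule (Fin n) k e).map (Ideal.Quotient.mkₐ k I).toLinearMap := by
    rw [LinearMap.range_comp, range_formOfₗ]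
  have h6 := LinearMap.finrank_range_add_finrank_ker f
  rw [h4, h5] at h6
  rw [h2, hilb]
  omega

lemma hilb_mono {I J : Ideal (MvPolynomial (Fin n) k)} (h : I ≤ J) (i : ℕ) :
    hilb J i ≤ hilb I i := by
  have : (homogeneousSubmodule (Fin n) k i).map (Ideal.Quotient.mkₐ k J).toLinearMap =
      ((homogeneousSubmodule (Fin n) k i).map (Ideal.Quotient.mkₐ k I).toLinearMap).map
        (Ideal.Quotient.factorₐ k h).toLinearMap := by
    rw [← Submodule.map_comp]
    rfl
  rw [hilb, this]
  exact Submodule.finrank_map_le _ _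

/-- A nonzero functional on a one-dimensional graded piece of a quotient detects membership. -/
lemma mem_of_evForm_eq_zero {I : Ideal (MvPolynomial (Fin n) k)} {e : ℕ} (h1 : hilb I e = 1)
    {W : Mon n e → k} (hW : W ∈ killSpace I e) (hne : W ≠ 0) {u : MvPolynomial (Fin n) k}
    (hu : u.IsHomogeneous e) (h0 : evForm W u = 0) : u ∈ I := by
  by_contra hnot
  apply hne
  let V := (homogeneousSubmodule (Fin n) k e).map (Ideal.Quotient.mkₐ k I).toLinearMap
  let v : V := ⟨Ideal.Quotient.mk I u, mem_hilb_space.2 ⟨u, hu, rfl⟩⟩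
  have hv : v ≠ 0 := fun h => hnot (Ideal.Quotient.eq_zero_iff_mem.1 (congrArg Subtype.val h))
  funext m
  obtain ⟨t, ht⟩ := (finrank_eq_one_iff_of_nonzero' v hv).1 h1
    ⟨Ideal.Quotient.mk I (monomial m.1 1), mem_hilb_space.2 ⟨_, isHomogeneous_monomial 1 m.2, rfl⟩⟩
  have ht' : Ideal.Quotient.mk I (t • u) = Ideal.Quotient.mk I (monomial m.1 1) :=
    congrArg Subtype.val ht
  have h2 := hW _ (Ideal.Quotient.eq.1 ht')
  rw [map_sub, map_smul, h0, smul_zero, zero_sub, neg_eq_zero, evForm_monomial] at h2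
  exact h2

end Functionals

/-! ### Relations among the columns as forms of degree d -/

section RelationForms

open MvPolynomial

variable {n d : ℕ} {R : Type*} [CommRing R] {N : Finset (Mon n d)}

/-- The form `x^a - ∑ c_{ab} x^b`, with `b` running over `N`. -/
noncomputable def relForm (c : {a // a ∉ N} → {b // b ∈ N} → R) (a : {a // a ∉ N}) :
    MvPolynomial (Fin n) R :=
  monomial a.1.1 1 - ∑ b, c a b • monomial b.1.1 1

lemma isHomogeneous_relForm (c : {a // a ∉ N} → {b // b ∈ N} → R) (a : {a // a ∉ N}) :
    (relForm c a).IsHomogeneous d := by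
  refine (isHomogeneous_monomial 1 a.1.2).sub (IsHomogeneous.sum _ _ _ fun b _ => ?_)
  rw [smul_monomial]
  exact isHomogeneous_monomial _ b.1.2

/-- The matrix of the linear conditions that say that a functional on forms of degree `e` vanishes
on the products of the forms `relForm c a` with the monomials of degree `r`. -/
noncomputable def relMatrix (c : {a // a ∉ N} → {b // b ∈ N} → R) (r e : ℕ) :
    Matrix (Mon n r × {a // a ∉ N}) (Mon n e) R :=
  Matrix.of fun p u => coeff u.1 (monomial p.1.1 1 * relForm c p.2)

lemma relMatrix_mulVec (c : {a // a ∉ N} → {b // b ∈ N} → R) {r e : ℕ} (W : Mon n e → R)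
    (p : Mon n r × {a // a ∉ N}) :
    (relMatrix c r e).mulVec W p = evForm W (monomial p.1.1 1 * relForm c p.2) := by
  rw [evForm_apply, Matrix.mulVec, dotProduct]
  exact Finset.sum_congr rfl fun u _ => mul_comm _ _

lemma evForm_mul_relForm (c : {a // a ∉ N} → {b // b ∈ N} → R) {e : ℕ} (W : Mon n e → R)
    (m : Fin n →₀ ℕ) (a : {a // a ∉ N}) :
    evForm W (monomial m 1 * relForm c a) = evForm W (monomial (m + a.1.1) 1) -
      ∑ b, c a b * evForm W (monomial (m + b.1.1) 1) := by
  rw [relForm, mul_sub, map_sub, monomial_mul, one_mul, Finset.mul_sum, map_sum]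
  congr 1
  refine Finset.sum_congr rfl fun b _ => ?_
  rw [mul_smul_comm, monomial_mul, one_mul, map_smul, smul_eq_mul]

lemma map_relForm {R' : Type*} [CommRing R'] (ψ : R →+* R')
    (c : {a // a ∉ N} → {b // b ∈ N} → R) (a : {a // a ∉ N}) :
    map ψ (relForm c a) = relForm (fun a b => ψ (c a b)) a := by
  rw [relForm, relForm, map_sub, map_sum, map_monomial, map_one]
  congr 1
  exact Finset.sum_congr rfl fun b _ => by simp [smul_monomial]

lemma relMatrix_map {R' : Type*} [CommRing R'] (ψ : R →+* R')
    (c : {a // a ∉ N} → {b // b ∈ N} → R) (r e : ℕ) :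
    (relMatrix c r e).map ψ = relMatrix (fun a b => ψ (c a b)) r e := by
  ext p u
  simp only [relMatrix, Matrix.map_apply, Matrix.of_apply]
  rw [← map_relForm, ← coeff_map, map_mul, map_monomial, map_one]

/-- Multiples by monomials of degree other than `r` are killed for degree reasons, so the finitely
many conditions in `relMatrix` control the whole ideal. -/
lemma evForm_eq_zero_of_relMatrix {c : {a // a ∉ N} → {b // b ∈ N} → R} {r e : ℕ} (hre : r + d = e)
    {W : Mon n e → R} (hW : (relMatrix c r e).mulVec W = 0) {h : MvPolynomial (Fin n) R}
    (hh : h ∈ Ideal.span (Set.range (relForm c))) : evForm W h = 0 := by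
  suffices ∀ g, evForm W (g * h) = 0 by simpa using this 1
  induction hh using Submodule.span_induction with
  | mem x hx =>
    obtain ⟨a, rfl⟩ := hx
    intro g
    have : evForm W ∘ₗ LinearMap.mulRight R (relForm c a) = 0 := by
      refine ext_monomial fun m => ?_
      rw [LinearMap.comp_apply, LinearMap.mulRight_apply, LinearMap.zero_apply]
      by_cases hm : m.degree = r
      · rw [← relMatrix_mulVec c W (⟨m, hm⟩, a), hW, Pi.zero_apply]
      · exact evForm_of_isHomogeneous _
          ((isHomogeneous_monomial 1 rfl).mul (isHomogeneous_relForm c a)) (by omega)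
    exact LinearMap.congr_fun this g
  | zero => simp
  | add x y _ _ hx hy => intro g; rw [mul_add, map_add, hx, hy, add_zero]
  | smul a x _ hx => intro g; rw [smul_eq_mul, ← mul_assoc]; exact hx _

lemma mem_killSpace_iff {k : Type*} [Field k] {c : {a // a ∉ N} → {b // b ∈ N} → k} {r e : ℕ}
    (hre : r + d = e) {W : Mon n e → k} :
    W ∈ killSpace (Ideal.span (Set.range (relForm c))) e ↔ (relMatrix c r e).mulVec W = 0 := by
  constructor
  · intro h
    funext p
    rw [relMatrix_mulVec]
    exact h _ (Ideal.mul_mem_left _ _ (Ideal.subset_span ⟨_, rfl⟩))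
  · intro h x hx
    exact evForm_eq_zero_of_relMatrix hre h hx

lemma isHomogeneous_span_relForm {k : Type*} [Field k] (c : {a // a ∉ N} → {b // b ∈ N} → k) :
    (Ideal.span (Set.range (relForm c))).IsHomogeneous (homogeneousSubmodule (Fin n) k) := by
  refine Ideal.homogeneous_span _ _ ?_
  rintro _ ⟨a, rfl⟩
  exact ⟨d, isHomogeneous_relForm c a⟩

end RelationForms

/-! ### Annihilators of forms and Macaulay duality -/

section ResultantForms

open MvPolynomial

variable {n d : ℕ} {k : Type*} [Field k]

lemma card_mon (hn : 0 < n) : Fintype.card (Mon n d) = dimForms n d := by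
  have h1 : Fintype.card (Mon n d) = (Finset.univ.finsuppAntidiag d : Finset (Fin n →₀ ℕ)).card := by
    rw [← Fintype.card_coe]
    refine Fintype.card_congr (Equiv.subtypeEquivRight fun a => ?_)
    simp [Finset.mem_finsuppAntidiag, Finsupp.degree_eq_sum]
  rw [h1, Finset.card_finsuppAntidiag_nat_eq_choose, Finset.card_univ, Fintype.card_fin, dimForms,
    add_comm d n]
  have : n + d - 1 = d + (n - 1) := by omega
  rw [this, Nat.choose_symm_add]

lemma finrank_homogeneousSubmodule (i : ℕ) :
    Module.finrank k (homogeneousSubmodule (Fin n) k i) = Fintype.card (Mon n i) := by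
  have hinj : Function.Injective (formOfₗ (n := n) (k := k) i) := by
    intro c c' h
    rw [formOfₗ_apply, formOfₗ_apply] at h
    funext m
    rw [← coeff_formOf c m, h, coeff_formOf]
  rw [← range_formOfₗ, LinearMap.finrank_range_of_inj hinj, Module.finrank_fintype_fun_eq_card]

lemma hilbertFn_add_finrank_annihilatorDeg (F : MvPolynomial (Fin n) k) (i : ℕ) :
    hilbertFn F i + Module.finrank k (annihilatorDeg F i) = Fintype.card (Mon n i) := by
  rw [← finrank_homogeneousSubmodule (k := k), hilbertFn]
  have h := LinearMap.finrank_range_add_finrank_ker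
    ((Ideal.Quotient.mkₐ k (annihilator F)).toLinearMap.domRestrict (homogeneousSubmodule (Fin n) k i))
  rw [LinearMap.range_domRestrict, LinearMap.ker_domRestrict] at h
  rw [← h]
  congr 1
  have hle : annihilatorDeg F i ≤ homogeneousSubmodule (Fin n) k i := inf_le_right
  rw [← (Submodule.comapSubtypeEquivOfLe hle).finrank_eq]
  have hk : (annihilatorDeg F i).comap (homogeneousSubmodule (Fin n) k i).subtype =
      (LinearMap.ker (Ideal.Quotient.mkₐ k (annihilator F)).toLinearMap).comap
        (homogeneousSubmodule (Fin n) k i).subtype := by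
    ext ⟨x, hx⟩
    simp only [Submodule.mem_comap, Submodule.subtype_apply, LinearMap.mem_ker]
    constructor
    · intro h1
      exact Ideal.Quotient.eq_zero_iff_mem.2 h1.1
    · intro h1
      exact ⟨Ideal.Quotient.eq_zero_iff_mem.1 h1, hx⟩
  rw [hk]

/-- The point of the space of forms of degree `s` given by a form. -/
noncomputable def formEval (s : ℕ) (F : MvPolynomial (Fin n) k) : CoeffRing k n s →ₐ[k] k :=
  aeval fun m : Mon n s => coeff m.1 F

lemma formOf_formEval {s : ℕ} {F : MvPolynomial (Fin n) k} (hF : F.IsHomogeneous s) :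
    (formOf fun m : Mon n s => formEval s F (X m)) = F := by
  have : (fun m : Mon n s => formEval s F (X m)) = fun m => coeff m.1 F := by
    funext m; exact aeval_X _ _
  rw [this, formOf_coeff hF]

lemma mem_radical_of_resultantNeZero [IsAlgClosed k] {f : Fin n → MvPolynomial (Fin n) k}
    (hf : ResultantNeZero f) {I : Ideal (MvPolynomial (Fin n) k)} (hI : ∀ i, f i ∈ I) (j : Fin n) :
    X j ∈ I.radical := by
  rw [← vanishingIdeal_zeroLocus_eq_radical (K := k), mem_vanishingIdeal_iff]
  intro x hx
  have : x = 0 := hf x fun i => by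
    have := (mem_zeroLocus_iff.1 hx) (f i) (hI i)
    simpa using this
  simp [this]

/-- The forms of degree `d` annihilating `F` are spanned by forms `x^a - ∑ c_{ab} x^b` where `b`
runs over the labels of a basis of the column space of the catalecticant matrix. -/
lemma exists_relForm_mem_annihilator [CharZero k] {s : ℕ} (hds : d ≤ s)
    {F : MvPolynomial (Fin n) k} (hF : F.IsHomogeneous s) :
    ∃ (N : Finset (Mon n d)) (c : {a // a ∉ N} → {b // b ∈ N} → k),
      N.card = hilbertFn F d ∧
      LinearIndependent k (fun b : {b // b ∈ N} =>
        ((catMatrix k n s d).map (formEval s F)).col b.1) ∧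
      (∀ a, relForm c a ∈ annihilator F) ∧
      ∀ h ∈ annihilatorDeg F d, h ∈ Ideal.span (Set.range (relForm c)) := by
  classical
  set M := (catMatrix k n s d).map (formEval s F) with hM
  have hMapply : ∀ b a, M b a = coeff b.1 (act F (monomial a.1 1)) := by
    intro b a
    have := map_catMatrix_apply (formEval s F) b a
    rwa [formOf_formEval hF] at this
  obtain ⟨τ, α, hα, hsp, hli⟩ := exists_linearIndependent' k M.col
  have hτ : Finite τ := Finite.of_injective α hα
  cases nonempty_fintype τ
  let N : Finset (Mon n d) := Finset.univ.map ⟨α, hα⟩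
  have hrange : Set.range (fun b : {b // b ∈ N} => M.col b.1) = Set.range (M.col ∘ α) := by
    ext v
    constructor
    · rintro ⟨⟨b, hb⟩, rfl⟩
      obtain ⟨t, -, rfl⟩ := Finset.mem_map.1 hb
      exact ⟨t, rfl⟩
    · rintro ⟨t, rfl⟩
      exact ⟨⟨α t, Finset.mem_map_of_mem _ (Finset.mem_univ t)⟩, rfl⟩
  have hcard : N.card = M.rank := by
    rw [Finset.card_map, Finset.card_univ, linearIndependent_iff_card_eq_finrank_span.1 hli,
      Set.finrank, hsp, Matrix.rank_eq_finrank_span_cols]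
  have hliN : LinearIndependent k (fun b : {b // b ∈ N} => M.col b.1) := by
    rw [linearIndependent_iff_card_eq_finrank_span, Set.finrank, hrange, hsp,
      ← Matrix.rank_eq_finrank_span_cols, Fintype.card_coe, hcard]
  have hcomb : ∀ a : {a // a ∉ N}, ∃ c : {b // b ∈ N} → k,
      ∑ b, c b • M.col b.1 = M.col a.1 := by
    intro a
    have : M.col a.1 ∈ Submodule.span k (Set.range (fun b : {b // b ∈ N} => M.col b.1)) := by
      rw [hrange, hsp]
      exact Submodule.subset_span ⟨_, rfl⟩
    exact (Submodule.mem_span_range_iff_exists_fun k).1 this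
  choose c hc using hcomb
  have hrel : ∀ a, relForm c a ∈ annihilator F := by
    intro a
    change act F (relForm c a) = 0
    refine act_eq_zero_of_coeff hds hF (isHomogeneous_relForm c a) fun b => ?_
    rw [relForm, map_sub, map_sum, coeff_sub, coeff_sum, ← hMapply]
    have := congrFun (hc a) b
    rw [Finset.sum_apply] at this
    simp only [Pi.smul_apply, Matrix.col_apply, smul_eq_mul] at this
    rw [← this, sub_eq_zero]
    exact Finset.sum_congr rfl fun b' _ => by rw [map_smul, coeff_smul, hMapply, smul_eq_mul]
  refine ⟨N, c, ?_, hliN, hrel, ?_⟩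
  · rw [hcard, hM, rank_catMatrix_map hds, formOf_formEval hF]
  · rintro h ⟨hh, hhd⟩
    have hsum : h = ∑ a : Mon n d, coeff a.1 h • monomial a.1 1 := by
      conv_lhs => rw [← formOf_coeff hhd]
      rw [formOf]
      exact Finset.sum_congr rfl fun a _ => by simp [smul_monomial]
    -- Subtracting the relations with leading coefficients taken from `h` leaves a form supported on
    -- `N` that still annihilates `F`; independence of the columns in `N` makes it zero.
    let g := h - ∑ a : {a // a ∉ N}, coeff a.1.1 h • relForm c a
    have hgF : act F g = 0 := by
      have h1 : act F h = 0 := hh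
      have h2 : ∀ a, act F (relForm c a) = 0 := hrel
      simp [g, h1, h2]
    have hghom : g.IsHomogeneous d := by
      refine hhd.sub (IsHomogeneous.sum _ _ _ fun a _ => ?_)
      rw [smul_eq_C_mul]
      exact (isHomogeneous_relForm c a).C_mul _
    have hgA : ∀ a : {a // a ∉ N}, coeff a.1.1 g = 0 := by
      intro a
      have h1 : ∀ a' : {a // a ∉ N}, coeff a.1.1 (relForm c a') = if a' = a then 1 else 0 := by
        intro a'
        rw [relForm, coeff_sub, coeff_sum, coeff_monomial, Finset.sum_eq_zero, sub_zero]
        · simp only [Subtype.ext_iff]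
        · intro b _
          rw [coeff_smul, coeff_monomial, if_neg, smul_zero]
          intro hba
          exact a.2 (by rw [← Subtype.ext hba]; exact b.2)
      rw [coeff_sub, coeff_sum]
      simp [h1]
    have hg0 : g = 0 := by
      have hgsum : g = ∑ b : {b // b ∈ N}, coeff b.1.1 g • monomial b.1.1 1 := by
        have h1 : g = ∑ a : Mon n d, coeff a.1 g • monomial a.1 1 := by
          conv_lhs => rw [← formOf_coeff hghom]
          rw [formOf]
          exact Finset.sum_congr rfl fun a _ => by simp [smul_monomial]
        conv_lhs => rw [h1]
        rw [← Finset.sum_subset (Finset.subset_univ N), ← Finset.sum_coe_sort N]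
        intro a _ ha
        rw [hgA ⟨a, ha⟩, zero_smul]
      have hz : ∑ b : {b // b ∈ N}, coeff b.1.1 g • M.col b.1 = 0 := by
        funext b'
        rw [Finset.sum_apply]
        have h2 : coeff b'.1 (act F g) = 0 := by rw [hgF, coeff_zero]
        rw [hgsum, map_sum, coeff_sum] at h2
        simp only [map_smul, coeff_smul, ← hMapply] at h2
        exact h2
      have h3 := Fintype.linearIndependent_iff.1 hliN _ hz
      rw [hgsum]
      exact Finset.sum_eq_zero fun b _ => by rw [h3 b, zero_smul]
    have : h = ∑ a : {a // a ∉ N}, coeff a.1.1 h • relForm c a := sub_eq_zero.1 hg0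
    rw [this]
    exact Ideal.sum_mem _ fun a _ =>
      Submodule.smul_of_tower_mem _ _ (Ideal.subset_span ⟨a, rfl⟩)

variable {N : Finset (Mon n d)}

lemma span_relForm_le_annihilator {F : MvPolynomial (Fin n) k}
    {c : {a // a ∉ N} → {b // b ∈ N} → k} (h : ∀ a, relForm c a ∈ annihilator F) :
    Ideal.span (Set.range (relForm c)) ≤ annihilator F := by
  rw [Ideal.span_le]
  rintro _ ⟨a, rfl⟩
  exact h a

lemma mem_killSpace_of_le_annihilator [CharZero k] {s : ℕ} {F : MvPolynomial (Fin n) k}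
    (hF : F.IsHomogeneous s) {I : Ideal (MvPolynomial (Fin n) k)} (hI : I ≤ annihilator F) :
    (fun u : Mon n s => (mfact u.1 : k) * coeff u.1 F) ∈ killSpace I s := by
  intro h hh
  rw [← pairing_eq_evForm hF]
  simpa using mem_annihilator_iff.1 (hI hh) 1

lemma le_annihilator_of_mem_killSpace [CharZero k] {s : ℕ} {F : MvPolynomial (Fin n) k}
    (hF : F.IsHomogeneous s) {I : Ideal (MvPolynomial (Fin n) k)}
    (h : (fun u : Mon n s => (mfact u.1 : k) * coeff u.1 F) ∈ killSpace I s) :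
    I ≤ annihilator F := by
  intro x hx
  rw [mem_annihilator_iff]
  intro g
  rw [pairing_eq_evForm hF]
  exact h _ (I.mul_mem_left g hx)

lemma hilbertFn_le_seqT [Infinite k] (hd : 0 < d) {F : MvPolynomial (Fin n) k}
    {c : {a // a ∉ N} → {b // b ∈ N} → k} (hcard : Fintype.card {a // a ∉ N} = n)
    (hrad : ∀ j, X j ∈ (Ideal.span (Set.range (relForm c))).radical)
    (h : Ideal.span (Set.range (relForm c)) ≤ annihilator F) (i : ℕ) :
    hilbertFn F i ≤ seqT n d i := by
  rw [← hilb_eq_seqT hd hcard (isHomogeneous_relForm c) hrad]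
  exact hilb_mono h i

/-- Macaulay: the annihilator of a nonzero dual socle generator of a complete intersection is the
complete intersection ideal. -/
lemma hilbertFn_eq_seqT [CharZero k] (hd : 0 < d) {F : MvPolynomial (Fin n) k}
    (hF : F.IsHomogeneous (n * (d - 1))) (hF0 : F ≠ 0)
    {c : {a // a ∉ N} → {b // b ∈ N} → k} (hcard : Fintype.card {a // a ∉ N} = n)
    (hrad : ∀ j, X j ∈ (Ideal.span (Set.range (relForm c))).radical)
    (h : Ideal.span (Set.range (relForm c)) ≤ annihilator F) (i : ℕ) :
    hilbertFn F i = seqT n d i := by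
  refine le_antisymm (hilbertFn_le_seqT hd hcard hrad h i) ?_
  set I := Ideal.span (Set.range (relForm c)) with hI
  have hhilb := hilb_eq_seqT hd hcard (isHomogeneous_relForm c) hrad
  rcases lt_or_ge (n * (d - 1)) i with hi | hi
  · rw [seqT_eq_zero hd hi]; exact Nat.zero_le _
  have hW0 : (fun u : Mon n (n * (d - 1)) => (mfact u.1 : k) * coeff u.1 F) ≠ 0 := by
    intro h0
    apply hF0
    ext u
    rw [coeff_zero]
    by_cases hu : u.degree = n * (d - 1)
    · have := congrFun h0 ⟨u, hu⟩
      simpa [mfact_ne_zero] using this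
    · exact hF.coeff_eq_zero hu
  -- Descending induction on the degree from the socle degree. There the quotient is a line detected
  -- by `F ≠ 0`; below it, the multiples X_j u lie in `I` by induction, and the socle has nothing in
  -- these degrees.
  have key : ∀ e i, i + e = n * (d - 1) → ∀ u : MvPolynomial (Fin n) k, u.IsHomogeneous i →
      u ∈ annihilator F → u ∈ I := by
    intro e
    induction e with
    | zero =>
      intro i hi u hu huF
      subst hi
      refine mem_of_evForm_eq_zero (by rw [hhilb]; exact seqT_top hd)
        (mem_killSpace_of_le_annihilator hF h) hW0 hu ?_
      rw [← pairing_eq_evForm hF]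
      simpa using mem_annihilator_iff.1 huF 1
    | succ e ih =>
      intro i hi u hu huF
      refine socle_eq hd hcard (isHomogeneous_relForm c) hrad hu (by omega) fun j => ?_
      exact ih (1 + i) (by omega) _ ((isHomogeneous_X k j).mul hu) (Ideal.mul_mem_left _ _ huF)
  rw [← hhilb i, hilb, hilbertFn]
  refine (finrank_map_eq_of_ker fun u hu => ?_).le
  have h1 : (Ideal.Quotient.mkₐ k I).toLinearMap u = 0 ↔ u ∈ I := Ideal.Quotient.eq_zero_iff_mem
  have h2 : (Ideal.Quotient.mkₐ k (annihilator F)).toLinearMap u = 0 ↔ u ∈ annihilator F :=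
    Ideal.Quotient.eq_zero_iff_mem
  rw [h1, h2]
  exact ⟨fun hu' => h hu', key (n * (d - 1) - i) i (by omega) u hu⟩

lemma radical_of_killSpace_eq_bot {I : Ideal (MvPolynomial (Fin n) k)}
    (hI : I.IsHomogeneous (homogeneousSubmodule (Fin n) k)) {e : ℕ}
    (h : killSpace I e = ⊥) (j : Fin n) : X j ∈ I.radical := by
  have h0 : hilb I e = 0 := by
    rw [← finrank_killSpace hI, h, finrank_bot]
  rw [hilb, Submodule.finrank_eq_zero] at h0
  refine ⟨e, ?_⟩
  have hm : Ideal.Quotient.mk I (X j ^ e) ∈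
      (homogeneousSubmodule (Fin n) k e).map (Ideal.Quotient.mkₐ k I).toLinearMap :=
    mem_hilb_space.2 ⟨_, isHomogeneous_X_pow j e, rfl⟩
  rw [h0] at hm
  exact Ideal.Quotient.eq_zero_iff_mem.1 hm

end ResultantForms

/-! ### The chart and its parametrization of forms -/

section Chart

open MvPolynomial

/-- The data of a chart of the space of forms of degree `s` annihilated by a complete intersection
of forms of degree `d`: the labels `N` of a monomial basis modulo the complete intersection, a base
point `c₀`, and left inverses over the base field of the matrices of linear conditions at the base
point. -/
structure Chart (k : Type*) [Field k] (n d s : ℕ) where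
  N : Finset (Mon n d)
  c₀ : {a // a ∉ N} → {b // b ∈ N} → k
  u₀ : Mon n s
  L : Matrix (Mon n s) (Mon n (s - d) × {a // a ∉ N}) k
  l : Mon n s → k
  L' : Matrix (Mon n (s + 1)) (Mon n (s - d + 1) × {a // a ∉ N}) k
  le : d ≤ s
  left_inverse : L * relMatrix c₀ (s - d) s + Matrix.vecMulVec l (Pi.single u₀ 1) = 1
  left_inverse' : L' * relMatrix c₀ (s - d + 1) (s + 1) = 1

namespace Chart

variable {k : Type*} [Field k] {n d s : ℕ} (D : Chart k n d s)

section General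

variable {R : Type*} [CommRing R] [Algebra k R]

/-- The square matrix of conditions that determines a form up to a factor. -/
noncomputable def psi (c : {a // a ∉ D.N} → {b // b ∈ D.N} → R) : Matrix (Mon n s) (Mon n s) R :=
  D.L.map (algebraMap k R) * relMatrix c (s - d) s +
    Matrix.vecMulVec (fun u => algebraMap k R (D.l u)) (Pi.single D.u₀ 1)

/-- The square matrix whose invertibility says that all forms of degree `s + 1` are in the ideal. -/
noncomputable def psi' (c : {a // a ∉ D.N} → {b // b ∈ D.N} → R) :
    Matrix (Mon n (s + 1)) (Mon n (s + 1)) R :=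
  D.L'.map (algebraMap k R) * relMatrix c (s - d + 1) (s + 1)

/-- The functional with parameters `c` and `t`. -/
noncomputable def sol (c : {a // a ∉ D.N} → {b // b ∈ D.N} → R) (t : R) : Mon n s → R :=
  t • (D.psi c).adjugate.mulVec fun u => algebraMap k R (D.l u)

variable {R' : Type*} [CommRing R'] [Algebra k R'] (φ : R →ₐ[k] R')

lemma psi_map (c : {a // a ∉ D.N} → {b // b ∈ D.N} → R) :
    (φ : R →+* R').mapMatrix (D.psi c) = D.psi fun a b => φ (c a b) := by
  rw [psi, map_add, RingHom.mapMatrix_apply, RingHom.mapMatrix_apply, Matrix.map_mul, psi]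
  congr 1
  · congr 1
    · ext i j; simp
    · exact relMatrix_map (φ : R →+* R') c _ _
  · ext i j
    simp [Matrix.vecMulVec_apply, Pi.single_apply, apply_ite φ]

lemma psi'_map (c : {a // a ∉ D.N} → {b // b ∈ D.N} → R) :
    (φ : R →+* R').mapMatrix (D.psi' c) = D.psi' fun a b => φ (c a b) := by
  rw [psi', RingHom.mapMatrix_apply, Matrix.map_mul, psi']
  congr 1
  · ext i j; simp
  · exact relMatrix_map (φ : R →+* R') c _ _

lemma det_psi_map (c : {a // a ∉ D.N} → {b // b ∈ D.N} → R) :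
    φ (D.psi c).det = (D.psi fun a b => φ (c a b)).det := by
  rw [← psi_map, ← RingHom.map_det]; rfl

lemma det_psi'_map (c : {a // a ∉ D.N} → {b // b ∈ D.N} → R) :
    φ (D.psi' c).det = (D.psi' fun a b => φ (c a b)).det := by
  rw [← psi'_map, ← RingHom.map_det]; rfl

lemma sol_map (c : {a // a ∉ D.N} → {b // b ∈ D.N} → R) (t : R) (u : Mon n s) :
    φ (D.sol c t u) = D.sol (fun a b => φ (c a b)) (φ t) u := by
  have h1 : ∀ i j, φ ((D.psi c).adjugate i j) =
      (D.psi fun a b => φ (c a b)).adjugate i j := by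
    intro i j
    rw [← psi_map, ← RingHom.map_adjugate]
    rfl
  simp [sol, Matrix.mulVec, dotProduct, h1]

variable {c : {a // a ∉ D.N} → {b // b ∈ D.N} → R}

lemma psi_mulVec {W : Mon n s → R} (hW : (relMatrix c (s - d) s).mulVec W = 0) :
    (D.psi c).mulVec W = W D.u₀ • fun u => algebraMap k R (D.l u) := by
  rw [psi, Matrix.add_mulVec, ← Matrix.mulVec_mulVec, hW, Matrix.mulVec_zero, zero_add,
    Matrix.vecMulVec_mulVec]
  funext u
  simp [mul_comm]

/-- Every solution of the linear conditions satisfies ψW = W(u₀)·l; multiplying by the adjugate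
recovers W without division, which is why `sol` is polynomial in the parameters. -/
lemma det_smul_eq_sol {W : Mon n s → R} (hW : (relMatrix c (s - d) s).mulVec W = 0) :
    (D.psi c).det • W = D.sol c (W D.u₀) := by
  have h := congrArg (D.psi c).adjugate.mulVec (D.psi_mulVec hW)
  rw [Matrix.mulVec_mulVec, Matrix.adjugate_mul, Matrix.mulVec_smul, Matrix.smul_mulVec,
    Matrix.one_mulVec] at h
  exact h

lemma psi_mulVec_sol (t : R) :
    (D.psi c).mulVec (D.sol c t) = (t * (D.psi c).det) • fun u => algebraMap k R (D.l u) := by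
  rw [sol, Matrix.mulVec_smul, Matrix.mulVec_mulVec, Matrix.mul_adjugate, Matrix.smul_mulVec,
    Matrix.one_mulVec, smul_smul]

end General

/-- The left inverses were chosen at the base point. Consequently the determinants of `psi` and
`psi'` are polynomials that do not vanish identically. -/
lemma psi_base : D.psi D.c₀ = 1 := by
  rw [psi, ← D.left_inverse]
  congr 1

lemma psi'_base : D.psi' D.c₀ = 1 := by
  rw [psi', ← D.left_inverse']
  congr 1

section Point

variable {c : {a // a ∉ D.N} → {b // b ∈ D.N} → k}

/-- Invertibility of `psi'` leaves no functional in degree s + 1, so all forms of that degree, in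
particular the powers of the variables, lie in the ideal. -/
lemma radical_of_det_ne_zero (h' : (D.psi' c).det ≠ 0) (j : Fin n) :
    X j ∈ (Ideal.span (Set.range (relForm c))).radical := by
  refine radical_of_killSpace_eq_bot (isHomogeneous_span_relForm c) (e := s + 1) ?_ j
  rw [eq_bot_iff]
  intro W hW
  have hle := D.le
  rw [mem_killSpace_iff (r := s - d + 1) (by omega)] at hW
  have h1 : (D.psi' c).mulVec W = 0 := by
    rw [psi', ← Matrix.mulVec_mulVec, hW, Matrix.mulVec_zero]
  exact Matrix.eq_zero_of_mulVec_eq_zero h' h1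

end Point

/-- The functionals of socle degree killing the complete intersection form a line. A generator W has
W(u₀) ≠ 0, since otherwise `det_smul_eq_sol` would make it zero, and then `sol` is a multiple of W.
-/
lemma sol_mem_killSpace [Infinite k] (D : Chart k n d (n * (d - 1))) (hd : 0 < d)
    (hcard : Fintype.card {a // a ∉ D.N} = n)
    {c : {a // a ∉ D.N} → {b // b ∈ D.N} → k} (h : (D.psi c).det ≠ 0)
    (h' : (D.psi' c).det ≠ 0) (t : k) :
    D.sol c t ∈ killSpace (Ideal.span (Set.range (relForm c))) (n * (d - 1)) := by
  have hrad := D.radical_of_det_ne_zero h'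
  have h1 := finrank_killSpace (isHomogeneous_span_relForm c) (n * (d - 1))
  rw [hilb_eq_seqT hd hcard (isHomogeneous_relForm c) hrad, seqT_top hd] at h1
  obtain ⟨⟨W, hW⟩, hW0, -⟩ := finrank_eq_one_iff'.1 h1
  have hWne : W ≠ 0 := fun h0 => hW0 (Subtype.ext h0)
  have hle := D.le
  have hker := (mem_killSpace_iff (r := n * (d - 1) - d) (by omega)).1 hW
  have hsol := D.det_smul_eq_sol hker
  have hu : W D.u₀ ≠ 0 := by
    intro h0
    rw [h0, sol, zero_smul] at hsol
    exact (smul_ne_zero h hWne) hsol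
  have : D.sol c t = (t / W D.u₀ * (D.psi c).det) • W := by
    rw [mul_smul, hsol, sol, sol, smul_smul, div_mul_cancel₀ _ hu]
  rw [this]
  exact Submodule.smul_mem _ _ hW

/-- The coordinate ring of the affine space of parameters. -/
abbrev Ring : Type _ := MvPolynomial (Option ({a // a ∉ D.N} × {b // b ∈ D.N})) k

/-- The coordinates on the space of parameters. -/
noncomputable def coord (a : {a // a ∉ D.N}) (b : {b // b ∈ D.N}) : D.Ring := X (some (a, b))

/-- The functional with generic parameters. -/
noncomputable def genSol : Mon n s → D.Ring := D.sol D.coord (X none)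

/-- The parametrization of forms. -/
noncomputable def param : CoeffRing k n s →ₐ[k] D.Ring :=
  aeval fun m => algebraMap k D.Ring (mfact m.1 : k)⁻¹ * D.genSol m

lemma mfact_mul_param [CharZero k] (m : Mon n s) :
    (mfact m.1 : D.Ring) * D.param (X m) = D.genSol m := by
  rw [param, aeval_X, ← mul_assoc, ← map_natCast (algebraMap k D.Ring), ← map_mul,
    mul_inv_cancel₀ (Nat.cast_ne_zero.2 (mfact_ne_zero _)), map_one, one_mul]

/-- The product of `q` with the two determinants vanishes at all points, hence is zero. The
determinants equal 1 at the base point, and the ring is a domain. -/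
lemma eq_zero_of_forall_aeval [Infinite k] {q : D.Ring}
    (h : ∀ p : Option ({a // a ∉ D.N} × {b // b ∈ D.N}) → k,
      (D.psi fun a b => p (some (a, b))).det ≠ 0 →
      (D.psi' fun a b => p (some (a, b))).det ≠ 0 → aeval p q = 0) : q = 0 := by
  have hdet : ∀ p : Option ({a // a ∉ D.N} × {b // b ∈ D.N}) → k,
      aeval p (D.psi D.coord).det = (D.psi fun a b => p (some (a, b))).det := by
    intro p
    rw [det_psi_map]
    simp [coord]
  have hdet' : ∀ p : Option ({a // a ∉ D.N} × {b // b ∈ D.N}) → k,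
      aeval p (D.psi' D.coord).det = (D.psi' fun a b => p (some (a, b))).det := by
    intro p
    rw [det_psi'_map]
    simp [coord]
  have hz : q * ((D.psi D.coord).det * (D.psi' D.coord).det) = 0 := by
    refine MvPolynomial.funext fun p => ?_
    rw [map_zero, ← coe_aeval_eq_eval, RingHom.coe_coe, map_mul, map_mul, hdet, hdet']
    by_cases h1 : (D.psi fun a b => p (some (a, b))).det = 0
    · rw [h1, zero_mul, mul_zero]
    by_cases h2 : (D.psi' fun a b => p (some (a, b))).det = 0
    · rw [h2, mul_zero, mul_zero]
    rw [h p h1 h2, zero_mul]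
  let p₀ : Option ({a // a ∉ D.N} × {b // b ∈ D.N}) → k :=
    fun o => o.elim 0 fun x => D.c₀ x.1 x.2
  rcases mul_eq_zero.1 hz with h0 | h0
  · exact h0
  · exfalso
    have := congrArg (aeval p₀) h0
    rw [map_mul, hdet, hdet', map_zero] at this
    have e1 : (fun a b => p₀ (some (a, b))) = D.c₀ := rfl
    rw [e1, psi_base, psi'_base, Matrix.det_one, Matrix.det_one] at this
    simp at this

lemma aeval_genSol (p : Option ({a // a ∉ D.N} × {b // b ∈ D.N}) → k) (u : Mon n s) :
    aeval p (D.genSol u) = D.sol (fun a b => p (some (a, b))) (p none) u := by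
  rw [genSol, sol_map]
  simp [coord]

/-- For generic parameters the conditions are overdetermined, and `sol` is built only to solve them
through `psi`. They hold at the points given by complete intersections, hence identically. -/
lemma relMatrix_mulVec_genSol [Infinite k] (D : Chart k n d (n * (d - 1))) (hd : 0 < d)
    (hcard : Fintype.card {a // a ∉ D.N} = n) :
    (relMatrix D.coord (n * (d - 1) - d) (n * (d - 1))).mulVec D.genSol = 0 := by
  funext i
  refine D.eq_zero_of_forall_aeval fun p h h' => ?_
  have hle := D.le
  have h1 := (mem_killSpace_iff (r := n * (d - 1) - d) (by omega)).1
    (D.sol_mem_killSpace hd hcard h h' (p none))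
  have h2 := congrFun h1 i
  refine Eq.trans ?_ h2
  rw [Matrix.mulVec, Matrix.mulVec, dotProduct, dotProduct, map_sum]
  refine Finset.sum_congr rfl fun u _ => ?_
  rw [map_mul, aeval_genSol]
  congr 1
  have h3 := congrFun (congrFun (relMatrix_map (aeval p : D.Ring →ₐ[k] k).toRingHom D.coord
    (n * (d - 1) - d) (n * (d - 1))) i) u
  rw [Matrix.map_apply] at h3
  simpa [coord] using h3

/-- An ideal that vanishes at all points given by complete intersections vanishes under the
parametrization. -/
lemma le_ker_param [CharZero k] (D : Chart k n d (n * (d - 1))) (hd : 0 < d)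
    (hcard : Fintype.card {a // a ∉ D.N} = n) {J : Ideal (CoeffRing k n (n * (d - 1)))}
    (hJ : ∀ ρ : CoeffRing k n (n * (d - 1)) →ₐ[k] k,
      (∀ i, hilbertFn (formOf fun m => ρ (X m)) i ≤ seqT n d i) → J ≤ RingHom.ker ρ) :
    J ≤ RingHom.ker D.param := by
  intro x hx
  rw [RingHom.mem_ker]
  refine D.eq_zero_of_forall_aeval fun p h h' => ?_
  refine hJ ((aeval p).comp D.param) (fun i => ?_) hx
  refine hilbertFn_le_seqT hd hcard (D.radical_of_det_ne_zero h') ?_ i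
  refine le_annihilator_of_mem_killSpace (isHomogeneous_formOf _) ?_
  convert D.sol_mem_killSpace hd hcard h h' (p none) using 1
  funext u
  rw [coeff_formOf, ← aeval_genSol, ← mfact_mul_param, map_mul, map_natCast]
  rfl

end Chart

end Chart

/-! ### Cramer's rule from vanishing minors -/

section Cramer

variable {A ι κ β : Type*} [CommRing A] [Fintype β] [DecidableEq β]

/-- If all minors of size one more than that of an invertible square submatrix vanish, then every
column is the combination of the columns of the submatrix given by Cramer's rule. -/
lemma eq_sum_of_minors_eq_zero (M : Matrix ι κ A)
    (hM : ∀ (p : Fin (Fintype.card β + 1) ↪ ι) (q : Fin (Fintype.card β + 1) ↪ κ),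
      (M.submatrix p q).det = 0) (f : β → ι) (g : β → κ)
    (hdet : IsUnit (M.submatrix f g).det) (i : ι) (j : κ) :
    M i j = ∑ b, M i (g b) * ((M.submatrix f g)⁻¹.mulVec fun b => M (f b) j) b := by
  let f' : β ⊕ Unit → ι := Sum.elim f fun _ => i
  let g' : β ⊕ Unit → κ := Sum.elim g fun _ => j
  -- The submatrix bordered by one row and one column is a minor in the hypothesis, or has a
  -- repeated row or column.
  have hzero : (M.submatrix f' g').det = 0 := by
    by_cases hf : Function.Injective f'
    · by_cases hg : Function.Injective g'
      · let e : Fin (Fintype.card β + 1) ≃ β ⊕ Unit :=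
          (Fintype.equivFinOfCardEq (by simp)).symm
        have := hM ⟨f' ∘ e, hf.comp e.injective⟩ ⟨g' ∘ e, hg.comp e.injective⟩
        rw [← Matrix.det_submatrix_equiv_self e]
        exact this
      · obtain ⟨a, b, hab, hne⟩ := Function.not_injective_iff.1 hg
        exact Matrix.det_zero_of_column_eq hne fun r => by simp [hab]
    · obtain ⟨a, b, hab, hne⟩ := Function.not_injective_iff.1 hf
      exact Matrix.det_zero_of_row_eq hne (by funext r; simp [hab])
  have hblock : M.submatrix f' g' = Matrix.fromBlocks (M.submatrix f g)
      (Matrix.of fun b _ => M (f b) j) (Matrix.of fun _ b => M i (g b))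
      (Matrix.of fun _ _ => M i j) := by
    ext (a | a) (b | b) <;> rfl
  -- The bordered determinant is that of the invertible block times its Schur complement, here a
  -- scalar that must therefore vanish.
  have hinv := Matrix.invertibleOfIsUnitDet _ hdet
  rw [hblock, Matrix.det_fromBlocks₁₁, hdet.mul_right_eq_zero, Matrix.det_unique,
    Matrix.invOf_eq_nonsing_inv, Matrix.mul_assoc, Matrix.sub_apply, sub_eq_zero] at hzero
  exact hzero

end Cramer

section MapMinors

variable {A A' ι κ : Type*} [CommRing A] [CommRing A']

lemma det_submatrix_map_eq_zero (M : Matrix ι κ A) (φ : A →+* A') {r : ℕ}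
    (h : minorsIdeal M r ≤ RingHom.ker φ) (p : Fin r ↪ ι) (q : Fin r ↪ κ) :
    ((M.map φ).submatrix p q).det = 0 := by
  have : (M.submatrix p q).det ∈ minorsIdeal M r := Ideal.subset_span ⟨p, q, rfl⟩
  have h1 := h this
  rwa [RingHom.mem_ker, RingHom.map_det] at h1

end MapMinors

/-! ### Column relations as linear conditions on the form -/

section Relations

open MvPolynomial

variable {n d s : ℕ} {k : Type*} [Field k] [CharZero k] {A : Type*} [CommRing A] [Algebra k A]
  {N : Finset (Mon n d)}

lemma isUnit_mfact (k : Type*) [Field k] [CharZero k] {A : Type*} [CommRing A] [Algebra k A]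
    (m : Fin n →₀ ℕ) : IsUnit (mfact m : A) := by
  rw [← map_natCast (algebraMap k A)]
  exact ((Nat.cast_ne_zero.2 (mfact_ne_zero m)).isUnit : IsUnit (mfact m : k)).map _

/-- This is the bridge between catalecticant columns and complete intersections: the factor between
the two kinds of equation is a factorial, a unit in any algebra over `k`. -/
lemma relMatrix_mulVec_eq_zero_iff (φ : CoeffRing k n s →ₐ[k] A)
    (c : {a // a ∉ N} → {b // b ∈ N} → A) :
    (relMatrix c (s - d) s).mulVec (fun u => (mfact u.1 : A) * φ (X u)) = 0 ↔
      ∀ i a, φ (catMatrix k n s d i a.1) = ∑ b : {b // b ∈ N}, c a b * φ (catMatrix k n s d i b.1) := by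
  have key : ∀ i a, (relMatrix c (s - d) s).mulVec (fun u => (mfact u.1 : A) * φ (X u)) (i, a) =
      (mfact i.1 : A) * (φ (catMatrix k n s d i a.1) -
        ∑ b : {b // b ∈ N}, c a b * φ (catMatrix k n s d i b.1)) := by
    intro i a
    rw [relMatrix_mulVec, evForm_mul_relForm, mul_sub, Finset.mul_sum, mfact_mul_catMatrix]
    congr 1
    refine Finset.sum_congr rfl fun b _ => ?_
    rw [← mfact_mul_catMatrix]
    ring
  constructor
  · intro h i a
    have h1 := key i a
    rw [h, Pi.zero_apply] at h1
    exact sub_eq_zero.1 ((isUnit_mfact k i.1).mul_right_eq_zero.1 h1.symm)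
  · intro h
    funext ⟨i, a⟩
    rw [key, h, sub_self, mul_zero, Pi.zero_apply]

end Relations

/-! ### Recovering the parameters from a form -/

namespace Chart

open MvPolynomial

variable {k : Type*} [Field k] {n d s : ℕ} (D : Chart k n d s)

section

variable {A : Type*} [CommRing A] [Algebra k A] (φ : CoeffRing k n s →ₐ[k] A)
  (f : {b // b ∈ D.N} → Mon n (s - d))

/-- The square submatrix of the catalecticant matrix with the given rows and the columns labelled
by `N`. -/
noncomputable def pivot : Matrix {b // b ∈ D.N} {b // b ∈ D.N} A :=
  ((catMatrix k n s d).map φ).submatrix f fun b => b.1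

/-- The coefficients of the relations between columns of the catalecticant matrix. -/
noncomputable def relCoeff (a : {a // a ∉ D.N}) (b : {b // b ∈ D.N}) : A :=
  ((D.pivot φ f)⁻¹.mulVec fun b' => φ (catMatrix k n s d (f b') a.1)) b

variable {φ f}

/-- The rows of the invertible pivot block already determine the coefficients. This gives both
compatibility with base change and the recovery of the parameters of a parametrized form. -/
lemma relCoeff_unique (hdet : IsUnit (D.pivot φ f).det) {c : {a // a ∉ D.N} → {b // b ∈ D.N} → A}
    (hc : ∀ i a, φ (catMatrix k n s d i a.1) =
      ∑ b : {b // b ∈ D.N}, c a b * φ (catMatrix k n s d i b.1)) :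
    D.relCoeff φ f = c := by
  funext a
  have h1 : (D.pivot φ f).mulVec (c a) = fun b' => φ (catMatrix k n s d (f b') a.1) := by
    funext b'
    rw [hc]
    exact Finset.sum_congr rfl fun b _ => mul_comm _ _
  have h2 : D.relCoeff φ f a =
    (D.pivot φ f)⁻¹.mulVec fun b' => φ (catMatrix k n s d (f b') a.1) := rfl
  rw [h2, ← h1, Matrix.mulVec_mulVec, Matrix.nonsing_inv_mul _ hdet, Matrix.one_mulVec]

lemma relCoeff_spec (hdet : IsUnit (D.pivot φ f).det)
    (hminors : minorsIdeal (catMatrix k n s d) (D.N.card + 1) ≤ RingHom.ker φ)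
    (i : Mon n (s - d)) (a : {a // a ∉ D.N}) : φ (catMatrix k n s d i a.1) =
      ∑ b : {b // b ∈ D.N}, D.relCoeff φ f a b * φ (catMatrix k n s d i b.1) := by
  have hcard : Fintype.card {b // b ∈ D.N} = D.N.card := Fintype.card_coe _
  have h := eq_sum_of_minors_eq_zero ((catMatrix k n s d).map φ)
    (by rw [hcard]; exact det_submatrix_map_eq_zero _ (φ : CoeffRing k n s →+* A) hminors)
    f (fun b : {b // b ∈ D.N} => b.1) hdet i a.1
  rw [Matrix.map_apply] at h
  rw [h]
  exact Finset.sum_congr rfl fun b _ => mul_comm _ _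

lemma pivot_map {A' : Type*} [CommRing A'] [Algebra k A'] (χ : A →ₐ[k] A') :
    χ (D.pivot φ f).det = (D.pivot (χ.comp φ) f).det :=
  RingHom.map_det (χ : A →+* A') _

lemma relCoeff_map {A' : Type*} [CommRing A'] [Algebra k A'] (χ : A →ₐ[k] A')
    (hdet : IsUnit (D.pivot φ f).det)
    (hminors : minorsIdeal (catMatrix k n s d) (D.N.card + 1) ≤ RingHom.ker φ) :
    D.relCoeff (χ.comp φ) f = fun a b => χ (D.relCoeff φ f a b) := by
  refine D.relCoeff_unique ?_ fun i a => ?_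
  · rw [← pivot_map]; exact hdet.map χ
  · rw [AlgHom.comp_apply, D.relCoeff_spec hdet hminors i a, map_sum]
    exact Finset.sum_congr rfl fun b _ => by rw [map_mul, AlgHom.comp_apply]

end

section LocalInverse

variable {O : Type*} [CommRing O] [Algebra k O] (π : CoeffRing k n s →ₐ[k] O)
  (f : {b // b ∈ D.N} → Mon n (s - d))

/-- The scaling parameter of a form. -/
noncomputable def scale : O :=
  (mfact D.u₀.1 : O) * π (X D.u₀) * Ring.inverse (D.psi (D.relCoeff π f)).det

/-- The parameters of a form. -/
noncomputable def localInverse : D.Ring →ₐ[k] O :=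
  aeval fun o => o.elim (D.scale π f) fun x => D.relCoeff π f x.1 x.2

variable {π f}

lemma localInverse_coord (a : {a // a ∉ D.N}) (b : {b // b ∈ D.N}) :
    D.localInverse π f (D.coord a b) = D.relCoeff π f a b := by
  rw [localInverse, coord, aeval_X]
  rfl

lemma localInverse_X_none : D.localInverse π f (X none) = D.scale π f := by
  rw [localInverse, aeval_X]
  rfl

/-- On the locus where the catalecticant minors vanish, the parametrization is inverted by the
parameters. -/
lemma localInverse_comp_param [CharZero k] (hdet : IsUnit (D.pivot π f).det)
    (hminors : minorsIdeal (catMatrix k n s d) (D.N.card + 1) ≤ RingHom.ker π)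
    (hpsi : IsUnit (D.psi (D.relCoeff π f)).det) :
    (D.localInverse π f).comp D.param = π := by
  refine MvPolynomial.algHom_ext fun m => (isUnit_mfact k m.1).mul_left_cancel ?_
  -- The functional of the form solves its own relations, so det ψ times it is `sol` at its `u₀`
  -- coordinate. As `sol` is linear in that argument, dividing it by the unit det ψ, which is what
  -- `scale` does, returns the form.
  have hW := congrFun (D.det_smul_eq_sol
    ((relMatrix_mulVec_eq_zero_iff π _).2 (D.relCoeff_spec hdet hminors))) m
  have h1 : D.localInverse π f (D.genSol m) = D.sol (D.relCoeff π f) (D.scale π f) m := by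
    rw [genSol, sol_map, localInverse_X_none]
    simp only [localInverse_coord]
  rw [AlgHom.comp_apply, ← map_natCast (D.localInverse π f), ← map_mul, mfact_mul_param, h1,
    map_natCast]
  simp only [sol, Pi.smul_apply, smul_eq_mul] at hW ⊢
  rw [scale, mul_right_comm, ← hW, mul_right_comm, Ring.mul_inverse_cancel _ hpsi, one_mul]

/-- All ingredients are rational in the form with denominators det(pivot) and det ψ, which are units
here. `Ring.inverse` commutes with `χ` only because of this. -/
lemma localInverse_map [CharZero k] {O' : Type*} [CommRing O'] [Algebra k O'] (χ : O →ₐ[k] O')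
    (hdet : IsUnit (D.pivot π f).det)
    (hminors : minorsIdeal (catMatrix k n s d) (D.N.card + 1) ≤ RingHom.ker π)
    (hpsi : IsUnit (D.psi (D.relCoeff π f)).det) :
    χ.comp (D.localInverse π f) = D.localInverse (χ.comp π) f := by
  refine MvPolynomial.algHom_ext fun o => ?_
  rcases o with _ | ⟨a, b⟩
  · rw [AlgHom.comp_apply, localInverse_X_none, localInverse_X_none, scale, scale,
      D.relCoeff_map χ hdet hminors, ← det_psi_map, map_mul, map_mul, map_natCast,
      AlgHom.comp_apply]
    congr 1
    obtain ⟨w, hw⟩ := hpsi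
    have h2 : χ (D.psi (D.relCoeff π f)).det = Units.map (χ : O →* O') w := by rw [← hw]; rfl
    rw [h2, ← hw, Ring.inverse_unit, Ring.inverse_unit]
    rfl
  · have h1 := D.localInverse_coord (π := χ.comp π) (f := f) a b
    have h2 := D.localInverse_coord (π := π) (f := f) a b
    rw [coord] at h1 h2
    rw [AlgHom.comp_apply, h1, h2, D.relCoeff_map χ hdet hminors]

end LocalInverse

/-- The parameters of the parametrized form are the given ones. -/
lemma localInverse_comp_algebraMap_param [CharZero k] (D : Chart k n d (n * (d - 1))) (hd : 0 < d)
    (hcard : Fintype.card {a // a ∉ D.N} = n) {Q : Type*} [CommRing Q] [Algebra k Q]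
    (χ : D.Ring →ₐ[k] Q) {f : {b // b ∈ D.N} → Mon n (n * (d - 1) - d)}
    (hl : D.l D.u₀ = 1)
    (hdet : IsUnit (D.pivot (χ.comp D.param) f).det)
    (hpsi : IsUnit (D.psi (D.relCoeff (χ.comp D.param) f)).det) :
    D.localInverse (χ.comp D.param) f = χ := by
  have hgen := D.relMatrix_mulVec_genSol hd hcard
  have hW : (relMatrix D.coord (n * (d - 1) - d) (n * (d - 1))).mulVec
      (fun u => (mfact u.1 : D.Ring) * D.param (X u)) = 0 := by
    simpa only [mfact_mul_param] using hgen
  have hrel : D.relCoeff (χ.comp D.param) f = fun a b => χ (D.coord a b) := by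
    refine D.relCoeff_unique hdet fun i a => ?_
    rw [AlgHom.comp_apply, (relMatrix_mulVec_eq_zero_iff D.param _).1 hW i a, map_sum]
    exact Finset.sum_congr rfl fun b _ => by rw [map_mul, AlgHom.comp_apply]
  -- Two evaluations of ψ applied to `genSol` are compared at `u₀`; the normalization `D.l D.u₀ = 1`
  -- makes t itself, not a multiple of it, come back.
  have hu : D.genSol D.u₀ = X none * (D.psi D.coord).det := by
    have h1 := D.psi_mulVec hgen
    rw [genSol, psi_mulVec_sol, ← genSol] at h1
    have h2 := congrFun h1 D.u₀
    simpa [hl] using h2.symm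
  refine MvPolynomial.algHom_ext fun o => ?_
  rcases o with _ | ⟨a, b⟩
  · rw [localInverse_X_none, scale, hrel, AlgHom.comp_apply, ← map_natCast χ, ← map_mul,
      mfact_mul_param, hu, map_mul, ← det_psi_map, mul_assoc, Ring.mul_inverse_cancel, mul_one]
    rwa [hrel, ← det_psi_map] at hpsi
  · have h1 := D.localInverse_coord (π := χ.comp D.param) (f := f) a b
    rw [coord] at h1
    rw [h1, hrel]
    rfl

end Chart

/-! ### Regularity under localization -/

section Regular

variable {R : Type*} [CommRing R]

lemma isRegularRing_localization (M : Submonoid R) [IsRegularRing R] :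
    IsRegularRing (Localization M) := by
  have := IsLocalization.isNoetherianRing M (Localization M) inferInstance
  rw [isRegularRing_iff]
  intro p hp
  exact IsRegularLocalRing.of_ringEquiv
    (IsLocalization.algEquiv (p.comap (algebraMap R (Localization M))).primeCompl
      (Localization.AtPrime (p.comap (algebraMap R (Localization M))))
      (Localization.AtPrime p)).toRingEquiv

/-- If the local ring at a prime is a regular ring, then so is the local ring at any smaller
prime. -/
lemma isRegularLocalRing_of_le {p q : Ideal R} [p.IsPrime] [q.IsPrime] (h : q ≤ p)
    [IsRegularRing (Localization.AtPrime p)] (S : Type*) [CommRing S] [Algebra R S]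
    [IsLocalization.AtPrime S q] : IsRegularLocalRing S := by
  have hdisj : Disjoint (p.primeCompl : Set R) (q : Set R) :=
    Set.disjoint_left.2 fun x hx hq => hx (h hq)
  have hprime := IsLocalization.isPrime_of_isPrime_disjoint p.primeCompl (Localization.AtPrime p)
    q inferInstance hdisj
  have hcomap := IsLocalization.under_map_of_isPrime_disjoint p.primeCompl
    (Localization.AtPrime p) (I := q) inferInstance hdisj
  set q' := q.map (algebraMap R (Localization.AtPrime p))
  have h1 : IsLocalization.AtPrime (Localization.AtPrime q')
      (q'.comap (algebraMap R (Localization.AtPrime p))) := inferInstance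
  have h2 : IsLocalization q.primeCompl (Localization.AtPrime q') := by
    convert h1 using 1
    ext x
    simp only [Ideal.mem_primeCompl_iff, hcomap]
  exact IsRegularLocalRing.of_ringEquiv
    (IsLocalization.algEquiv q.primeCompl (Localization.AtPrime q') S).toRingEquiv

end Regular

/-! ### Heights of rational points of affine space -/

section Dimension

open MvPolynomial

variable {k : Type*} [Field k] {σ : Type*}

/-- The translation by a point as an automorphism of the polynomial ring. -/
noncomputable def translation (p : σ → k) : MvPolynomial σ k ≃ₐ[k] MvPolynomial σ k :=
  AlgEquiv.ofAlgHom (aeval fun i => X i + C (p i)) (aeval fun i => X i - C (p i))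
    (MvPolynomial.algHom_ext fun i => by simp [← algebraMap_eq])
    (MvPolynomial.algHom_ext fun i => by simp [← algebraMap_eq])

lemma aeval_translation (p q : σ → k) (x : MvPolynomial σ k) :
    aeval q (translation p x) = aeval (q + p) x := by
  have : (aeval q).comp (translation p : MvPolynomial σ k →ₐ[k] MvPolynomial σ k) =
      aeval (q + p) := MvPolynomial.algHom_ext fun i => by simp [translation]
  exact congrArg (fun f => f x) this

/-- Translations act transitively on rational points, so all these ideals have equal height. By the
Nullstellensatz they are all the maximal ideals, whose heights have supremum the Krull dimension. -/
lemma height_ker_aeval [IsAlgClosed k] [Finite σ] (p : σ → k) :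
    (RingHom.ker (aeval p : MvPolynomial σ k →ₐ[k] k)).height = Nat.card σ := by
  have key : ∀ q : σ → k, (RingHom.ker (aeval q : MvPolynomial σ k →ₐ[k] k)).height =
      (RingHom.ker (aeval p : MvPolynomial σ k →ₐ[k] k)).height := by
    intro q
    rw [← (translation (p - q)).toRingEquiv.height_comap
      (RingHom.ker (aeval q : MvPolynomial σ k →ₐ[k] k))]
    congr 1
    ext x
    rw [Ideal.mem_comap, RingHom.mem_ker, RingHom.mem_ker]
    have := aeval_translation (p - q) q x
    rw [add_sub_cancel] at this
    rw [← this]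
    rfl
  have h1 := Ideal.sup_isMaximal_height_eq_ringKrullDim (R := MvPolynomial σ k)
  rw [MvPolynomial.ringKrullDim_of_isNoetherianRing, ringKrullDim_eq_zero_of_field, zero_add] at h1
  have h2 : ⨆ (I : Ideal (MvPolynomial σ k)) (_ : I.IsMaximal), I.height =
      (RingHom.ker (aeval p : MvPolynomial σ k →ₐ[k] k)).height := by
    apply le_antisymm
    · refine iSup₂_le fun I hI => ?_
      obtain ⟨q, rfl⟩ := (isMaximal_iff_eq_vanishingIdeal_singleton (K := k)).1 hI
      rw [← key q]
      apply le_of_eq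
      congr 1
      ext x
      rw [mem_vanishingIdeal_singleton_iff, RingHom.mem_ker]
    · refine le_iSup₂_of_le (RingHom.ker (aeval p : MvPolynomial σ k →ₐ[k] k)) ?_ le_rfl
      exact RingHom.ker_isMaximal_of_surjective _ fun x => ⟨C x, by simp⟩
  rw [h2] at h1
  exact_mod_cast h1

end Dimension

/-! ### Isomorphism of local rings at rational points -/

section Localize

variable {k B P : Type*} [Field k] [CommRing B] [Algebra k B] [CommRing P] [Algebra k P]
  {p : Ideal B} [p.IsPrime] {q : Ideal P} [q.IsPrime]
  (O Q : Type*) [CommRing O] [Algebra k O] [Algebra B O] [IsScalarTower k B O]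
  [IsLocalization.AtPrime O p] [CommRing Q] [Algebra k Q] [Algebra P Q] [IsScalarTower k P Q]
  [IsLocalization.AtPrime Q q]

lemma isUnit_of_apply_ne_zero {O : Type*} [CommRing O] [Algebra k O] [IsLocalRing O]
    (r : O →ₐ[k] k) {x : O} (hx : r x ≠ 0) : IsUnit x := by
  have : IsLocalHom (r : O →+* k) :=
    Function.Surjective.isLocalHom (r : O →+* k) fun y => ⟨algebraMap k O y, by simp⟩
  exact isUnit_of_map_unit (r : O →+* k) x (isUnit_iff_ne_zero.2 hx)

/-- The extension of a homomorphism to the local ring at a prime. -/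
lemma exists_localLift (p : Ideal B) [p.IsPrime] [IsLocalization.AtPrime O p] {A : Type*}
    [CommRing A] [Algebra k A] (f : B →ₐ[k] A) (hf : ∀ b ∉ p, IsUnit (f b)) :
    ∃ g : O →ₐ[k] A, ∀ b, g (algebraMap B O b) = f b :=
  ⟨IsLocalization.liftAlgHom (M := p.primeCompl) (f := f) fun y => hf y.1 y.2,
    fun _ => IsLocalization.lift_eq _ _⟩

variable {O}

/-- A criterion for the local rings of two algebras at rational points to be isomorphic. -/
lemma nonempty_algEquiv_localization (p : Ideal B) [p.IsPrime] [IsLocalization.AtPrime O p]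
    (q : Ideal P) [q.IsPrime] [IsLocalization.AtPrime Q q]
    (εP : P →ₐ[k] k) (hq : ∀ x, x ∈ q ↔ εP x = 0) (φ : B →ₐ[k] P) (hp : ∀ b, b ∈ p ↔ φ b ∈ q)
    (r : O →ₐ[k] k) (α : P →ₐ[k] O)
    (hr : r.comp α = εP) (hα : ∀ b, α (φ b) = algebraMap B O b)
    (hφ : ∀ χ : O →ₐ[k] Q,
      (∀ b, χ (algebraMap B O b) = algebraMap P Q (φ b)) → ∀ x, χ (α x) = algebraMap P Q x) :
    Nonempty (O ≃ₐ[k] Q) := by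
  have : IsLocalRing O := IsLocalization.AtPrime.isLocalRing O p
  obtain ⟨toQ, h1⟩ := exists_localLift O p ((IsScalarTower.toAlgHom k P Q).comp φ) fun b hb =>
      IsLocalization.map_units Q (⟨φ b, fun h => hb ((hp b).2 h)⟩ : q.primeCompl)
  obtain ⟨toO, h2⟩ := exists_localLift Q q α fun x hx =>
    isUnit_of_apply_ne_zero r fun h => hx ((hq x).2 (by rw [← hr]; exact h))
  refine ⟨AlgEquiv.ofAlgHom toQ toO ?_ ?_⟩
  · apply AlgHom.coe_ringHom_injective
    refine IsLocalization.ringHom_ext q.primeCompl (RingHom.ext fun x => ?_)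
    change toQ (toO (algebraMap P Q x)) = algebraMap P Q x
    rw [h2, hφ toQ h1]
  · apply AlgHom.coe_ringHom_injective
    refine IsLocalization.ringHom_ext p.primeCompl (RingHom.ext fun b => ?_)
    change toO (toQ (algebraMap B O b)) = algebraMap B O b
    rw [h1, AlgHom.comp_apply, IsScalarTower.toAlgHom_apply, h2, hα]

end Localize

/-! ### The local ring at a form is that of the parameter space -/

namespace Chart

open MvPolynomial

variable {k : Type*} [Field k] [CharZero k] {n d : ℕ}

/-- The local ring at a form of a scheme of forms of given annihilator type is isomorphic to the
local ring of the space of parameters. -/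
lemma nonempty_algEquiv (D : Chart k n d (n * (d - 1))) (hd : 0 < d)
    (hcard : Fintype.card {a // a ∉ D.N} = n) (hl : D.l D.u₀ = 1)
    {f : {b // b ∈ D.N} → Mon n (n * (d - 1) - d)}
    {ε : CoeffRing k n (n * (d - 1)) →ₐ[k] k}
    (hdet : (D.pivot ε f).det ≠ 0) (hpsi : (D.psi (D.relCoeff ε f)).det ≠ 0)
    {J : Ideal (CoeffRing k n (n * (d - 1)))}
    (hminors : minorsIdeal (catMatrix k n (n * (d - 1)) d) (D.N.card + 1) ≤ J)
    (hJ : J ≤ RingHom.ker ε) (hparam : J ≤ RingHom.ker D.param)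
    (p : Ideal (CoeffRing k n (n * (d - 1)) ⧸ J)) [p.IsPrime]
    (hp : ∀ x, Ideal.Quotient.mk J x ∈ p ↔ ε x = 0)
    (q : Ideal D.Ring) [q.IsPrime] (hq : ∀ x, x ∈ q ↔ D.localInverse ε f x = 0)
    (O Q : Type*) [CommRing O] [Algebra k O] [Algebra (CoeffRing k n (n * (d - 1)) ⧸ J) O]
    [IsScalarTower k (CoeffRing k n (n * (d - 1)) ⧸ J) O] [IsLocalization.AtPrime O p]
    [CommRing Q] [Algebra k Q] [Algebra D.Ring Q] [IsScalarTower k D.Ring Q]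
    [IsLocalization.AtPrime Q q] :
    Nonempty (O ≃ₐ[k] Q) := by
  have : IsLocalRing O := IsLocalization.AtPrime.isLocalRing O p
  let εB : (CoeffRing k n (n * (d - 1)) ⧸ J) →ₐ[k] k := Ideal.Quotient.liftₐ J ε hJ
  let φ : (CoeffRing k n (n * (d - 1)) ⧸ J) →ₐ[k] D.Ring := Ideal.Quotient.liftₐ J D.param hparam
  have hεB : ∀ x, εB (Ideal.Quotient.mk J x) = ε x := fun x => rfl
  have hφ : ∀ x, φ (Ideal.Quotient.mk J x) = D.param x := fun x => rfl
  have hunit : ∀ b ∉ p, IsUnit (εB b) := fun b hb => by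
    obtain ⟨x, rfl⟩ := Ideal.Quotient.mk_surjective b
    rw [hp] at hb
    exact isUnit_iff_ne_zero.2 hb
  obtain ⟨r, hr⟩ := exists_localLift O p εB hunit
  let π : CoeffRing k n (n * (d - 1)) →ₐ[k] O :=
    (IsScalarTower.toAlgHom k (CoeffRing k n (n * (d - 1)) ⧸ J) (O)).comp
      (Ideal.Quotient.mkₐ k J)
  have hrπ : r.comp π = ε := AlgHom.ext fun x => hr _
  have hπ : minorsIdeal (catMatrix k n (n * (d - 1)) d) (D.N.card + 1) ≤ RingHom.ker π := by
    intro x hx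
    rw [RingHom.mem_ker]
    change algebraMap _ _ (Ideal.Quotient.mk J x) = _
    rw [Ideal.Quotient.eq_zero_iff_mem.2 (hminors hx), map_zero]
  -- Units of the local ring are detected at the rational point, where the determinants are nonzero
  -- by hypothesis.
  have hdetπ : IsUnit (D.pivot π f).det := by
    refine isUnit_of_apply_ne_zero r ?_
    rw [pivot_map, hrπ]
    exact hdet
  have hpsiπ : IsUnit (D.psi (D.relCoeff π f)).det := by
    refine isUnit_of_apply_ne_zero r ?_
    rw [det_psi_map, ← D.relCoeff_map r hdetπ hπ, hrπ]
    exact hpsi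
  have hinv : ∀ x, D.localInverse ε f (D.param x) = ε x := fun x =>
    congrArg (fun g => g x) (D.localInverse_comp_param hdet.isUnit (hminors.trans hJ) hpsi.isUnit)
  refine nonempty_algEquiv_localization Q p q (D.localInverse ε f) hq φ ?_ r (D.localInverse π f) ?_ ?_ ?_
  · intro b
    obtain ⟨x, rfl⟩ := Ideal.Quotient.mk_surjective b
    rw [hφ, hq, hp, hinv]
  · rw [D.localInverse_map r hdetπ hπ hpsiπ, hrπ]
  · intro b
    obtain ⟨x, rfl⟩ := Ideal.Quotient.mk_surjective b
    rw [hφ]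
    exact congrArg (fun g => g x) (D.localInverse_comp_param hdetπ hπ hpsiπ)
  · intro χ hχ
    let ι : D.Ring →ₐ[k] Q := IsScalarTower.toAlgHom k _ _
    -- Base change of the local inverse along `χ` computes the parameters of the parametrized form
    -- over `Q`, which are the coordinates themselves; this is the second composite.
    have hχπ : χ.comp π = ι.comp D.param := AlgHom.ext fun x => hχ (Ideal.Quotient.mk J x)
    have h1 := D.localInverse_map χ hdetπ hπ hpsiπ
    rw [hχπ, D.localInverse_comp_algebraMap_param hd hcard ι hl] at h1
    · intro x
      exact congrArg (fun g => g x) h1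
    · rw [← hχπ, ← pivot_map]
      exact hdetπ.map χ
    · rw [← hχπ, D.relCoeff_map χ hdetπ hπ, ← det_psi_map]
      exact hpsiπ.map χ

end Chart

/-! ### Left inverses of injective matrices -/

section LeftInverse

variable {k ι κ : Type*} [Field k] [Fintype ι] [Fintype κ] [DecidableEq κ]

lemma exists_left_inverse_of_mulVec (M : Matrix ι κ k) (hM : ∀ W, M.mulVec W = 0 → W = 0) :
    ∃ L : Matrix κ ι k, L * M = 1 := by
  classical
  obtain ⟨g, hg⟩ := LinearMap.exists_leftInverse_of_injective M.mulVecLin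
    (LinearMap.ker_eq_bot'.2 hM)
  refine ⟨LinearMap.toMatrix' g, ?_⟩
  apply Matrix.toLin'.injective
  rw [Matrix.toLin'_mul, Matrix.toLin'_toMatrix', Matrix.toLin'_apply', hg, Matrix.toLin'_one]

/-- Add the coordinate functional at `u` as an extra row of `M`. The column of the left inverse
belonging to that row is `l`. -/
lemma exists_left_inverse_of_mulVec_add (M : Matrix ι κ k) (u : κ)
    (hM : ∀ W, M.mulVec W = 0 → W u = 0 → W = 0) :
    ∃ (L : Matrix κ ι k) (l : κ → k), L * M + Matrix.vecMulVec l (Pi.single u 1) = 1 := by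
  obtain ⟨L, hL⟩ := exists_left_inverse_of_mulVec
    (Matrix.fromRows M (Matrix.of fun _ : Unit => Pi.single u (1 : k))) fun W hW => by
      rw [Matrix.fromRows_mulVec] at hW
      refine hM W (funext fun i => congrFun hW (Sum.inl i)) ?_
      have := congrFun hW (Sum.inr ())
      simpa [Matrix.mulVec, single_dotProduct] using this
  refine ⟨L.submatrix id Sum.inl, fun v => L v (Sum.inr ()), ?_⟩
  rw [← hL]
  ext i j
  simp [Matrix.mul_apply, Matrix.vecMulVec_apply]

end LeftInverse

/-! ### The chart centred at a form of U_Res -/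

section ChartExistence

open MvPolynomial

variable {k : Type*} [Field k] {n d : ℕ}

lemma lt_dimForms (hn : 2 ≤ n) (hd : 2 ≤ d) : n < dimForms n d := by
  obtain ⟨m, rfl⟩ := Nat.exists_eq_add_of_le' hn
  have h1 : (m + 3).choose (m + 1) ≤ dimForms (m + 2) d :=
    Nat.choose_le_choose (m + 1) (by omega)
  refine lt_of_lt_of_le ?_ h1
  rw [Nat.choose_symm_of_eq_add (show m + 3 = (m + 1) + 2 by ring), Nat.choose_two_right,
    Nat.lt_iff_add_one_le, Nat.le_div_iff_mul_le two_pos]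
  exact Nat.mul_le_mul (by omega) (by omega)

lemma le_mul_pred (hn : 2 ≤ n) (hd : 2 ≤ d) : d ≤ n * (d - 1) := by
  calc d ≤ 2 * (d - 1) := by omega
    _ ≤ n * (d - 1) := Nat.mul_le_mul_right _ hn

/-- The base point is given by the relations of `F` itself. They generate an ideal containing F^⊥ ∩
S_d, so the resultant condition makes them a complete intersection. Its functionals form a line in
degree s and vanish in degree s + 1, which provides the two left inverses. -/
lemma exists_chart [IsAlgClosed k] [CharZero k] (hn : 2 ≤ n) (hd : 2 ≤ d)
    {F : MvPolynomial (Fin n) k} (hF : F ∈ URes k n d) :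
    ∃ (D : Chart k n d (n * (d - 1))) (f : {b // b ∈ D.N} → Mon n (n * (d - 1) - d)),
      Fintype.card {a // a ∉ D.N} = n ∧ D.N.card + n = dimForms n d ∧ D.l D.u₀ = 1 ∧
      (D.pivot (formEval (n * (d - 1)) F) f).det ≠ 0 ∧
      (D.psi (D.relCoeff (formEval (n * (d - 1)) F) f)).det ≠ 0 ∧
      ∀ i, hilbertFn F i = seqT n d i := by
  obtain ⟨hFs, hfin, b, hb⟩ := hF
  have hds := le_mul_pred hn hd
  have hd0 : 0 < d := by omega
  set s := n * (d - 1) with hs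
  have hFsum := hilbertFn_add_finrank_annihilatorDeg F d
  rw [hfin, card_mon (by omega)] at hFsum
  obtain ⟨N, c, hN, hli, hann, hspan⟩ := exists_relForm_mem_annihilator hds hFs
  rw [← hN] at hFsum
  have hcard : Fintype.card {a // a ∉ N} = n := by
    rw [Fintype.card_subtype_compl, Fintype.card_coe, card_mon (by omega)]
    omega
  have hrad : ∀ j, X j ∈ (Ideal.span (Set.range (relForm c))).radical :=
    mem_radical_of_resultantNeZero hb fun i => hspan _ (b i).2
  have hIann := span_relForm_le_annihilator hann
  -- For `F = 0` the catalecticant has no independent columns, so `N` would be empty and K = n,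
  -- against K > n.
  have hF0 : F ≠ 0 := by
    rintro rfl
    have h1 : ((catMatrix k n s d).map (formEval s (0 : MvPolynomial (Fin n) k))) = 0 := by
      ext i j
      have h := mfact_mul_catMatrix (formEval s (0 : MvPolynomial (Fin n) k)) i j
      rw [evForm_apply, Finset.sum_eq_zero fun u _ => by simp [formEval]] at h
      exact (mul_eq_zero.1 h).resolve_left (Nat.cast_ne_zero.2 (mfact_ne_zero _))
    have h2 : N.card = 0 := by
      rw [Finset.card_eq_zero, Finset.eq_empty_iff_forall_notMem]
      intro x hx
      exact hli.ne_zero ⟨x, hx⟩ (by rw [h1]; rfl)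
    have := lt_dimForms hn hd
    omega
  let W : Mon n s → k := fun u => (mfact u.1 : k) * coeff u.1 F
  have hWmem := mem_killSpace_of_le_annihilator hFs hIann
  change W ∈ _ at hWmem
  have hW0 : W ≠ 0 := by
    intro h0
    apply hF0
    ext m
    rw [coeff_zero]
    by_cases hm : m.degree = s
    · have := congrFun h0 ⟨m, hm⟩
      exact (mul_eq_zero.1 this).resolve_left (Nat.cast_ne_zero.2 (mfact_ne_zero _))
    · exact hFs.coeff_eq_zero hm
  obtain ⟨u₀, hu₀⟩ := Function.ne_iff.1 hW0
  have hkill : ∀ V ∈ killSpace (Ideal.span (Set.range (relForm c))) s, ∃ t : k, t • W = V := by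
    have h1 := finrank_killSpace (isHomogeneous_span_relForm c) s
    rw [hilb_eq_seqT hd0 hcard (isHomogeneous_relForm c) hrad, seqT_top hd0] at h1
    intro V hV
    obtain ⟨t, ht⟩ := (finrank_eq_one_iff_of_nonzero' (⟨W, hWmem⟩ : killSpace _ s)
      fun h => hW0 (congrArg Subtype.val h)).1 h1 ⟨V, hV⟩
    exact ⟨t, congrArg Subtype.val ht⟩
  obtain ⟨L, l, hL⟩ := exists_left_inverse_of_mulVec_add (relMatrix c (s - d) s) u₀
    fun V hV hVu => by
      obtain ⟨t, rfl⟩ := hkill V ((mem_killSpace_iff (by omega)).2 hV)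
      rw [Pi.smul_apply, smul_eq_mul] at hVu
      rw [(mul_eq_zero.1 hVu).resolve_right hu₀, zero_smul]
  obtain ⟨L', hL'⟩ := exists_left_inverse_of_mulVec (relMatrix c (s - d + 1) (s + 1)) fun V hV => by
    have h1 := finrank_killSpace (isHomogeneous_span_relForm c) (s + 1)
    rw [hilb_eq_seqT hd0 hcard (isHomogeneous_relForm c) hrad, seqT_eq_zero hd0 (by omega),
      Submodule.finrank_eq_zero] at h1
    have : V ∈ killSpace (Ideal.span (Set.range (relForm c))) (s + 1) :=
      (mem_killSpace_iff (by omega)).2 hV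
    rwa [h1, Submodule.mem_bot] at this
  let D : Chart k n d s := ⟨N, c, u₀, L, l, L', hds, by convert hL, by convert hL'⟩
  obtain ⟨f, -, hf⟩ := exists_rows_det_ne_zero
    (((catMatrix k n s d).map (formEval s F)).submatrix id fun b : {b // b ∈ N} => b.1) hli
  have hdet : (D.pivot (formEval s F) f).det ≠ 0 := by
    convert hf using 2
    rfl
  have hWrel : (relMatrix c (s - d) s).mulVec W = 0 := (mem_killSpace_iff (by omega)).1 hWmem
  have hc : D.relCoeff (formEval s F) f = c := by
    refine D.relCoeff_unique hdet.isUnit ((relMatrix_mulVec_eq_zero_iff _ c).1 ?_)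
    convert hWrel using 2
    funext u
    rw [formEval, aeval_X]
  refine ⟨D, f, hcard, hFsum, ?_, hdet, ?_, hilbertFn_eq_seqT hd0 hFs hF0 hcard hrad hIann⟩
  -- At the base point ψ = 1, so W = W(u₀)·l; compare the coordinates at `u₀`, where W is nonzero.
  · have h1 := D.psi_mulVec (c := D.c₀) hWrel
    rw [D.psi_base, Matrix.one_mulVec] at h1
    have h2 := congrFun h1 u₀
    exact (mul_left_cancel₀ hu₀ ((mul_one _).trans h2)).symm
  · rw [hc]
    have := D.psi_base
    change D.psi c = 1 at this
    rw [this, Matrix.det_one]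
    exact one_ne_zero

end ChartExistence

/-! ### The ideals of 𝐕 and 𝐆𝐨𝐫_≤(T) -/

section Ideals

open MvPolynomial

variable {k : Type*} [Field k] {n d : ℕ}

instance (n : ℕ) : Subsingleton (Mon n 0) :=
  ⟨fun a b => Subtype.ext ((Finsupp.degree_eq_zero_iff _).1 a.2 |>.trans
    ((Finsupp.degree_eq_zero_iff _).1 b.2).symm)⟩

lemma minorsIdeal_eq_bot_of_card_lt {ι κ R : Type*} [CommRing R] [Fintype ι] (A : Matrix ι κ R)
    {r : ℕ} (h : Fintype.card ι < r) : minorsIdeal A r = ⊥ := by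
  rw [minorsIdeal, Ideal.span_eq_bot]
  rintro _ ⟨p, -, -⟩
  have := Fintype.card_le_of_embedding p
  rw [Fintype.card_fin] at this
  omega

/-- An ideal that defines a scheme of forms contained in `𝐕` and containing all forms
annihilated by a complete intersection of forms of degree `d`. -/
structure IsBetween (J : Ideal (CoeffRing k n (n * (d - 1)))) : Prop where
  idealV_le : idealV k n d ≤ J
  le_ker : ∀ ρ : CoeffRing k n (n * (d - 1)) →ₐ[k] k,
    (∀ i, hilbertFn (formOf fun m => ρ (X m)) i ≤ seqT n d i) → J ≤ RingHom.ker ρ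

variable [CharZero k]

lemma isBetween_idealV (hd : d ≤ n * (d - 1)) (hT : seqT n d d + n = dimForms n d) :
    IsBetween (idealV k n d) where
  idealV_le := le_rfl
  le_ker ρ hρ := by
    refine minorsIdeal_le_ker _ (ρ : CoeffRing k n (n * (d - 1)) →+* k) ?_
    have h1 := rank_catMatrix_map hd ρ
    have h2 := hρ d
    rw [← h1] at h2
    change ((catMatrix k n (n * (d - 1)) d).map ρ).rank < _
    omega

lemma isBetween_idealGor (hd : d ≤ n * (d - 1)) (hd2 : 2 ≤ d)
    (hT : seqT n d d + n = dimForms n d) :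
    IsBetween (idealGor k n d) where
  idealV_le := by
    have hsize : dimForms n d - n + 1 = seqT n d d + 1 := by omega
    rw [idealV, hsize]
    by_cases h : d ≤ n * (d - 1) - 1
    · exact le_iSup₂_of_le d (Finset.mem_Icc.2 ⟨by omega, h⟩) le_rfl
    -- Here n = d = 2 and the degree d equals s, outside the range of the ideal of 𝐆𝐨𝐫_≤(T). The
    -- matrix has a single row, so the 2-minors generating the ideal of 𝐕 do not exist.
    · have hs : n * (d - 1) = d := by omega
      have hT1 : seqT n d d = 1 := by
        have := seqT_top (n := n) (d := d) (by omega)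
        rwa [hs] at this
      have : n * (d - 1) - d = 0 := by omega
      have hsub : Subsingleton (Mon n (n * (d - 1) - d)) := by
        rw [this]; infer_instance
      rw [minorsIdeal_eq_bot_of_card_lt]
      · exact bot_le
      · have := Fintype.card_le_one_iff_subsingleton.2 hsub
        omega
  le_ker ρ hρ := by
    refine iSup₂_le fun i hi => minorsIdeal_le_ker _ (ρ : CoeffRing k n (n * (d - 1)) →+* k) ?_
    have hi2 := (Finset.mem_Icc.1 hi).2
    have h1 := rank_catMatrix_map (show i ≤ n * (d - 1) by omega) ρ
    have h2 := hρ i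
    rw [← h1] at h2
    exact Nat.lt_succ_of_le h2

variable [IsAlgClosed k]

lemma hilbertFn_of_mem_URes (hn : 2 ≤ n) (hd : 2 ≤ d) {F : MvPolynomial (Fin n) k}
    (hF : F ∈ URes k n d) (i : ℕ) : hilbertFn F i = seqT n d i := by
  obtain ⟨D, f, -, -, -, -, -, h⟩ := exists_chart hn hd hF
  exact h i

lemma seqT_add_of_mem_URes (hn : 2 ≤ n) (hd : 2 ≤ d) {F : MvPolynomial (Fin n) k}
    (hF : F ∈ URes k n d) : seqT n d d + n = dimForms n d := by
  rw [← hilbertFn_of_mem_URes hn hd hF, ← card_mon (by omega),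
    ← hilbertFn_add_finrank_annihilatorDeg F d, hF.2.1]

lemma IsBetween.le_ker_formEval {J : Ideal (CoeffRing k n (n * (d - 1)))} (hJ : IsBetween J)
    (hn : 2 ≤ n) (hd : 2 ≤ d) {F : MvPolynomial (Fin n) k} (hF : F ∈ URes k n d) :
    J ≤ RingHom.ker (formEval (n * (d - 1)) F) := by
  refine hJ.le_ker _ fun i => ?_
  rw [formOf_formEval hF.1, hilbertFn_of_mem_URes hn hd hF]

/-- The local ring at a form of `U_Res` is the local ring of an affine space at a rational
point. -/
lemma IsBetween.isRegularRing_and_ringKrullDim {J : Ideal (CoeffRing k n (n * (d - 1)))}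
    (hJ : IsBetween J) (hn : 2 ≤ n) (hd : 2 ≤ d) {F : MvPolynomial (Fin n) k}
    (hF : F ∈ URes k n d) (p : Ideal (CoeffRing k n (n * (d - 1)) ⧸ J)) [p.IsPrime]
    (hp : ∀ x, Ideal.Quotient.mk J x ∈ p ↔ formEval (n * (d - 1)) F x = 0) :
    IsRegularRing (Localization.AtPrime p) ∧
      ringKrullDim (Localization.AtPrime p) = (n * (dimForms n d - n) + 1 : ℕ) := by
  obtain ⟨D, f, hcard, hN, hl, hdet, hpsi, -⟩ := exists_chart hn hd hF
  let q : Ideal D.Ring := RingHom.ker (D.localInverse (formEval (n * (d - 1)) F) f)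
  have hqp : q.IsPrime := RingHom.ker_isPrime _
  have hsize : D.N.card + 1 = dimForms n d - n + 1 := by omega
  have hd0 : 0 < d := by omega
  obtain ⟨e⟩ := D.nonempty_algEquiv hd0 hcard hl hdet hpsi
    (by rw [hsize]; exact hJ.idealV_le) (hJ.le_ker_formEval hn hd hF)
    (D.le_ker_param hd0 hcard hJ.le_ker) p hp q (fun x => Iff.rfl) (Localization.AtPrime p)
    (Localization.AtPrime q)
  have hreg : IsRegularRing (Localization.AtPrime q) := isRegularRing_localization _
  refine ⟨IsRegularRing.of_ringEquiv e.symm.toRingEquiv, ?_⟩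
  rw [ringKrullDim_eq_of_ringEquiv e.toRingEquiv,
    IsLocalization.AtPrime.ringKrullDim_eq_height q]
  have hq : q.height = Nat.card (Option ({a // a ∉ D.N} × {b // b ∈ D.N})) := height_ker_aeval _
  have hNc : D.N.card = dimForms n d - n := by omega
  rw [hq, Nat.card_eq_fintype_card, Fintype.card_option, Fintype.card_prod, hcard,
    Fintype.card_coe, hNc]
  rfl

end Ideals

/-! ### Passage to schemes -/

section Schemes

universe u

/-- Regularity means that the cotangent space has dimension equal to the Krull dimension. -/
lemma tangentDim_eq (X : Scheme.{u}) (x : X) (h : IsSmoothAt X x) {m : ℕ}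
    (hm : ringKrullDim (X.presheaf.stalk x) = m) : tangentDim X x = m := by
  have h' : IsRegularLocalRing (X.presheaf.stalk x) := h
  have h1 := (IsRegularLocalRing.iff_finrank_cotangentSpace _).1 h'
  rw [hm] at h1
  rw [tangentDim, Subspace.dual_finrank_eq]
  exact_mod_cast h1

variable {k : Type u} [Field k] [CharZero k] [IsAlgClosed k] {n d : ℕ}

/-- A point specializing to `v` is a prime contained in that of `F`, so its local ring is a
localization of the regular local ring at `F`. -/
lemma IsBetween.exists_point {J : Ideal (CoeffRing k n (n * (d - 1)))}
    (hJ : IsBetween J) (hn : 2 ≤ n) (hd : 2 ≤ d) {F : MvPolynomial (Fin n) k}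
    (hF : F ∈ URes k n d) :
    ∃ v : Spec (.of (CoeffRing k n (n * (d - 1)) ⧸ J)),
      Spec.map (CommRingCat.ofHom (Ideal.Quotient.mk J)) v = formPoint k n d F ∧
      ringKrullDim ((Spec (.of (CoeffRing k n (n * (d - 1)) ⧸ J))).presheaf.stalk v) =
        (n * (dimForms n d - n) + 1 : ℕ) ∧
      ∀ x : Spec (.of (CoeffRing k n (n * (d - 1)) ⧸ J)), x ⤳ v → IsSmoothAt _ x := by
  have hker := hJ.le_ker_formEval hn hd hF
  let ε : (CoeffRing k n (n * (d - 1)) ⧸ J) →+* k :=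
    Ideal.Quotient.lift J (formEval (n * (d - 1)) F : CoeffRing k n (n * (d - 1)) →+* k) hker
  have hprime : (RingHom.ker ε).IsPrime := RingHom.ker_isPrime _
  have hmem : ∀ x, Ideal.Quotient.mk J x ∈ RingHom.ker ε ↔ formEval (n * (d - 1)) F x = 0 :=
    fun x => Iff.rfl
  obtain ⟨hreg, hdim⟩ := hJ.isRegularRing_and_ringKrullDim hn hd hF (RingHom.ker ε) hmem
  let v : PrimeSpectrum (CoeffRing k n (n * (d - 1)) ⧸ J) := ⟨RingHom.ker ε, hprime⟩
  refine ⟨v, ?_, ?_, ?_⟩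
  · exact PrimeSpectrum.ext (Ideal.ext fun x => Iff.rfl)
  · let _ : Algebra (CoeffRing k n (n * (d - 1)) ⧸ J)
        ((Spec (.of (CoeffRing k n (n * (d - 1)) ⧸ J))).presheaf.stalk v) :=
      StructureSheaf.stalkAlgebra _ v
    have : IsLocalization.AtPrime
        ((Spec (.of (CoeffRing k n (n * (d - 1)) ⧸ J))).presheaf.stalk v) v.asIdeal :=
      StructureSheaf.IsLocalization.to_stalk _ v
    rw [IsLocalization.AtPrime.ringKrullDim_eq_height v.asIdeal, ← hdim]
    exact (IsLocalization.AtPrime.ringKrullDim_eq_height (RingHom.ker ε)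
      (Localization.AtPrime (RingHom.ker ε))).symm
  · intro x hx
    let y : PrimeSpectrum (CoeffRing k n (n * (d - 1)) ⧸ J) := x
    have hyx : y ≤ v := (PrimeSpectrum.le_iff_specializes y v).2 hx
    let _ : Algebra (CoeffRing k n (n * (d - 1)) ⧸ J)
        ((Spec (.of (CoeffRing k n (n * (d - 1)) ⧸ J))).presheaf.stalk x) :=
      StructureSheaf.stalkAlgebra _ y
    have : IsLocalization.AtPrime
        ((Spec (.of (CoeffRing k n (n * (d - 1)) ⧸ J))).presheaf.stalk x) y.asIdeal :=
      StructureSheaf.IsLocalization.to_stalk _ y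
    exact isRegularLocalRing_of_le (p := RingHom.ker ε) hyx _

end Schemes

/-! ### Minors and rank -/

section Minors

/-- Laplace expansion along the first row. -/
lemma minorsIdeal_succ_le {ι κ R : Type*} [CommRing R] (A : Matrix ι κ R) (r : ℕ) :
    minorsIdeal A (r + 1) ≤ minorsIdeal A r := by
  rw [minorsIdeal, Ideal.span_le]
  rintro _ ⟨p, q, rfl⟩
  rw [Matrix.det_succ_row_zero]
  refine Ideal.sum_mem _ fun j _ => Ideal.mul_mem_left _ _ (Ideal.subset_span ?_)
  exact ⟨⟨p ∘ Fin.succ, p.injective.comp (Fin.succ_injective r)⟩,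
    ⟨q ∘ j.succAbove, q.injective.comp Fin.succAbove_right_injective⟩, rfl⟩

lemma minorsIdeal_antitone {ι κ R : Type*} [CommRing R] (A : Matrix ι κ R) :
    Antitone (minorsIdeal A) :=
  antitone_nat_of_succ_le (minorsIdeal_succ_le A)

lemma rank_map_le_of_minorsIdeal_le_ker {ι κ A k : Type*} [Finite ι] [Fintype κ] [CommRing A]
    [Field k] (M : Matrix ι κ A) (φ : A →+* k) {r : ℕ}
    (h : minorsIdeal M (r + 1) ≤ RingHom.ker φ) : (M.map φ).rank ≤ r := by
  by_contra! hlt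
  obtain ⟨p, q, hpq⟩ := exists_minor_ne_zero (M.map φ)
  exact hpq (det_submatrix_map_eq_zero M φ ((minorsIdeal_antitone M hlt).trans h) p q)

end Minors

/-! ### Openness of the Hilbert function condition -/

section HilbertFunction

open MvPolynomial

variable {k : Type*} [Field k] [CharZero k] {n d : ℕ}

lemma hilbertFn_eq_zero {s i : ℕ} (hi : s < i) {F : MvPolynomial (Fin n) k}
    (hF : F.IsHomogeneous s) : hilbertFn F i = 0 := by
  have key : (homogeneousSubmodule (Fin n) k i).map
      (Ideal.Quotient.mkₐ k (annihilator F)).toLinearMap = ⊥ := by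
    rw [eq_bot_iff]
    rintro _ ⟨h, hh, rfl⟩
    rw [Submodule.mem_bot]
    refine Ideal.Quotient.eq_zero_iff_mem.2 (mem_annihilator_iff.2 fun g => ?_)
    induction g using MvPolynomial.induction_on' with
    | add p q hp hq => rw [add_mul, map_add, hp, hq, add_zero]
    | monomial a c =>
      rw [pairing_eq_evForm hF]
      have h1 : (monomial a c : MvPolynomial (Fin n) k).IsHomogeneous a.degree :=
        isHomogeneous_monomial c rfl
      exact evForm_of_isHomogeneous _ (h1.mul hh) (by omega)
  rw [hilbertFn, key, finrank_bot]

lemma hilbertFn_eq_rank {s i : ℕ} (hi : i ≤ s) {F : MvPolynomial (Fin n) k}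
    (hF : F.IsHomogeneous s) :
    hilbertFn F i = ((catMatrix k n s i).map (formEval s F)).rank := by
  rw [rank_catMatrix_map hi, formOf_formEval hF]

/-- The nonvanishing of suitable minors cuts out the forms with Hilbert function `T` among those
in `𝐆𝐨𝐫_≤(T)`. -/
lemma exists_formEval_ne_zero (hd : 0 < d) {F : MvPolynomial (Fin n) k} (hF : F ∈ GorSet k n d) :
    ∃ g : CoeffRing k n (n * (d - 1)), formEval (n * (d - 1)) F g ≠ 0 ∧
      ∀ G : MvPolynomial (Fin n) k, G.IsHomogeneous (n * (d - 1)) →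
        idealGor k n d ≤ RingHom.ker (formEval (n * (d - 1)) G) →
        formEval (n * (d - 1)) G g ≠ 0 → G ∈ GorSet k n d := by
  set s := n * (d - 1) with hs
  -- In each degree i ≤ s some minor of size t_i is nonzero at `F`. Nonvanishing of their product
  -- keeps every rank at least t_i; beyond s the dummy value 1 is never used.
  have hminor : ∀ i : ℕ, ∃ x : CoeffRing k n s, formEval s F x ≠ 0 ∧
      (i ≤ s → x ∈ minorsIdeal (catMatrix k n s i) (seqT n d i)) := by
    intro i
    by_cases hi : i ≤ s
    · obtain ⟨p, q, hpq⟩ := exists_minor_ne_zero ((catMatrix k n s i).map (formEval s F))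
      refine ⟨((catMatrix k n s i).submatrix p q).det, ?_, fun _ => ?_⟩
      · intro h0
        exact hpq ((RingHom.map_det (formEval s F : CoeffRing k n s →+* k)
          ((catMatrix k n s i).submatrix p q)).symm.trans h0)
      · rw [← hF.2 i, hilbertFn_eq_rank hi hF.1]
        exact Ideal.subset_span ⟨p, q, rfl⟩
    · exact ⟨1, by simp, fun h => absurd h hi⟩
  choose x hx hxmem using hminor
  refine ⟨∏ i ∈ Finset.range (s + 1), x i, ?_, fun G hG hker hne => ⟨hG, fun i => ?_⟩⟩
  · rw [map_prod]
    exact Finset.prod_ne_zero_iff.2 fun i _ => hx i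
  rcases lt_or_ge s i with hi | hi
  · rw [hilbertFn_eq_zero hi hG, seqT_eq_zero hd hi]
  rw [hilbertFn_eq_rank hi hG]
  apply le_antisymm
  -- The degrees 0 and s are not among the equations of 𝐆𝐨𝐫_≤(T); there t_i = 1 and the matrix has
  -- at most one column or one row.
  · rcases Nat.eq_zero_or_pos i with rfl | hi0
    · rw [seqT_zero hd]
      exact (Matrix.rank_le_card_width _).trans
        (Fintype.card_le_one_iff_subsingleton.2 inferInstance)
    rcases hi.eq_or_lt with rfl | hlt
    · have hsub : Subsingleton (Mon n (s - s)) := by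
        rw [Nat.sub_self]; infer_instance
      have : seqT n d s = 1 := seqT_top hd
      rw [this]
      exact (Matrix.rank_le_card_height _).trans
        (Fintype.card_le_one_iff_subsingleton.2 hsub)
    · refine rank_map_le_of_minorsIdeal_le_ker _ (formEval s G : CoeffRing k n s →+* k)
        (le_trans ?_ hker)
      exact le_iSup₂_of_le i (Finset.mem_Icc.2 ⟨hi0, by omega⟩) le_rfl
  · by_contra! hlt
    have h1 := minorsIdeal_le_ker (catMatrix k n s i) (formEval s G : CoeffRing k n s →+* k) hlt
      (hxmem i hi)
    rw [map_prod, Finset.prod_ne_zero_iff] at hne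
    exact hne i (Finset.mem_range.2 (by omega)) h1

end HilbertFunction

/-! ### The open subscheme 𝐆𝐨𝐫(T) -/

section Gor

universe u

variable {k : Type u} [Field k] {n d : ℕ}

lemma mem_iff_of_ι_eq_formPoint {F : MvPolynomial (Fin n) k} (w : schemeGorLe k n d)
    (h : schemeGorLe.ι k n d w = formPoint k n d F) (x : CoeffRing k n (n * (d - 1))) :
    Ideal.Quotient.mk (idealGor k n d) x ∈
      (show PrimeSpectrum (CoeffRing k n (n * (d - 1)) ⧸ idealGor k n d) from w).asIdeal ↔
    formEval (n * (d - 1)) F x = 0 := by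
  have h1 := congrArg (fun y : PrimeSpectrum (CoeffRing k n (n * (d - 1))) => x ∈ y.asIdeal) h
  exact iff_of_eq h1

/-- The basic open set of the function from `exists_formEval_ne_zero` is one of the open sets whose
union is `gorOpen`, and it contains the point of `F`. -/
lemma mem_gorOpen [CharZero k] (hd : 0 < d) {F : MvPolynomial (Fin n) k} (hF : F ∈ GorSet k n d)
    (v : schemeGorLe k n d) (hv : schemeGorLe.ι k n d v = formPoint k n d F) :
    v ∈ gorOpen k n d := by
  obtain ⟨g, hg, hG⟩ := exists_formEval_ne_zero hd hF
  let O : (schemeGorLe k n d).Opens :=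
    (PrimeSpectrum.basicOpen (Ideal.Quotient.mk (idealGor k n d) g) :
      TopologicalSpace.Opens (PrimeSpectrum (CoeffRing k n (n * (d - 1)) ⧸ idealGor k n d)))
  refine TopologicalSpace.Opens.mem_sSup.2 ⟨O, ?_, ?_⟩
  · intro G hGh w hw hwG
    have hmem := mem_iff_of_ι_eq_formPoint w hwG
    refine hG G hGh (fun x hx => ?_) fun h0 => hw ((hmem g).2 h0)
    rw [RingHom.mem_ker, ← hmem, Ideal.Quotient.eq_zero_iff_mem.2 hx]
    exact Ideal.zero_mem _
  · exact fun h => hg ((mem_iff_of_ι_eq_formPoint v hv g).1 h)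

end Gor

lemma cast_tangentDim {n d : ℕ} (hn : 2 ≤ n) (hd : 2 ≤ d) :
    ((n * (dimForms n d - n) + 1 : ℕ) : ℤ) = (dimForms n d : ℤ) * n - n ^ 2 + 1 := by
  have := (lt_dimForms hn hd).le
  push_cast [Nat.cast_sub this]
  ring

end Catalecticant

theorem mainTheorem1 {k : Type*} [Field k] [IsAlgClosed k] [CharZero k] {n d : ℕ}
    (hn : 2 ≤ n) (hd : 2 ≤ d)
    (F : MvPolynomial (Fin n) k) (hF : F ∈ Catalecticant.URes k n d) :
    (∃ v : Catalecticant.schemeV k n d,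
      Catalecticant.schemeV.ι k n d v = Catalecticant.formPoint k n d F ∧
      (Catalecticant.tangentDim (Catalecticant.schemeV k n d) v : ℤ) =
        (Catalecticant.dimForms n d : ℤ) * n - n ^ 2 + 1 ∧
      ∀ x : Catalecticant.schemeV k n d, x ⤳ v →
        Catalecticant.IsSmoothAt (Catalecticant.schemeV k n d) x) ∧
    (∃ v : Catalecticant.schemeGor k n d,
      Catalecticant.schemeGor.ι k n d v = Catalecticant.formPoint k n d F ∧
      (Catalecticant.tangentDim (Catalecticant.schemeGor k n d) v : ℤ) =
        (Catalecticant.dimForms n d : ℤ) * n - n ^ 2 + 1 ∧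
      ∀ x : Catalecticant.schemeGor k n d, x ⤳ v →
        Catalecticant.IsSmoothAt (Catalecticant.schemeGor k n d) x) := by
  open Catalecticant in
  have hds := le_mul_pred hn hd
  have hT := seqT_add_of_mem_URes hn hd hF
  constructor
  · obtain ⟨v, hv, hdim, hreg⟩ := (isBetween_idealV hds hT).exists_point hn hd hF
    refine ⟨v, hv, ?_, hreg⟩
    rw [← cast_tangentDim hn hd]
    exact congrArg _ (tangentDim_eq _ v (hreg v (specializes_refl v)) hdim)
  · obtain ⟨v, hv, hdim, hreg⟩ := (isBetween_idealGor hds hd hT).exists_point hn hd hF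
    have hmem : v ∈ gorOpen k n d :=
      mem_gorOpen (by omega) ⟨hF.1, hilbertFn_of_mem_URes hn hd hF⟩ v hv
    -- The stalks of an open subscheme are those of the ambient scheme, so regularity and Krull
    -- dimension transfer from 𝐆𝐨𝐫_≤(T).
    let e : ∀ x : gorOpen k n d, (schemeGor k n d).presheaf.stalk x ≃+*
        (schemeGorLe k n d).presheaf.stalk x.1 := fun x =>
      ((gorOpen k n d).stalkIso x).commRingCatIsoToRingEquiv
    have hsm : ∀ x : gorOpen k n d, x ⤳ (⟨v, hmem⟩ : gorOpen k n d) →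
        IsSmoothAt (schemeGor k n d) x := by
      intro x hx
      have h1 : IsRegularLocalRing ((schemeGorLe k n d).presheaf.stalk x.1) :=
        hreg x.1 (hx.map continuous_subtype_val)
      exact IsRegularLocalRing.of_ringEquiv (e x).symm
    refine ⟨(⟨v, hmem⟩ : gorOpen k n d), ?_, ?_, hsm⟩
    · rw [← hv]
      rfl
    · rw [← cast_tangentDim hn hd]
      refine congrArg _ (tangentDim_eq (schemeGor k n d) (⟨v, hmem⟩ : gorOpen k n d)
        (hsm _ (specializes_refl _)) ?_)
      rw [ringKrullDim_eq_of_ringEquiv (e ⟨v, hmem⟩)]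
      exact hdim
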